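/- **Conventions.** All algebras are complex. In a unital $*$-algebra $C$ an element $a$ is *positive* if for every $\delta>0$ the element $a+\delta 1$ is a finite sum of elements $x^*x$, $x\in C$ (in a C$^*$-algebra this is the usual notion). A linear map $\varphi:C\to D$ is *completely positive* if for every $n$ the map $[c_{pq}]\mapsto[\varphi(c_{pq})]$ sends positive elements of $M_n(C)$ to positive elements of $M_n(D)$. A *state* is a unital linear functional $\tau$ with $\tau(a^*a)\ge 0$ for all $a$. Let $B$ be a unital $*$-algebra in which every element is bounded, i.e. for every $b\in B$ there is $c\in\mathbb R$ such that $c1-b^*b$ is positive (every unital C$^*$-algebra has this property). A *$B$-$B$-non-commutative probability space* $(A,E,\varepsilon)$ consists of a unital $*$-algebra $A$, a unital $*$-homomorphism $\varepsilon:B\otimes B^{\mathrm{op}}\to A$, with $L_b=\varepsilon(b\otimes1)$ and $R_b=\varepsilon(1\otimes b)$, such that $b\mapsto L_b$ and $b\mapsto R_b$ are injective, and a unital linear map $E:A\to B$ with $E(L_{b_1}R_{b_2}a)=b_1E(a)b_2$ and $E(aL_b)=E(aR_b)$. Its left (right) algebra is the commutant in $A$ of $\{R_b\}$ (of $\{L_b\}$).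 Together with $\tau:A\to\mathbb C$ it is *analytical* if $\tau$ is a state, $\tau(a)=\tau(L_{E(a)})=\tau(R_{E(a)})$ for all $a\in A$, $b\mapsto\tau(L_b)$ is tracial, for every $a\in A$ there is $c$ with $\tau((ax)^*(ax))\le c\,\tau(x^*x)$ for all $x\in A$, and $E$ is completely positive as a map from the left algebra to $B$ and as a map from the right algebra to $B^{\mathrm{op}}$. *Cumulants.* For $\chi\in\{\ell,r\}^n$ the $\chi$-order on $\{1,\dots,n\}$ lists first the indices with $\chi(k)=\ell$ increasingly, then those with $\chi(k)=r$ decreasingly; $BNC(\chi)$ is the lattice (under refinement) of partitions that are non-crossing for the $\chi$-order, and $\mu_{BNC}$ is its Möbius function. For $Z_k$ in the left algebra if $\chi(k)=\ell$ and in the right algebra if $\chi(k)=r$, the moment $E_\pi(Z_1,\dots,Z_n)\in B$, $\pi\in BNC(\chi)$, is obtained by removing the blocks of $\pi$ in the decreasing $\chi$-order of their $\chi$-minima: a block $V$ with $b=E(\prod_{k\in V}Z_k)$ (product in the natural order) is removed by replacing $Z_p$, where $p$ is the immediate $\chi$-predecessor of the $\chi$-minimum of $V$, by $Z_pL_b$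 if $\chi(p)=\ell$ and by $R_bZ_p$ if $\chi(p)=r$; for the last block, $b$ is the value. (This is the bi-multiplicative function with $E_{1_\chi}(Z_1,\dots,Z_n)=E(Z_1\cdots Z_n)$.) Put $\kappa_{1_\chi}(Z_1,\dots,Z_n)=\sum_{\sigma\in BNC(\chi)}E_\sigma(Z_1,\dots,Z_n)\,\mu_{BNC}(\sigma,1_\chi)$. *The operators.* Let $I,J$ be finite index sets, $K=I\sqcup J\neq\emptyset$, and let $\eta_k:B\to B$ $(k\in K)$ be completely positive; put $\eta_{k,k}=\eta_k$ and $\eta_{k,k'}=0$ for $k\ne k'$. Let $\mathcal F=B\oplus\bigoplus_{m\ge1}H_m$ be the algebraic full Fock space, where $H_m=\bigoplus_{k_1,\dots,k_m\in K}B^{\otimes(m+1)}$ is spanned by the words $b_0Z_{k_1}b_1\cdots Z_{k_m}b_m$. Let $L_b,R_b$ be left and right multiplication by $b$ on $\mathcal F$, and let $$l_k(w)=1Z_kw,\quad l_k^*(b)=0,\quad l_k^*(b_0Z_{k_1}b_1\cdots Z_{k_m}b_m)=\eta_{k,k_1}(b_0)b_1Z_{k_2}\cdots Z_{k_m}b_m,$$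 $$r_k(w)=wZ_k1,\quad r_k^*(b)=0,\quad r_k^*(b_0Z_{k_1}\cdots b_{m-1}Z_{k_m}b_m)=b_0Z_{k_1}\cdots Z_{k_{m-1}} b_{m-1}\eta_{k_m,k}(b_m).$$ Put $S_i=l_i+l_i^*$ $(i\in I)$ and $D_j=r_j+r_j^*$ $(j\in J)$, let $A$ be the algebra of linear maps on $\mathcal F$ generated by $\mathrm{alg}(\{L_b\}_{b\in B},\{S_i\}_{i\in I})$ and $\mathrm{alg}(\{R_b\}_{b\in B},\{D_j\}_{j\in J})$, let $\varepsilon(b_1\otimes b_2)=L_{b_1}R_{b_2}$, and let $E(T)$ be the $B$-component of $T1_B$. Let $\tau_B$ be a tracial state on $B$ and $\tau=\tau_B\circ E$. **Theorem.** There is an involution on $A$ making $A$ a $*$-algebra with $L_b^*=L_{b^*}$, $R_b^*=R_{b^*}$, $S_i^*=S_i$, $D_j^*=D_j$, such that each $S_i$ is in the left algebra, each $D_j$ is in the right algebra, and $(A,E,\varepsilon,\tau)$ is an analytical $B$-$B$-non-commutative probability space. All operator-valued bi-free cumulants of $\{S_i\},\{D_j\}$ of order $n\ge1$, $n\neq2$,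 vanish: $\kappa_{1_\chi}(Z_1,\dots,Z_n)=0$ whenever each $Z_k$ is of the form $L_bS_iL_{b'}$ (if $\chi(k)=\ell$) or $R_bD_jR_{b'}$ (if $\chi(k)=r$). For all $i,i_1,i_2\in I$, $j,j_1,j_2\in J$ and $b\in B$, $$\kappa_{1_{(\ell,\ell)}}(S_{i_1}L_b,S_{i_2})=\delta_{i_1,i_2}\eta_{i_1}(b),\qquad \kappa_{1_{(r,r)}}(D_{j_1}R_b,D_{j_2})=\delta_{j_1,j_2}\eta_{j_1}(b),$$ $$\kappa_{1_{(\ell,r)}}(S_iL_b,D_j)=0,\qquad \kappa_{1_{(r,\ell)}}(D_jR_b,S_i)=0.$$ -/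

import Mathlib

noncomputable section

namespace BiFree

open scoped TensorProduct ComplexOrder
open MulOpposite (op)

universe u

/-! ### Positivity in unital complex star-algebras -/

/-- Positive elements of a unital star-algebra: `a` is positive if, for every `δ > 0`, the element
`a + δ 1` is a finite sum of hermitian squares `x* x`. In a C*-algebra, and in the matrices over a
C*-algebra, these are exactly the usual positive elements. -/
def IsPositive {C : Type*} [Ring C] [StarRing C] [Algebra ℂ C] (a : C) : Prop :=
  ∀ δ : ℝ, 0 < δ →
    a + algebraMap ℂ C (δ : ℂ) ∈ AddSubmonoid.closure (Set.range fun x : C => star x * x)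

/-- Complete positivity: every matrix amplification maps positive matrices to positive matrices. -/
def IsCompletelyPositive {C D : Type*} [Ring C] [StarRing C] [Algebra ℂ C]
    [Ring D] [StarRing D] [Algebra ℂ D] (φ : C →ₗ[ℂ] D) : Prop :=
  ∀ (n : ℕ) (M : Matrix (Fin n) (Fin n) C), IsPositive M → IsPositive (M.map φ)

/-- Every element is bounded: for every `b` there is a real `c` such that `c 1 - b* b` is
positive. Every C*-algebra, and every star-algebra generated by partial isometries, is of this
kind. -/
def IsBoundedStarAlgebra (C : Type*) [Ring C] [StarRing C] [Algebra ℂ C] : Prop :=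
  ∀ b : C, ∃ c : ℝ, IsPositive (algebraMap ℂ C (c : ℂ) - star b * b)

/-- States: unital positive linear functionals. -/
structure IsState {C : Type*} [Ring C] [StarRing C] [Algebra ℂ C] (τ : C →ₗ[ℂ] ℂ) : Prop where
  map_one : τ 1 = 1
  nonneg : ∀ a : C, 0 ≤ τ (star a * a)

/-- Tracial functionals. -/
def IsTracial {C : Type*} [Ring C] [Algebra ℂ C] (τ : C →ₗ[ℂ] ℂ) : Prop :=
  ∀ a b : C, τ (a * b) = τ (b * a)

/-! ### `B`-`B`-non-commutative probability spaces

The structure map `ε : B ⊗ Bᵒᵖ → A` is an algebra homomorphism; its compatibility with the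
involutions is one of the axioms of `IsBBProbabilitySpace`. -/

/-- The left copy `L_b = ε (b ⊗ 1)` of `b`. -/
def leftB {B A : Type*} [Ring B] [Algebra ℂ B] [Ring A] [Algebra ℂ A]
    (ε : B ⊗[ℂ] Bᵐᵒᵖ →ₐ[ℂ] A) (b : B) : A := ε (b ⊗ₜ[ℂ] 1)

/-- The right copy `R_b = ε (1 ⊗ b)` of `b`. -/
def rightB {B A : Type*} [Ring B] [Algebra ℂ B] [Ring A] [Algebra ℂ A]
    (ε : B ⊗[ℂ] Bᵐᵒᵖ →ₐ[ℂ] A) (b : B) : A := ε (1 ⊗ₜ[ℂ] op b)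

/-- `(A, E, ε)` is a `B`-`B`-non-commutative probability space. -/
structure IsBBProbabilitySpace {B A : Type*}
    [Ring B] [StarRing B] [Algebra ℂ B] [StarModule ℂ B]
    [Ring A] [StarRing A] [Algebra ℂ A] [StarModule ℂ A]
    (ε : B ⊗[ℂ] Bᵐᵒᵖ →ₐ[ℂ] A) (E : A →ₗ[ℂ] B) : Prop where
  map_star : ∀ x : B ⊗[ℂ] Bᵐᵒᵖ, ε (star x) = star (ε x)
  left_injective : Function.Injective (leftB ε)
  right_injective : Function.Injective (rightB ε)
  map_one : E 1 = 1
  map_mul : ∀ (b₁ b₂ : B) (a : A), E (ε (b₁ ⊗ₜ[ℂ] op b₂) * a) = b₁ * E a * b₂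
  left_eq_right : ∀ (a : A) (b : B), E (a * leftB ε b) = E (a * rightB ε b)

/-- The left algebra `A_ℓ`: the elements of `A` commuting with all `R_b`.
(`StarSubalgebra.centralizer` is the commutant of the set and of its adjoints; the set of all
`R_b` is closed under adjoints when `ε` preserves the involutions.) -/
def leftAlgebra {B A : Type*} [Ring B] [Algebra ℂ B]
    [Ring A] [StarRing A] [Algebra ℂ A] [StarModule ℂ A]
    (ε : B ⊗[ℂ] Bᵐᵒᵖ →ₐ[ℂ] A) : StarSubalgebra ℂ A :=
  StarSubalgebra.centralizer ℂ (Set.range (rightB ε))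

/-- The right algebra `A_r`: the elements of `A` commuting with all `L_b`. -/
def rightAlgebra {B A : Type*} [Ring B] [Algebra ℂ B]
    [Ring A] [StarRing A] [Algebra ℂ A] [StarModule ℂ A]
    (ε : B ⊗[ℂ] Bᵐᵒᵖ →ₐ[ℂ] A) : StarSubalgebra ℂ A :=
  StarSubalgebra.centralizer ℂ (Set.range (leftB ε))

/-- `(A, E, ε, τ)` is an analytical `B`-`B`-non-commutative probability space.
`bounded` says that left multiplication by any `a` is bounded on `A / N_τ` for the norm
`x ↦ τ (x* x) ^ (1/2)`. On the right algebra, which contains the copy `{R_b}` of `Bᵒᵖ`, complete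
positivity of `E` is meant with values in `Bᵒᵖ`. -/
structure IsAnalyticBBProbabilitySpace {B A : Type*}
    [Ring B] [StarRing B] [Algebra ℂ B] [StarModule ℂ B]
    [Ring A] [StarRing A] [Algebra ℂ A] [StarModule ℂ A]
    (ε : B ⊗[ℂ] Bᵐᵒᵖ →ₐ[ℂ] A) (E : A →ₗ[ℂ] B) (τ : A →ₗ[ℂ] ℂ) : Prop
    extends IsBBProbabilitySpace ε E where
  isState : IsState τ
  compatible_left : ∀ a : A, τ a = τ (leftB ε (E a))
  compatible_right : ∀ a : A, τ a = τ (rightB ε (E a))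
  tracial : ∀ b₁ b₂ : B, τ (leftB ε (b₁ * b₂)) = τ (leftB ε (b₂ * b₁))
  bounded : ∀ a : A, ∃ c : ℝ, ∀ x : A,
    (τ (star (a * x) * (a * x))).re ≤ c * (τ (star x * x)).re
  cp_left : IsCompletelyPositive (E ∘ₗ (leftAlgebra ε).subtype.toAlgHom.toLinearMap)
  cp_right : IsCompletelyPositive
    ((MulOpposite.opLinearEquiv ℂ : B ≃ₗ[ℂ] Bᵐᵒᵖ).toLinearMap ∘ₗ E ∘ₗ
      (rightAlgebra ε).subtype.toAlgHom.toLinearMap)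

/-! ### Bi-non-crossing partitions -/

/-- The two directions `ℓ` and `r`. -/
inductive Side
  | left
  | right

/-- The strict `χ`-order on the indices: first the left indices in increasing order, then the
right indices in decreasing order. -/
def chiLT {n : ℕ} (χ : Fin n → Side) (i j : Fin n) : Prop :=
  match χ i, χ j with
  | .left, .left => i < j
  | .left, .right => True
  | .right, .left => False
  | .right, .right => j < i

open scoped Classical in
/-- The list of all indices in increasing `χ`-order. -/
def chiList {n : ℕ} (χ : Fin n → Side) : List (Fin n) :=
  (List.finRange n).filter (fun k => χ k = Side.left) ++
    ((List.finRange n).filter (fun k => χ k = Side.right)).reverse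

/-- Partitions of the index set are given by their equivalence relations, ordered by refinement.
A partition is bi-non-crossing if it is non-crossing for the `χ`-order. -/
def IsBiNonCrossing {n : ℕ} (χ : Fin n → Side) (π : Setoid (Fin n)) : Prop :=
  ∀ v₁ w₁ v₂ w₂ : Fin n, chiLT χ v₁ w₁ → chiLT χ w₁ v₂ → chiLT χ v₂ w₂ →
    π v₁ v₂ → π w₁ w₂ → π v₁ w₁

/-- `BNC(χ)`, partially ordered by refinement. -/
abbrev BNC {n : ℕ} (χ : Fin n → Side) : Type := {π : Setoid (Fin n) // IsBiNonCrossing χ π}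

instance {n : ℕ} (χ : Fin n → Side) : Fintype (BNC χ) :=
  haveI : Finite (Setoid (Fin n)) :=
    Finite.of_injective (fun (s : Setoid (Fin n)) (a b : Fin n) => s a b) fun s t h => by
      ext a b
      exact iff_of_eq (congrFun (congrFun h a) b)
  Fintype.ofFinite _

instance {n : ℕ} (χ : Fin n → Side) : LocallyFiniteOrder (BNC χ) := by
  classical exact Fintype.toLocallyFiniteOrder

/-- The partition `1_χ` with only one block. -/
def BNC.one {n : ℕ} (χ : Fin n → Side) : BNC χ :=
  ⟨⊤, fun _ _ _ _ _ _ _ _ _ => trivial⟩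

open scoped Classical in
/-- The bi-non-crossing Möbius function (the Möbius function of the finite poset `BNC(χ)`). -/
def moebiusBNC {n : ℕ} (χ : Fin n → Side) (σ π : BNC χ) : ℤ := IncidenceAlgebra.mu ℤ σ π

/-! ### Operator-valued bi-free moments and cumulants -/

open scoped Classical in
/-- The product, in the natural order of the indices, of the entries `Z_k` over the block of `π`
containing `i`. -/
def blockProd {n : ℕ} {A : Type*} [Ring A] (π : Setoid (Fin n)) (Z : Fin n → A) (i : Fin n) : A :=
  (((List.finRange n).filter (fun k => π i k)).map Z).prod

open scoped Classical in
/-- Evaluation of a bi-non-crossing partition by removing its blocks one after the other, those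
with the `χ`-largest `χ`-minimum first. The argument is the list, in decreasing `χ`-order, of the
indices still to be visited. When the visited index `i` is the `χ`-minimum of its block `V`, all
blocks that start after `i` have been removed, so that `V` is a `χ`-interval of what is left. By
bi-multiplicativity, `V` is removed by inserting `b = E(∏_{k ∈ V} Z_k)` at the `χ`-predecessor `p`
of `i`: the entry `Z_p` becomes `Z_p L_b` if `p` is a left index, and `R_b Z_p` if `p` is a right
index. The last block gives the value. -/
def reduceBlocks {n : ℕ} {B A : Type*} [Ring B] [Algebra ℂ B] [Ring A] [Algebra ℂ A]
    (ε : B ⊗[ℂ] Bᵐᵒᵖ →ₐ[ℂ] A) (E : A →ₗ[ℂ] B) (χ : Fin n → Side) (π : Setoid (Fin n)) :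
    List (Fin n) → (Fin n → A) → B
  | [], _ => 1
  | [i], Z => E (blockProd π Z i)
  | i :: p :: l, Z =>
      if ∀ k ∈ p :: l, ¬ π i k then
        reduceBlocks ε E χ π (p :: l) (Function.update Z p
          (match χ p with
            | .left => Z p * leftB ε (E (blockProd π Z i))
            | .right => rightB ε (E (blockProd π Z i)) * Z p))
      else reduceBlocks ε E χ π (p :: l) Z

/-- The operator-valued bi-free moment function `E_π(Z_1, …, Z_n)`, for `Z_k` in the left or the
right algebra according to `χ k`: the bi-multiplicative function whose value at `1_χ` is
`E(Z_1 ⋯ Z_n)`. -/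
def bifreeMoment {n : ℕ} {B A : Type*} [Ring B] [Algebra ℂ B] [Ring A] [Algebra ℂ A]
    (ε : B ⊗[ℂ] Bᵐᵒᵖ →ₐ[ℂ] A) (E : A →ₗ[ℂ] B) (χ : Fin n → Side) (π : BNC χ)
    (Z : Fin n → A) : B :=
  reduceBlocks ε E χ π.1 (chiList χ).reverse Z

/-- The operator-valued bi-free cumulant function
`κ_π(Z_1, …, Z_n) = ∑_{σ ≤ π} E_σ(Z_1, …, Z_n) μ(σ, π)`. -/
def bifreeCumulant {n : ℕ} {B A : Type*} [Ring B] [Algebra ℂ B] [Ring A] [Algebra ℂ A]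
    (ε : B ⊗[ℂ] Bᵐᵒᵖ →ₐ[ℂ] A) (E : A →ₗ[ℂ] B) (χ : Fin n → Side) (π : BNC χ)
    (Z : Fin n → A) : B :=
  open scoped Classical in
  ∑ σ : BNC χ with σ ≤ π, moebiusBNC χ σ π • bifreeMoment ε E χ σ Z

/-! ### The full Fock space -/

/-- The homogeneous part of degree `m` of the algebraic full Fock space: `H_0 = B`, and `H_{m+1}`
is the direct sum over `k ∈ K` of copies of `B ⊗ H_m`; the tensor `single k b ⊗ x` stands for the
word `b Z_k x`. -/
def fockPart (B : Type u) [Ring B] [Algebra ℂ B] (K : Type) : ℕ → ModuleCat.{u} ℂ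
  | 0 => ModuleCat.of ℂ B
  | m + 1 => ModuleCat.of ℂ ((K →₀ B) ⊗[ℂ] fockPart B K m)

/-- The identification `B = H_0`. -/
def fockZero (B : Type u) [Ring B] [Algebra ℂ B] (K : Type) : B ≃ₗ[ℂ] fockPart B K 0 :=
  LinearEquiv.refl ℂ B

/-- The identification `⨁_k B ⊗ H_m = H_{m+1}`. -/
def fockSucc (B : Type u) [Ring B] [Algebra ℂ B] (K : Type) (m : ℕ) :
    ((K →₀ B) ⊗[ℂ] fockPart B K m) ≃ₗ[ℂ] fockPart B K (m + 1) :=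
  LinearEquiv.refl ℂ ((K →₀ B) ⊗[ℂ] fockPart B K m)

/-- The full Fock space `F(B, K) = B ⊕ H_1 ⊕ H_2 ⊕ ⋯`. -/
abbrev Fock (B : Type u) [Ring B] [Algebra ℂ B] (K : Type) : Type u :=
  DirectSum ℕ fun m => fockPart B K m

/-- The left action of `B` on `H_m`. -/
def leftActPart (B : Type u) [Ring B] [Algebra ℂ B] (K : Type) :
    (m : ℕ) → B →ₐ[ℂ] Module.End ℂ (fockPart B K m)
  | 0 => ((fockZero B K).conjAlgEquiv ℂ).toAlgHom.comp (Algebra.lsmul ℂ ℂ B)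
  | m + 1 => ((fockSucc B K m).conjAlgEquiv ℂ).toAlgHom.comp
      ((Module.End.rTensorAlgHom ℂ (K →₀ B) (fockPart B K m)).comp
        (Algebra.lsmul ℂ ℂ (K →₀ B)))

/-- The right action of `B` on `H_m`. -/
def rightActPart (B : Type u) [Ring B] [Algebra ℂ B] (K : Type) :
    (m : ℕ) → Bᵐᵒᵖ →ₐ[ℂ] Module.End ℂ (fockPart B K m)
  | 0 => ((fockZero B K).conjAlgEquiv ℂ).toAlgHom.comp (Algebra.lsmul ℂ ℂ B)
  | m + 1 => ((fockSucc B K m).conjAlgEquiv ℂ).toAlgHom.comp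
      ((Module.End.lTensorAlgHom ℂ (fockPart B K m) (K →₀ B)).comp (rightActPart B K m))

/-- A representation on each homogeneous part gives a representation on the direct sum. -/
def directSumRep {C : Type*} [Ring C] [Algebra ℂ C] {M : ℕ → Type*}
    [∀ m, AddCommGroup (M m)] [∀ m, Module ℂ (M m)] (f : (m : ℕ) → C →ₐ[ℂ] Module.End ℂ (M m)) :
    C →ₐ[ℂ] Module.End ℂ (DirectSum ℕ M) :=
  AlgHom.ofLinearMap
    { toFun := fun c => DirectSum.toModule ℂ ℕ _ fun m => DirectSum.lof ℂ ℕ M m ∘ₗ f m c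
      map_add' := fun a b => by
        refine DirectSum.linearMap_ext ℂ fun m => LinearMap.ext fun x => ?_
        simp
      map_smul' := fun a b => by
        refine DirectSum.linearMap_ext ℂ fun m => LinearMap.ext fun x => ?_
        simp }
    (by
      refine DirectSum.linearMap_ext ℂ fun m => LinearMap.ext fun x => ?_
      simp)
    (fun a b => by
      refine DirectSum.linearMap_ext ℂ fun m => LinearMap.ext fun x => ?_
      simp)

/-- The operators `L_b` of left multiplication on the Fock space. -/
def fockLeft (B : Type u) [Ring B] [Algebra ℂ B] (K : Type) :
    B →ₐ[ℂ] Module.End ℂ (Fock B K) :=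
  directSumRep (leftActPart B K)

/-- The operators `R_b` of right multiplication on the Fock space. -/
def fockRight (B : Type u) [Ring B] [Algebra ℂ B] (K : Type) :
    Bᵐᵒᵖ →ₐ[ℂ] Module.End ℂ (Fock B K) :=
  directSumRep (rightActPart B K)

/-- Left creation on `H_m`: `x ↦ 1 Z_k x`. -/
def leftCreatePart (B : Type u) [Ring B] [Algebra ℂ B] {K : Type} (k : K) (m : ℕ) :
    fockPart B K m →ₗ[ℂ] fockPart B K (m + 1) :=
  (fockSucc B K m).toLinearMap ∘ₗ
    TensorProduct.mk ℂ (K →₀ B) (fockPart B K m) (Finsupp.single k 1)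

/-- Right creation on `H_m`: `x ↦ x Z_k 1`. -/
def rightCreatePart (B : Type u) [Ring B] [Algebra ℂ B] {K : Type} (k : K) :
    (m : ℕ) → fockPart B K m →ₗ[ℂ] fockPart B K (m + 1)
  | 0 => (fockSucc B K 0).toLinearMap ∘ₗ
      (TensorProduct.mk ℂ (K →₀ B) (fockPart B K 0)).flip (fockZero B K 1) ∘ₗ
        Finsupp.lsingle k ∘ₗ (fockZero B K).symm.toLinearMap
  | m + 1 => (fockSucc B K (m + 1)).toLinearMap ∘ₗ
      LinearMap.lTensor (K →₀ B) (rightCreatePart B k m) ∘ₗ (fockSucc B K m).symm.toLinearMap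

/-- Left annihilation on `H_{m+1}`: `b Z_{k'} x ↦ η_{k,k'}(b) x`. -/
def leftAnnihPart {B : Type u} [Ring B] [Algebra ℂ B] {K : Type} (η : K → K → B →ₗ[ℂ] B)
    (k : K) (m : ℕ) : fockPart B K (m + 1) →ₗ[ℂ] fockPart B K m :=
  TensorProduct.lift
      (Finsupp.lsum ℂ fun k' => (leftActPart B K m).toLinearMap ∘ₗ η k k') ∘ₗ
    (fockSucc B K m).symm.toLinearMap

/-- Right annihilation on `H_{m+1}`: `x b Z_{k'} b' ↦ x b η_{k',k}(b')`. -/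
def rightAnnihPart {B : Type u} [Ring B] [Algebra ℂ B] {K : Type} (η : K → K → B →ₗ[ℂ] B)
    (k : K) : (m : ℕ) → fockPart B K (m + 1) →ₗ[ℂ] fockPart B K m
  | 0 => (fockZero B K).toLinearMap ∘ₗ
      TensorProduct.lift (Finsupp.lsum ℂ fun k' =>
        (LinearMap.mul ℂ B).compl₂ (η k' k ∘ₗ (fockZero B K).symm.toLinearMap)) ∘ₗ
          (fockSucc B K 0).symm.toLinearMap
  | m + 1 => (fockSucc B K m).toLinearMap ∘ₗ
      LinearMap.lTensor (K →₀ B) (rightAnnihPart η k m) ∘ₗ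
        (fockSucc B K (m + 1)).symm.toLinearMap

/-- The left creation operator `l_k`. -/
def leftCreate (B : Type u) [Ring B] [Algebra ℂ B] {K : Type} (k : K) :
    Module.End ℂ (Fock B K) :=
  DirectSum.toModule ℂ ℕ _ fun m => DirectSum.lof ℂ ℕ _ (m + 1) ∘ₗ leftCreatePart B k m

/-- The right creation operator `r_k`. -/
def rightCreate (B : Type u) [Ring B] [Algebra ℂ B] {K : Type} (k : K) :
    Module.End ℂ (Fock B K) :=
  DirectSum.toModule ℂ ℕ _ fun m => DirectSum.lof ℂ ℕ _ (m + 1) ∘ₗ rightCreatePart B k m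

/-- The left annihilation operator `l_k^*` for the covariance `η`; it vanishes on `B`. -/
def leftAnnih {B : Type u} [Ring B] [Algebra ℂ B] {K : Type} (η : K → K → B →ₗ[ℂ] B) (k : K) :
    Module.End ℂ (Fock B K) :=
  DirectSum.toModule ℂ ℕ _ fun
    | 0 => 0
    | m + 1 => DirectSum.lof ℂ ℕ (fun m => fockPart B K m) m ∘ₗ leftAnnihPart η k m

/-- The right annihilation operator `r_k^*` for the covariance `η`; it vanishes on `B`. -/
def rightAnnih {B : Type u} [Ring B] [Algebra ℂ B] {K : Type} (η : K → K → B →ₗ[ℂ] B) (k : K) :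
    Module.End ℂ (Fock B K) :=
  DirectSum.toModule ℂ ℕ _ fun
    | 0 => 0
    | m + 1 => DirectSum.lof ℂ ℕ (fun m => fockPart B K m) m ∘ₗ rightAnnihPart η k m

/-- The expectation `E(T) = p(T 1_B)`, where `p` takes the `B`-term. -/
def fockExpectation (B : Type u) [Ring B] [Algebra ℂ B] (K : Type) :
    Module.End ℂ (Fock B K) →ₗ[ℂ] B :=
  (fockZero B K).symm.toLinearMap ∘ₗ DirectSum.component ℂ ℕ (fun m => fockPart B K m) 0 ∘ₗ
    LinearMap.applyₗ (DirectSum.lof ℂ ℕ (fun m => fockPart B K m) 0 (fockZero B K 1))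

/-! ### Bi-semicircular operators -/

/-- The covariance with diagonal entries `η_k` and vanishing off-diagonal entries. -/
def diagCovariance {B : Type u} [Ring B] [Algebra ℂ B] {K : Type} [DecidableEq K]
    (η : K → B →ₗ[ℂ] B) : K → K → B →ₗ[ℂ] B :=
  fun k k' => if k = k' then η k else 0

/-- The left operators `S_i = l_i + l_i^*`, for `i ∈ I`. -/
def leftSemi {B : Type u} [Ring B] [Algebra ℂ B] {I J : Type}
    (η : I ⊕ J → I ⊕ J → B →ₗ[ℂ] B) (i : I) : Module.End ℂ (Fock B (I ⊕ J)) :=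
  leftCreate B (Sum.inl i) + leftAnnih η (Sum.inl i)

/-- The right operators `D_j = r_j + r_j^*`, for `j ∈ J`. -/
def rightSemi {B : Type u} [Ring B] [Algebra ℂ B] {I J : Type}
    (η : I ⊕ J → I ⊕ J → B →ₗ[ℂ] B) (j : J) : Module.End ℂ (Fock B (I ⊕ J)) :=
  rightCreate B (Sum.inr j) + rightAnnih η (Sum.inr j)

/-- `alg(B_ℓ, {S_i})`. -/
def leftFace {B : Type u} [Ring B] [Algebra ℂ B] {I J : Type}
    (η : I ⊕ J → I ⊕ J → B →ₗ[ℂ] B) : Subalgebra ℂ (Module.End ℂ (Fock B (I ⊕ J))) :=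
  Algebra.adjoin ℂ (Set.range (fockLeft B (I ⊕ J)) ∪ Set.range (leftSemi η))

/-- `alg(B_r, {D_j})`. -/
def rightFace {B : Type u} [Ring B] [Algebra ℂ B] {I J : Type}
    (η : I ⊕ J → I ⊕ J → B →ₗ[ℂ] B) : Subalgebra ℂ (Module.End ℂ (Fock B (I ⊕ J))) :=
  Algebra.adjoin ℂ (Set.range (fockRight B (I ⊕ J)) ∪ Set.range (rightSemi η))

/-- The algebra `A` generated by `alg(B_ℓ, {S_i})` and `alg(B_r, {D_j})`. -/
def biSemiAlgebra {B : Type u} [Ring B] [Algebra ℂ B] {I J : Type}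
    (η : I ⊕ J → I ⊕ J → B →ₗ[ℂ] B) : Subalgebra ℂ (Module.End ℂ (Fock B (I ⊕ J))) :=
  leftFace η ⊔ rightFace η

theorem fockLeft_mem {B : Type u} [Ring B] [Algebra ℂ B] {I J : Type}
    (η : I ⊕ J → I ⊕ J → B →ₗ[ℂ] B) (b : B) : fockLeft B (I ⊕ J) b ∈ biSemiAlgebra η :=
  (le_sup_left : leftFace η ≤ biSemiAlgebra η)
    (Algebra.subset_adjoin (Or.inl (Set.mem_range_self b)))

theorem fockRight_mem {B : Type u} [Ring B] [Algebra ℂ B] {I J : Type}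
    (η : I ⊕ J → I ⊕ J → B →ₗ[ℂ] B) (b : Bᵐᵒᵖ) : fockRight B (I ⊕ J) b ∈ biSemiAlgebra η :=
  (le_sup_right : rightFace η ≤ biSemiAlgebra η)
    (Algebra.subset_adjoin (Or.inl (Set.mem_range_self b)))

theorem leftSemi_mem {B : Type u} [Ring B] [Algebra ℂ B] {I J : Type}
    (η : I ⊕ J → I ⊕ J → B →ₗ[ℂ] B) (i : I) : leftSemi η i ∈ biSemiAlgebra η :=
  (le_sup_left : leftFace η ≤ biSemiAlgebra η)
    (Algebra.subset_adjoin (Or.inr (Set.mem_range_self i)))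

theorem rightSemi_mem {B : Type u} [Ring B] [Algebra ℂ B] {I J : Type}
    (η : I ⊕ J → I ⊕ J → B →ₗ[ℂ] B) (j : J) : rightSemi η j ∈ biSemiAlgebra η :=
  (le_sup_right : rightFace η ≤ biSemiAlgebra η)
    (Algebra.subset_adjoin (Or.inr (Set.mem_range_self j)))

/-- `S_i` as an element of `A`. -/
def semiS {B : Type u} [Ring B] [Algebra ℂ B] {I J : Type}
    (η : I ⊕ J → I ⊕ J → B →ₗ[ℂ] B) (i : I) : biSemiAlgebra η :=
  ⟨leftSemi η i, leftSemi_mem η i⟩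

/-- `D_j` as an element of `A`. -/
def semiD {B : Type u} [Ring B] [Algebra ℂ B] {I J : Type}
    (η : I ⊕ J → I ⊕ J → B →ₗ[ℂ] B) (j : J) : biSemiAlgebra η :=
  ⟨rightSemi η j, rightSemi_mem η j⟩

theorem leftActPart_comm (B : Type u) [Ring B] [Algebra ℂ B] (K : Type) :
    ∀ (m : ℕ) (b : B) (c : Bᵐᵒᵖ), Commute (leftActPart B K m b) (rightActPart B K m c)
  | 0, b, c =>
      have h : Commute (Algebra.lsmul ℂ ℂ B b) (Algebra.lsmul ℂ ℂ B c) :=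
        LinearMap.ext fun x : B => smul_comm b c x
      h.map ((fockZero B K).conjAlgEquiv ℂ)
  | m + 1, b, c =>
      have h : Commute (Module.End.rTensorAlgHom ℂ (K →₀ B) (fockPart B K m)
            (Algebra.lsmul ℂ ℂ (K →₀ B) b))
          (Module.End.lTensorAlgHom ℂ (fockPart B K m) (K →₀ B) (rightActPart B K m c)) :=
        (LinearMap.rTensor_comp_lTensor _ _ _).trans (LinearMap.lTensor_comp_rTensor _ _ _).symm
      h.map ((fockSucc B K m).conjAlgEquiv ℂ)

theorem fockLeft_comm (B : Type u) [Ring B] [Algebra ℂ B] (K : Type) (b : B) (c : Bᵐᵒᵖ) :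
    Commute (fockLeft B K b) (fockRight B K c) := by
  refine DirectSum.linearMap_ext ℂ fun m => LinearMap.ext fun x => ?_
  have h := LinearMap.congr_fun (leftActPart_comm B K m b c) x
  simp only [Module.End.mul_apply] at h
  simp [fockLeft, fockRight, directSumRep, h]

/-- The structure map `ε : B ⊗ Bᵒᵖ → A`, `b₁ ⊗ b₂ ↦ L_{b₁} R_{b₂}`. -/
def biSemiEps {B : Type u} [Ring B] [Algebra ℂ B] {I J : Type}
    (η : I ⊕ J → I ⊕ J → B →ₗ[ℂ] B) : B ⊗[ℂ] Bᵐᵒᵖ →ₐ[ℂ] biSemiAlgebra η :=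
  Algebra.TensorProduct.lift
    ((fockLeft B (I ⊕ J)).codRestrict (biSemiAlgebra η) (fockLeft_mem η))
    ((fockRight B (I ⊕ J)).codRestrict (biSemiAlgebra η) (fockRight_mem η))
    fun b c => Subtype.ext (fockLeft_comm B (I ⊕ J) b c)

/-- The expectation `E` on `A`. -/
def biSemiExpectation {B : Type u} [Ring B] [Algebra ℂ B] {I J : Type}
    (η : I ⊕ J → I ⊕ J → B →ₗ[ℂ] B) : biSemiAlgebra η →ₗ[ℂ] B :=
  fockExpectation B (I ⊕ J) ∘ₗ (biSemiAlgebra η).val.toLinearMap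

end BiFree

end

/-!
# Bi-free semicircular operators on the full Fock space

The operators `S_k` and `L_b` commute with `D_k` and `R_b`, for all letters `k` (`lsemi_rsemi`),
and applying words in the left operators for all letters to the vacuum `1` defines the Wick map
`wick`, a linear bijection of the Fock space with inverse `unwick`. So the vacuum is cyclic for
all left operators, hence separating for everything that commutes with them, and the same holds on
the right (`eq_zero_of_commute_left`, `eq_zero_of_commute_right`).

*The involution.* The antilinear reversal `J` of words (`fockStar`) exchanges left and right
operators. On each face the prescription `T^* 1 = J (T 1)` defines an involution, since `J T J`
commutes with the face (`exists_starRing_of_separating`). The algebra `A` is the tensor product of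
its faces: after inverting the Wick map, the vector `a c (1 Z_k 1)` can be split at the letter
`Z_k` to recover `a 1 ⊗ c 1` (`wickSplit_mul`, `faceMul_injective`). The involution of the tensor
product is the one of `A` (`exists_starRing_biSemiAlgebra`). This does not use a faithful
representation; the `B`-valued inner product of the Fock space may be degenerate.

*The analytic structure.* As the covariance between `I` and `J` vanishes, `E(a c) = E(a) E(c)` for
`a` in the left and `c` in the right face (`biSemiExpectation_mul`). Therefore
`E((∑ a_i c_i)^* (∑ a_j c_j)) = ∑ E(a_i^* a_j) E(c_i^* c_j)`, where `[E(a_i^* a_j)]` and the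
transpose of `[E(c_i^* c_j)]` are Gram matrices of the inner product, which are positive
(`isPositive_gram`). For a tracial state the trace of a product of positive matrices is
nonnegative (`IsState.sum_mul_nonneg`). Boundedness of `A` on the GNS space follows from
`l_k^* l_k = η_k(1) ≤ c` on the Fock space (`exists_isPositive_smul_gram_sub`). An element of the
left algebra, which may be larger than the left face, is a sum `∑ a_i c_i` with `c_i` commuting
with all `R_b`. The expectations `E(c_i^* c_j)` are then central, and complete positivity comes
down to the fact that the transpose of a positive matrix with central entries is positive
(`IsPositive.transpose_of_central`). There is no functional calculus in `B`, so this is shown by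
estimating powers of matrices.

*The cumulants.* Applied to the vacuum, a right operator may be replaced by a left operator that
is moved behind all the others; this produces the `χ`-order. Freeness of left operators with
respect to a covariance vanishing between two sets of letters (`semiMoment_append_of_free`) shows
that the moment function at `π` is the moment of the word in `χ`-order for the covariance that is
cut between the blocks of `π` (`bifreeMoment_eq`). Expanding `S = l + l^*`, this moment becomes a
sum, over pairings `P`, of terms that do not depend on `π` except for the condition `P ≤ π`
(`semiApply_mem_pairingCone`). The partitions `π ≥ P` in `BNC(χ)` form an interval `[c, 1_χ]`, on
which the Möbius function sums to zero unless `c = 1_χ` (`sum_moebiusBNC_eq_zero`). A pairing that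
arises contains two neighbours in the `χ`-order, and these and the rest form a partition in
`BNC(χ)` above `P`; so `c ≠ 1_χ` if `n > 2`, and for `n = 1` there is no pairing. For `n = 2` the
only contribution is that of the pair itself (`bifreeCumulant_two`).
-/

noncomputable section

namespace BiFree

open scoped TensorProduct ComplexOrder
open MulOpposite (op)

universe u

set_option linter.unusedSectionVars false

/-! ### Recursion and induction on the Fock space -/

section FockRecursion

variable {B : Type u} [Ring B] [Algebra ℂ B] {K : Type}

/-- The inclusion of `B` as the degree zero part of the Fock space. -/
def vac (B : Type u) [Ring B] [Algebra ℂ B] (K : Type) : B →ₗ[ℂ] Fock B K :=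
  DirectSum.lof ℂ ℕ (fun m => fockPart B K m) 0 ∘ₗ (fockZero B K).toLinearMap

/-- The projection of the Fock space onto its degree zero part. -/
def vacProj (B : Type u) [Ring B] [Algebra ℂ B] (K : Type) : Fock B K →ₗ[ℂ] B :=
  (fockZero B K).symm.toLinearMap ∘ₗ DirectSum.component ℂ ℕ (fun m => fockPart B K m) 0

/-- The vector `b Z_k w` of degree `m + 1`, for `w` of degree `m`. -/
def consPart (m : ℕ) (k : K) (b : B) (w : fockPart B K m) : fockPart B K (m + 1) :=
  fockSucc B K m (Finsupp.single k b ⊗ₜ[ℂ] w)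

theorem leftActPart_succ (m : ℕ) (b c : B) (k : K) (w : fockPart B K m) :
    leftActPart B K (m + 1) b (consPart m k c w) = consPart m k (b * c) w := by
  change fockSucc B K m ((b • Finsupp.single k c) ⊗ₜ[ℂ] w) = _
  rw [Finsupp.smul_single]
  rfl

theorem leftCreate_lof (k : K) (m : ℕ) (w : fockPart B K m) :
    leftCreate B k (DirectSum.lof ℂ ℕ (fun m => fockPart B K m) m w) =
      DirectSum.lof ℂ ℕ (fun m => fockPart B K m) (m + 1) (consPart m k 1 w) := by
  simp only [leftCreate, DirectSum.toModule_lof]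
  rfl

theorem directSumRep_lof {C : Type*} [Ring C] [Algebra ℂ C] {M : ℕ → Type*}
    [∀ m, AddCommGroup (M m)] [∀ m, Module ℂ (M m)] (f : (m : ℕ) → C →ₐ[ℂ] Module.End ℂ (M m))
    (c : C) (m : ℕ) (x : M m) :
    directSumRep f c (DirectSum.lof ℂ ℕ M m x) = DirectSum.lof ℂ ℕ M m (f m c x) := by
  simp [directSumRep]

theorem fockLeft_leftCreate_lof (b : B) (k : K) (m : ℕ) (w : fockPart B K m) :
    fockLeft B K b (leftCreate B k (DirectSum.lof ℂ ℕ (fun m => fockPart B K m) m w)) =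
      DirectSum.lof ℂ ℕ (fun m => fockPart B K m) (m + 1) (consPart m k b w) := by
  rw [leftCreate_lof, fockLeft, directSumRep_lof, leftActPart_succ, mul_one]

theorem fockPart_induction (m : ℕ) {P : fockPart B K (m + 1) → Prop} (zero : P 0)
    (cons : ∀ b k w, P (consPart m k b w)) (add : ∀ x y, P x → P y → P (x + y)) (x) : P x := by
  have key : ∀ t : (K →₀ B) ⊗[ℂ] fockPart B K m, P (fockSucc B K m t) := by
    intro t
    induction t with
    | zero => simpa using zero
    | tmul f w =>
      induction f using Finsupp.induction_linear with
      | zero => simpa using zero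
      | single k b => exact cons b k w
      | add f g hf hg =>
        rw [TensorProduct.add_tmul, map_add]
        exact add _ _ hf hg
    | add x y hx hy =>
      rw [map_add]
      exact add _ _ hx hy
  exact key x

/-- Every vector of the Fock space is a sum of vectors of degree zero and vectors `b Z_k w`. -/
@[elab_as_elim]
theorem fock_induction {P : Fock B K → Prop} (zero : P 0) (add : ∀ x y, P x → P y → P (x + y))
    (vac : ∀ b, P (vac B K b))
    (cons : ∀ b k w, P w → P (fockLeft B K b (leftCreate B k w))) (w : Fock B K) : P w := by
  have key : ∀ m x, P (DirectSum.lof ℂ ℕ (fun m => fockPart B K m) m x) := by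
    intro m
    induction m with
    | zero => exact fun x => vac x
    | succ m ih =>
      intro x
      induction x using fockPart_induction with
      | zero => simpa using zero
      | cons b k w =>
        rw [← fockLeft_leftCreate_lof]
        exact cons b k _ (ih w)
      | add x y hx hy =>
        rw [map_add]
        exact add _ _ hx hy
  induction w using DirectSum.induction_on with
  | zero => exact zero
  | of m x => exact key m x
  | add x y hx hy => exact add x y hx hy

variable {σ : ℂ →+* ℂ} {M : Type*} [AddCommGroup M] [Module ℂ M]

/-- The homogeneous parts of `fockRec`. -/
def fockRecPart (f : B →ₛₗ[σ] M) (g : K → B →ₛₗ[σ] M →ₗ[ℂ] M) :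
    (m : ℕ) → fockPart B K m →ₛₗ[σ] M
  | 0 => f.comp (fockZero B K).symm.toLinearMap
  | m + 1 => (TensorProduct.lift (LinearMap.mk₂'ₛₗ σ σ
      (fun (c : K →₀ B) (w : fockPart B K m) => c.sum fun k b => g k b (fockRecPart f g m w))
      (fun c d w => Finsupp.sum_add_index' (by simp) (by simp))
      (fun r c w => by
        rw [Finsupp.sum_smul_index' (by simp), Finsupp.smul_sum]
        simp)
      (fun c w v => by simp [Finsupp.sum_add])
      (fun r c w => by simp [Finsupp.smul_sum]))).comp (fockSucc B K m).symm.toLinearMap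

theorem fockRecPart_succ (f : B →ₛₗ[σ] M) (g : K → B →ₛₗ[σ] M →ₗ[ℂ] M) (m : ℕ) (k : K) (b : B)
    (w : fockPart B K m) :
    fockRecPart f g (m + 1) (consPart m k b w) = g k b (fockRecPart f g m w) := by
  simp [fockRecPart, consPart]

/-- The semilinear map on the Fock space determined by its values on `B` and by a rule that
computes the value at `b Z_k w` from the value at `w`. -/
def fockRec (f : B →ₛₗ[σ] M) (g : K → B →ₛₗ[σ] M →ₗ[ℂ] M) : Fock B K →ₛₗ[σ] M where
  toFun := DirectSum.toAddMonoid fun m => (fockRecPart f g m).toAddMonoidHom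
  map_add' := map_add _
  map_smul' r w := by
    induction w using DirectSum.induction_on with
    | zero => simp
    | of m x =>
      rw [← DirectSum.lof_eq_of ℂ, ← map_smul, DirectSum.lof_eq_of, DirectSum.lof_eq_of]
      simp
    | add x y hx hy => simp only [smul_add, map_add, hx, hy]

theorem fockRec_lof (f : B →ₛₗ[σ] M) (g : K → B →ₛₗ[σ] M →ₗ[ℂ] M) (m : ℕ) (x : fockPart B K m) :
    fockRec f g (DirectSum.lof ℂ ℕ (fun m => fockPart B K m) m x) = fockRecPart f g m x := by
  rw [DirectSum.lof_eq_of]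
  simp [fockRec]

@[simp]
theorem fockRec_vac (f : B →ₛₗ[σ] M) (g : K → B →ₛₗ[σ] M →ₗ[ℂ] M) (b : B) :
    fockRec f g (vac B K b) = f b :=
  fockRec_lof f g 0 _

@[simp]
theorem fockRec_cons (f : B →ₛₗ[σ] M) (g : K → B →ₛₗ[σ] M →ₗ[ℂ] M) (b : B) (k : K)
    (w : Fock B K) :
    fockRec f g (fockLeft B K b (leftCreate B k w)) = g k b (fockRec f g w) := by
  induction w using DirectSum.induction_on with
  | zero => simp
  | of m x =>
    rw [← DirectSum.lof_eq_of ℂ, fockLeft_leftCreate_lof, fockRec_lof, fockRecPart_succ,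
      fockRec_lof]
  | add x y hx hy => simp only [map_add, hx, hy]

end FockRecursion

/-! ### The elementary operators on words -/

section Operators

variable {B : Type u} [Ring B] [Algebra ℂ B] {K : Type}

/-- The operator `R_b` of right multiplication by `b`. -/
def rmul (B : Type u) [Ring B] [Algebra ℂ B] (K : Type) (b : B) : Module.End ℂ (Fock B K) :=
  fockRight B K (op b)

@[simp]
theorem vacProj_vac (b : B) : vacProj B K (vac B K b) = b := by
  simp [vacProj, vac]

@[simp]
theorem vacProj_cons (b : B) (k : K) (w : Fock B K) :
    vacProj B K (fockLeft B K b (leftCreate B k w)) = 0 := by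
  induction w using DirectSum.induction_on with
  | zero => simp
  | of m x =>
    rw [← DirectSum.lof_eq_of ℂ, fockLeft_leftCreate_lof]
    simp [vacProj, DirectSum.component.of]
  | add x y hx hy => simp only [map_add, hx, hy, add_zero]

@[simp]
theorem vacProj_create (k : K) (w : Fock B K) : vacProj B K (leftCreate B k w) = 0 := by
  have h := vacProj_cons 1 k w
  rwa [map_one, Module.End.one_apply] at h

@[simp]
theorem fockLeft_vac (b c : B) : fockLeft B K b (vac B K c) = vac B K (b * c) :=
  directSumRep_lof _ _ _ _

theorem fockLeft_mul_apply (b c : B) (w : Fock B K) :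
    fockLeft B K b (fockLeft B K c w) = fockLeft B K (b * c) w := by
  rw [map_mul, Module.End.mul_apply]

@[simp]
theorem vacProj_left (b : B) (w : Fock B K) :
    vacProj B K (fockLeft B K b w) = b * vacProj B K w := by
  induction w using fock_induction with
  | zero => simp
  | add x y hx hy => simp [hx, hy, mul_add]
  | vac c => simp
  | cons c k w => rw [fockLeft_mul_apply, vacProj_cons, vacProj_cons, mul_zero]

@[simp]
theorem rmul_vac (b c : B) : rmul B K b (vac B K c) = vac B K (c * b) :=
  directSumRep_lof _ _ _ _

@[simp]
theorem rmul_one : rmul B K 1 = 1 := by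
  rw [rmul, MulOpposite.op_one, map_one]

theorem rmul_mul_apply (b c : B) (w : Fock B K) :
    rmul B K b (rmul B K c w) = rmul B K (c * b) w := by
  rw [rmul, rmul, rmul, MulOpposite.op_mul, map_mul, Module.End.mul_apply]

theorem fockLeft_rmul (b c : B) (w : Fock B K) :
    fockLeft B K b (rmul B K c w) = rmul B K c (fockLeft B K b w) :=
  LinearMap.congr_fun (fockLeft_comm B K b (op c)) w

@[simp]
theorem rmul_create (b : B) (k : K) (w : Fock B K) :
    rmul B K b (leftCreate B k w) = leftCreate B k (rmul B K b w) := by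
  induction w using DirectSum.induction_on with
  | zero => simp
  | of m x =>
    rw [← DirectSum.lof_eq_of ℂ, leftCreate_lof, rmul, fockRight, directSumRep_lof,
      directSumRep_lof, leftCreate_lof]
    rfl
  | add x y hx hy => simp only [map_add, hx, hy]

@[simp]
theorem rmul_cons (a b : B) (k : K) (w : Fock B K) :
    rmul B K a (fockLeft B K b (leftCreate B k w)) =
      fockLeft B K b (leftCreate B k (rmul B K a w)) := by
  rw [← fockLeft_rmul, rmul_create]

@[simp]
theorem vacProj_rmul (b : B) (w : Fock B K) :
    vacProj B K (rmul B K b w) = vacProj B K w * b := by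
  induction w using fock_induction with
  | zero => simp
  | add x y hx hy => simp [hx, hy, add_mul]
  | vac c => simp
  | cons c k w => rw [rmul_cons, vacProj_cons, vacProj_cons, zero_mul]

variable (η : K → K → B →ₗ[ℂ] B)

@[simp]
theorem leftAnnih_vac (k : K) (b : B) : leftAnnih η k (vac B K b) = 0 := by
  simp [leftAnnih, vac]

@[simp]
theorem leftAnnih_cons (k j : K) (b : B) (w : Fock B K) :
    leftAnnih η k (fockLeft B K b (leftCreate B j w)) = fockLeft B K (η k j b) w := by
  induction w using DirectSum.induction_on with
  | zero => simp
  | of m x =>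
    rw [← DirectSum.lof_eq_of ℂ, fockLeft_leftCreate_lof, fockLeft, directSumRep_lof]
    simp [leftAnnih, leftAnnihPart, consPart]
  | add x y hx hy => simp only [map_add, hx, hy]

@[simp]
theorem leftAnnih_create (k j : K) (w : Fock B K) :
    leftAnnih η k (leftCreate B j w) = fockLeft B K (η k j 1) w := by
  have h := leftAnnih_cons η k j 1 w
  rwa [map_one, Module.End.one_apply] at h

theorem rmul_leftAnnih (k : K) (b : B) (w : Fock B K) :
    rmul B K b (leftAnnih η k w) = leftAnnih η k (rmul B K b w) := by
  induction w using fock_induction with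
  | zero => simp
  | add x y hx hy => simp [hx, hy]
  | vac c => simp
  | cons c j w => simp [fockLeft_rmul]

@[simp]
theorem rightCreate_vac (k : K) (b : B) :
    rightCreate B k (vac B K b) = fockLeft B K b (leftCreate B k (vac B K 1)) := by
  rw [vac, LinearMap.comp_apply, LinearMap.comp_apply, fockLeft_leftCreate_lof]
  simp [rightCreate, rightCreatePart, consPart]

@[simp]
theorem rightCreate_cons (k j : K) (b : B) (w : Fock B K) :
    rightCreate B k (fockLeft B K b (leftCreate B j w)) =
      fockLeft B K b (leftCreate B j (rightCreate B k w)) := by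
  induction w using DirectSum.induction_on with
  | zero => simp
  | of m x =>
    rw [← DirectSum.lof_eq_of ℂ, fockLeft_leftCreate_lof]
    simp only [rightCreate, DirectSum.toModule_lof, LinearMap.comp_apply]
    rw [fockLeft_leftCreate_lof]
    simp [rightCreatePart, consPart]
  | add x y hx hy => simp only [map_add, hx, hy]

@[simp]
theorem rightCreate_create (k j : K) (w : Fock B K) :
    rightCreate B k (leftCreate B j w) = leftCreate B j (rightCreate B k w) := by
  have h := rightCreate_cons k j 1 w
  rwa [map_one, Module.End.one_apply] at h

@[simp]
theorem vacProj_rightCreate (k : K) (w : Fock B K) : vacProj B K (rightCreate B k w) = 0 := by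
  induction w using fock_induction with
  | zero => simp
  | add x y hx hy => simp [hx, hy]
  | vac c => simp
  | cons c j w => simp

@[simp]
theorem rightAnnih_vac (k : K) (b : B) : rightAnnih η k (vac B K b) = 0 := by
  simp [rightAnnih, vac]

@[simp]
theorem rightAnnih_cons (k j : K) (b : B) (w : Fock B K) :
    rightAnnih η k (fockLeft B K b (leftCreate B j w)) =
      fockLeft B K b (leftCreate B j (rightAnnih η k w)) +
        vac B K (b * η j k (vacProj B K w)) := by
  induction w using DirectSum.induction_on with
  | zero => simp
  | of m x =>
    rw [← DirectSum.lof_eq_of ℂ, fockLeft_leftCreate_lof]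
    cases m with
    | zero =>
      have h : DirectSum.lof ℂ ℕ (fun m => fockPart B K m) 0 x =
        vac B K ((fockZero B K).symm x) := rfl
      rw [h, rightAnnih_vac, vacProj_vac]
      simp [rightAnnih, rightAnnihPart, consPart, vac]
    | succ m =>
      have h : vacProj B K (DirectSum.lof ℂ ℕ (fun m => fockPart B K m) (m + 1) x) = 0 := by
        simp [vacProj, DirectSum.component.of]
      rw [h]
      simp only [rightAnnih, DirectSum.toModule_lof, LinearMap.comp_apply]
      rw [fockLeft_leftCreate_lof]
      simp [rightAnnihPart, consPart]
  | add x y hx hy =>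
    simp only [map_add, hx, hy, mul_add]
    abel

@[simp]
theorem rightAnnih_create (k j : K) (w : Fock B K) :
    rightAnnih η k (leftCreate B j w) =
      leftCreate B j (rightAnnih η k w) + vac B K (η j k (vacProj B K w)) := by
  have h := rightAnnih_cons η k j 1 w
  rwa [map_one, Module.End.one_apply, Module.End.one_apply, one_mul] at h

theorem fockLeft_rightCreate (k : K) (b : B) (w : Fock B K) :
    fockLeft B K b (rightCreate B k w) = rightCreate B k (fockLeft B K b w) := by
  induction w using fock_induction with
  | zero => simp
  | add x y hx hy => simp [hx, hy]
  | vac c => simp [-map_mul, fockLeft_mul_apply]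
  | cons c j w => simp [-map_mul, fockLeft_mul_apply]

theorem fockLeft_rightAnnih (k : K) (b : B) (w : Fock B K) :
    fockLeft B K b (rightAnnih η k w) = rightAnnih η k (fockLeft B K b w) := by
  induction w using fock_induction with
  | zero => simp
  | add x y hx hy => simp [hx, hy]
  | vac c => simp
  | cons c j w => simp [-map_mul, fockLeft_mul_apply, mul_assoc]

/-- The word-level reflection of `leftAnnih_cons`. -/
theorem rightAnnih_rmul_rightCreate (k j : K) (b : B) (w : Fock B K) :
    rightAnnih η k (rmul B K b (rightCreate B j w)) = rmul B K (η j k b) w := by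
  induction w using fock_induction with
  | zero => simp
  | add x y hx hy => simp [hx, hy]
  | vac c => simp
  | cons c i w h =>
    simp [h]

/-- The operator `S_k = l_k + l_k^*`, for an arbitrary letter `k`. -/
def lsemi (k : K) : Module.End ℂ (Fock B K) := leftCreate B k + leftAnnih η k

/-- The operator `D_k = r_k + r_k^*`, for an arbitrary letter `k`. -/
def rsemi (k : K) : Module.End ℂ (Fock B K) := rightCreate B k + rightAnnih η k

theorem lsemi_apply (k : K) (w : Fock B K) :
    lsemi η k w = leftCreate B k w + leftAnnih η k w := rfl

theorem rsemi_apply (k : K) (w : Fock B K) :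
    rsemi η k w = rightCreate B k w + rightAnnih η k w := rfl

theorem rmul_lsemi (k : K) (b : B) (w : Fock B K) :
    rmul B K b (lsemi η k w) = lsemi η k (rmul B K b w) := by
  simp [lsemi_apply, rmul_leftAnnih]

theorem fockLeft_rsemi (k : K) (b : B) (w : Fock B K) :
    fockLeft B K b (rsemi η k w) = rsemi η k (fockLeft B K b w) := by
  simp [rsemi_apply, fockLeft_rightAnnih, fockLeft_rightCreate]

/-- Left and right operators commute, even for equal letters: on `b ∈ B` the contraction
`l_k^* r_j b = η_{k,j}(b)` cancels against `r_j^* l_k b = η_{k,j}(b)`. -/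
theorem lsemi_rsemi (k j : K) (w : Fock B K) :
    lsemi η k (rsemi η j w) = rsemi η j (lsemi η k w) := by
  induction w using fock_induction with
  | zero => simp
  | add x y hx hy => simp [hx, hy]
  | vac c => simp [lsemi_apply, rsemi_apply]
  | cons c i w =>
    simp [lsemi_apply, rsemi_apply, fockLeft_rightAnnih, fockLeft_rightCreate]
    abel

end Operators

/-! ### The reversal of words and the `B`-valued inner product -/

section StarOperations

variable {B : Type u} [Ring B] [StarRing B] [Algebra ℂ B] [StarModule ℂ B] {K : Type}

theorem rmul_add (b c : B) : rmul B K (b + c) = rmul B K b + rmul B K c := by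
  simp [rmul]

theorem rmul_smul (r : ℂ) (b : B) : rmul B K (r • b) = r • rmul B K b := by
  simp [rmul]

/-- The antilinear involution of the Fock space that reverses words,
`b_0 Z_{k_1} ⋯ Z_{k_m} b_m ↦ b_m^* Z_{k_m} ⋯ Z_{k_1} b_0^*`. -/
def fockStar (B : Type u) [Ring B] [StarRing B] [Algebra ℂ B] [StarModule ℂ B] (K : Type) :
    Fock B K →ₛₗ[starRingEnd ℂ] Fock B K :=
  fockRec
    { toFun := fun b => vac B K (star b)
      map_add' := fun b c => by simp
      map_smul' := fun r b => by simp }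
    fun k =>
      { toFun := fun b => rmul B K (star b) ∘ₗ rightCreate B k
        map_add' := fun b c => by rw [star_add, rmul_add, LinearMap.add_comp]
        map_smul' := fun r b => by
          rw [star_smul, rmul_smul, LinearMap.smul_comp, starRingEnd_apply] }

@[simp]
theorem fockStar_vac (b : B) : fockStar B K (vac B K b) = vac B K (star b) :=
  fockRec_vac _ _ b

@[simp]
theorem fockStar_cons (b : B) (k : K) (w : Fock B K) :
    fockStar B K (fockLeft B K b (leftCreate B k w)) =
      rmul B K (star b) (rightCreate B k (fockStar B K w)) :=
  fockRec_cons _ _ b k w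

@[simp]
theorem fockStar_create (k : K) (w : Fock B K) :
    fockStar B K (leftCreate B k w) = rightCreate B k (fockStar B K w) := by
  have h := fockStar_cons 1 k w
  rwa [map_one, Module.End.one_apply, star_one, rmul_one, Module.End.one_apply] at h

@[simp]
theorem fockStar_left (b : B) (w : Fock B K) :
    fockStar B K (fockLeft B K b w) = rmul B K (star b) (fockStar B K w) := by
  induction w using fock_induction with
  | zero => simp
  | add x y hx hy => simp [hx, hy]
  | vac c => simp
  | cons c k w =>
    rw [fockLeft_mul_apply, fockStar_cons, fockStar_cons, rmul_mul_apply, star_mul]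

@[simp]
theorem fockStar_rmul (b : B) (w : Fock B K) :
    fockStar B K (rmul B K b w) = fockLeft B K (star b) (fockStar B K w) := by
  induction w using fock_induction with
  | zero => simp
  | add x y hx hy => simp [hx, hy]
  | vac c => simp
  | cons c k w h =>
    rw [rmul_cons, fockStar_cons, h, fockStar_cons, fockLeft_rmul, fockLeft_rightCreate]

@[simp]
theorem fockStar_rightCreate (k : K) (w : Fock B K) :
    fockStar B K (rightCreate B k w) = leftCreate B k (fockStar B K w) := by
  induction w using fock_induction with
  | zero => simp
  | add x y hx hy => simp [hx, hy]
  | vac c => simp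
  | cons c j w h => simp [h]

@[simp]
theorem fockStar_fockStar (w : Fock B K) : fockStar B K (fockStar B K w) = w := by
  induction w using fock_induction with
  | zero => simp
  | add x y hx hy => simp [hx, hy]
  | vac c => simp
  | cons c j w h => simp [h]

@[simp]
theorem vacProj_fockStar (w : Fock B K) :
    vacProj B K (fockStar B K w) = star (vacProj B K w) := by
  induction w using fock_induction with
  | zero => simp
  | add x y hx hy => simp [hx, hy]
  | vac c => simp
  | cons c j w h => simp

variable (η : K → K → B →ₗ[ℂ] B)

/-- The `B`-valued inner product on the Fock space, antilinear in the first variable: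
`⟨b, y⟩ = b^* p(y)` and `⟨b Z_k w, y⟩ = ⟨w, l_k^* (b^* y)⟩`. It may be degenerate. -/
def fockInner : Fock B K →ₛₗ[starRingEnd ℂ] Fock B K →ₗ[ℂ] B :=
  fockRec
    { toFun := fun b => vacProj B K ∘ₗ fockLeft B K (star b)
      map_add' := fun b c => by simp [LinearMap.comp_add]
      map_smul' := fun r b => by simp [LinearMap.comp_smul] }
    fun k =>
      { toFun := fun b => (leftAnnih η k ∘ₗ fockLeft B K (star b)).lcomp ℂ B
        map_add' := fun b c => by
          ext f w
          simp
        map_smul' := fun r b => by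
          ext f w
          simp }

@[simp]
theorem fockInner_vac (b : B) (y : Fock B K) :
    fockInner η (vac B K b) y = star b * vacProj B K y := by
  rw [fockInner, fockRec_vac]
  simp

@[simp]
theorem fockInner_cons (b : B) (k : K) (w y : Fock B K) :
    fockInner η (fockLeft B K b (leftCreate B k w)) y =
      fockInner η w (leftAnnih η k (fockLeft B K (star b) y)) := by
  rw [fockInner, fockRec_cons]
  rfl

@[simp]
theorem fockInner_create (k : K) (x y : Fock B K) :
    fockInner η (leftCreate B k x) y = fockInner η x (leftAnnih η k y) := by
  have h := fockInner_cons η 1 k x y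
  rwa [star_one, map_one, Module.End.one_apply, Module.End.one_apply] at h

theorem fockInner_left (b : B) (x y : Fock B K) :
    fockInner η (fockLeft B K b x) y = fockInner η x (fockLeft B K (star b) y) := by
  induction x using fock_induction with
  | zero => simp
  | add x y hx hy => simp [hx, hy]
  | vac c => simp [mul_assoc]
  | cons c j w h =>
    rw [fockLeft_mul_apply, fockInner_cons, fockInner_cons, fockLeft_mul_apply, star_mul]

/-- A covariance is hermitian if `η_{k,j}(b)^* = η_{j,k}(b^*)`. -/
def IsHermitianCovariance (η : K → K → B →ₗ[ℂ] B) : Prop :=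
  ∀ k j b, star (η k j b) = η j k (star b)

variable {η}

theorem fockInner_annih (hη : IsHermitianCovariance η) (k : K) (x y : Fock B K) :
    fockInner η (leftAnnih η k x) y = fockInner η x (leftCreate B k y) := by
  induction x using fock_induction with
  | zero => simp
  | add x y hx hy => simp [hx, hy]
  | vac c => simp
  | cons c j w h =>
    rw [leftAnnih_cons, fockInner_left, fockInner_cons, leftAnnih_cons, hη]

theorem fockInner_lsemi (hη : IsHermitianCovariance η) (k : K) (x y : Fock B K) :
    fockInner η (lsemi η k x) y = fockInner η x (lsemi η k y) := by
  simp [lsemi_apply, fockInner_annih hη, add_comm]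

theorem star_fockInner (hη : IsHermitianCovariance η) (x y : Fock B K) :
    star (fockInner η x y) = fockInner η y x := by
  induction x using fock_induction generalizing y with
  | zero => simp
  | add x z hx hz => simp [hx, hz]
  | vac b =>
    induction y using fock_induction with
    | zero => simp
    | add x y hx hy =>
      rw [map_add, star_add, hx, hy, map_add, LinearMap.add_apply]
    | vac c => simp
    | cons c j w h => simp
  | cons b k w h =>
    rw [fockInner_cons, h, fockInner_annih hη, fockInner_left, star_star]

theorem fockStar_leftAnnih (hη : IsHermitianCovariance η) (k : K) (w : Fock B K) :
    fockStar B K (leftAnnih η k w) = rightAnnih η k (fockStar B K w) := by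
  induction w using fock_induction with
  | zero => simp
  | add x y hx hy => simp [hx, hy]
  | vac c => simp
  | cons c j w h => simp [rightAnnih_rmul_rightCreate, hη k j c]

theorem fockStar_rightAnnih (hη : IsHermitianCovariance η) (k : K) (w : Fock B K) :
    fockStar B K (rightAnnih η k w) = leftAnnih η k (fockStar B K w) := by
  rw [← fockStar_fockStar (leftAnnih η k _), fockStar_leftAnnih hη, fockStar_fockStar]

theorem fockStar_lsemi (hη : IsHermitianCovariance η) (k : K) (w : Fock B K) :
    fockStar B K (lsemi η k w) = rsemi η k (fockStar B K w) := by
  simp [lsemi_apply, rsemi_apply, fockStar_leftAnnih hη]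

theorem fockStar_rsemi (hη : IsHermitianCovariance η) (k : K) (w : Fock B K) :
    fockStar B K (rsemi η k w) = lsemi η k (fockStar B K w) := by
  simp [lsemi_apply, rsemi_apply, fockStar_rightAnnih hη]

end StarOperations

/-! ### Positive elements of bounded star-algebras -/

section Positivity

variable {C : Type*} [Ring C] [StarRing C] [Algebra ℂ C]

/-- The cone of finite sums of hermitian squares. -/
def sqCone (C : Type*) [Ring C] [StarRing C] : AddSubmonoid C :=
  AddSubmonoid.closure (Set.range fun x : C => star x * x)

theorem star_mul_self_mem_sqCone (x : C) : star x * x ∈ sqCone C :=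
  AddSubmonoid.subset_closure ⟨x, rfl⟩

/-- Positivity in terms of the cone of sums of hermitian squares. -/
theorem isPositive_iff {a : C} :
    IsPositive a ↔ ∀ δ : ℝ, 0 < δ → a + (δ : ℂ) • (1 : C) ∈ sqCone C := by
  simp only [IsPositive, Algebra.algebraMap_eq_smul_one]
  rfl

theorem IsPositive.add {a b : C} (ha : IsPositive a) (hb : IsPositive b) :
    IsPositive (a + b) := by
  rw [isPositive_iff] at *
  intro δ hδ
  have h := add_mem (ha (δ / 2) (by positivity)) (hb (δ / 2) (by positivity))
  convert h using 1
  push_cast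
  module

theorem conj_mem_sqCone {a : C} (ha : a ∈ sqCone C) (x : C) : star x * a * x ∈ sqCone C := by
  induction ha using AddSubmonoid.closure_induction with
  | mem y hy =>
    obtain ⟨y, rfl⟩ := hy
    have h := star_mul_self_mem_sqCone (y * x)
    rwa [star_mul, mul_assoc, ← mul_assoc (star y), ← mul_assoc (star x)] at h
  | zero => simp
  | add y z _ _ hy hz =>
    rw [mul_add, add_mul]
    exact add_mem hy hz

variable [StarModule ℂ C]

theorem smul_mem_sqCone {a : C} (ha : a ∈ sqCone C) {r : ℝ} (hr : 0 ≤ r) :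
    (r : ℂ) • a ∈ sqCone C := by
  have h := conj_mem_sqCone ha (((√r : ℝ) : ℂ) • (1 : C))
  have h2 : ((√r : ℝ) : ℂ) * ((√r : ℝ) : ℂ) = r := by
    rw [← Complex.ofReal_mul, Real.mul_self_sqrt hr]
  simp only [star_smul, star_one, RCLike.star_def, Complex.conj_ofReal, smul_mul_assoc, one_mul,
    mul_smul_comm, mul_one, smul_smul, h2] at h
  exact h

theorem isPositive_of_mem_sqCone {a : C} (ha : a ∈ sqCone C) : IsPositive a := by
  rw [isPositive_iff]
  intro δ hδ
  refine add_mem ha (smul_mem_sqCone ?_ hδ.le)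
  simpa using star_mul_self_mem_sqCone (1 : C)

theorem isPositive_star_mul_self (x : C) : IsPositive (star x * x) :=
  isPositive_of_mem_sqCone (star_mul_self_mem_sqCone x)

theorem isPositive_zero : IsPositive (0 : C) := isPositive_of_mem_sqCone (zero_mem _)

theorem isPositive_sum {ι : Type*} (s : Finset ι) (f : ι → C) (h : ∀ i ∈ s, IsPositive (f i)) :
    IsPositive (∑ i ∈ s, f i) :=
  Finset.sum_induction f IsPositive (fun _ _ => IsPositive.add) isPositive_zero h

theorem IsPositive.smul {a : C} (ha : IsPositive a) {r : ℝ} (hr : 0 ≤ r) :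
    IsPositive ((r : ℂ) • a) := by
  rcases hr.eq_or_lt with rfl | hr
  · simpa using isPositive_zero
  rw [isPositive_iff] at *
  intro δ hδ
  have h := smul_mem_sqCone (ha (δ / r) (by positivity)) hr.le
  convert h using 1
  rw [smul_add, smul_smul, ← Complex.ofReal_mul, mul_div_cancel₀ _ hr.ne']

theorem isPositive_one : IsPositive (1 : C) := by
  simpa using isPositive_star_mul_self (1 : C)

theorem isPositive_real {r : ℝ} (hr : 0 ≤ r) : IsPositive ((r : ℂ) • (1 : C)) :=
  isPositive_one.smul hr

theorem isSelfAdjoint_of_mem_sqCone {a : C} (ha : a ∈ sqCone C) : star a = a := by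
  induction ha using AddSubmonoid.closure_induction with
  | mem y hy =>
    obtain ⟨y, rfl⟩ := hy
    simp
  | zero => simp
  | add y z _ _ hy hz => rw [star_add, hy, hz]

theorem IsPositive.star_eq {a : C} (ha : IsPositive a) : star a = a := by
  have h := isSelfAdjoint_of_mem_sqCone (isPositive_iff.1 ha 1 one_pos)
  simpa using h

/-- The element `a` is bounded above by a real multiple of the unit. -/
def IsBddAbove (a : C) : Prop := ∃ c : ℝ, IsPositive ((c : ℂ) • (1 : C) - a)

theorem IsBoundedStarAlgebra.isBddAbove (hC : IsBoundedStarAlgebra C) (b : C) :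
    IsBddAbove (star b * b) := by
  obtain ⟨c, hc⟩ := hC b
  exact ⟨c, by simpa [Algebra.algebraMap_eq_smul_one] using hc⟩

/-- An upper bound for which the difference is exactly a sum of squares. -/
theorem IsBddAbove.exists_mem_sqCone {a : C} (h : IsBddAbove a) :
    ∃ c : ℝ, 1 ≤ c ∧ (c : ℂ) • (1 : C) - a ∈ sqCone C := by
  obtain ⟨c, hc⟩ := h
  have h2 := isPositive_iff.1 (hc.add (isPositive_real (le_max_right (1 - c) 0))) (1 : ℝ) one_pos
  have h3 : 0 ≤ max (1 - c) 0 := le_max_right _ _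
  refine ⟨c + max (1 - c) 0 + 1, ?_, ?_⟩
  · linarith [le_max_left (1 - c) 0]
  · convert h2 using 1
    push_cast
    module

theorem IsBoundedStarAlgebra.isBddAbove_of_star_eq (hC : IsBoundedStarAlgebra C) {b : C}
    (hb : star b = b) : IsBddAbove b := by
  obtain ⟨c, hc⟩ := hC.isBddAbove b
  refine ⟨(c + 1) / 2, ?_⟩
  -- `c + 1 - 2 b = (c - b^2) + (1 - b)^2`
  have h := (hc.add (isPositive_star_mul_self (1 - b))).smul (r := 1 / 2) (by norm_num)
  convert h using 1
  simp only [star_sub, star_one, hb, sub_mul, mul_sub, one_mul, mul_one]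
  push_cast
  module

/-- Positivity may be tested after adding arbitrarily small multiples of an element that is
bounded above. -/
theorem isPositive_of_forall_add_smul {a d : C} (hd : IsBddAbove d)
    (h : ∀ δ : ℝ, 0 < δ → IsPositive (a + (δ : ℂ) • d)) : IsPositive a := by
  obtain ⟨c, hc1, hc⟩ := hd.exists_mem_sqCone
  have hc0 : 0 < c := by linarith
  rw [isPositive_iff]
  intro δ hδ
  have h1 := isPositive_iff.1 ((h (δ / (2 * c)) (by positivity)).add
    ((isPositive_of_mem_sqCone hc).smul (r := δ / (2 * c)) (by positivity))) (δ / 2)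
      (by positivity)
  convert h1 using 1
  have h2 : ((δ / (2 * c) : ℝ) : ℂ) * c = ((δ / 2 : ℝ) : ℂ) := by
    rw [← Complex.ofReal_mul]
    congr 1
    field_simp
  rw [smul_sub, smul_smul, h2]
  push_cast
  module

theorem IsPositive.conj {a : C} (hC : IsBoundedStarAlgebra C) (ha : IsPositive a) (x : C) :
    IsPositive (star x * a * x) := by
  refine isPositive_of_forall_add_smul (hC.isBddAbove x) fun δ hδ => ?_
  have h := conj_mem_sqCone (isPositive_iff.1 ha δ hδ) x
  rw [mul_add, add_mul] at h
  refine isPositive_of_mem_sqCone ?_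
  simpa using h

/-- `(∑ a_i)^* (∑ a_i) ≤ n ∑ a_i^* a_i`. -/
theorem isPositive_card_smul_sub {ι : Type*} [Fintype ι] (a : ι → C) :
    IsPositive (((Fintype.card ι : ℝ) : ℂ) • ∑ i, star (a i) * a i -
      star (∑ i, a i) * ∑ i, a i) := by
  have h : IsPositive (((1 / 2 : ℝ) : ℂ) • ∑ i, ∑ j, star (a i - a j) * (a i - a j)) :=
    IsPositive.smul (isPositive_sum _ _ fun i _ => isPositive_sum _ _ fun j _ =>
      isPositive_star_mul_self _) (by norm_num)
  convert h using 1
  have h1 : ∑ i, ∑ j, star (a i) * a j = star (∑ i, a i) * ∑ i, a i := by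
    rw [star_sum, Finset.sum_mul_sum]
  have h2 : ∑ i, ∑ j, star (a j) * a i = star (∑ i, a i) * ∑ i, a i := by
    rw [Finset.sum_comm, h1]
  have h3 : ∀ i, (∑ _j : ι, star (a i) * a i) = (Fintype.card ι : ℂ) • (star (a i) * a i) := by
    intro i
    rw [Finset.sum_const, Finset.card_univ, Nat.cast_smul_eq_nsmul]
  have h4 : (∑ _i : ι, ∑ j, star (a j) * a j) = (Fintype.card ι : ℂ) • ∑ i, (star (a i) * a i) := by
    rw [Finset.sum_const, Finset.card_univ, Nat.cast_smul_eq_nsmul]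
  simp only [star_sub, sub_mul, mul_sub, Finset.sum_sub_distrib, h1, h2, h3, h4,
    ← Finset.smul_sum]
  push_cast
  module

/-- If `0 ≤ x ≤ s` then `x^2 ≤ s^2`. -/
theorem isPositive_sq_sub_sq (hC : IsBoundedStarAlgebra C) {x : C} {s : ℝ} (hs : 0 < s)
    (h0 : IsPositive x) (h1 : IsPositive ((s : ℂ) • (1 : C) - x)) :
    IsPositive (((s ^ 2 : ℝ) : ℂ) • (1 : C) - x ^ 2) := by
  have hx := h0.star_eq
  -- `s (s x - x^2) = x (s - x) x + (s - x) x (s - x)` and `s^2 - x^2 = (s x - x^2) + s (s - x)`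
  have h2 := (((h1.conj hC x).add (h0.conj hC ((s : ℂ) • (1 : C) - x))).smul
    (r := s⁻¹) (by positivity)).add (h1.smul hs.le)
  convert h2 using 1
  have hs' : ((s⁻¹ : ℝ) : ℂ) * s = 1 := by
    rw [← Complex.ofReal_mul, inv_mul_cancel₀ hs.ne', Complex.ofReal_one]
  have h3 : x * ((s : ℂ) • (1 : C) - x) * x +
      ((s : ℂ) • (1 : C) - x) * x * ((s : ℂ) • (1 : C) - x) =
        (s : ℂ) • ((s : ℂ) • x - x ^ 2) := by
    simp only [sub_mul, mul_sub, one_mul, mul_one, smul_mul_assoc, mul_smul_comm, pow_two]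
    module
  rw [star_sub, star_smul, star_one, hx, RCLike.star_def, Complex.conj_ofReal, h3, smul_smul, hs',
    one_smul]
  push_cast
  module

/-- If `x^(2^j) ≤ r^(2^j)` then `x ≤ r`. -/
theorem isPositive_sub_of_pow {x : C} {r : ℝ} (hr : 0 < r) (hx : star x = x) (j : ℕ)
    (h : IsPositive (((r ^ 2 ^ j : ℝ) : ℂ) • (1 : C) - x ^ 2 ^ j)) :
    IsPositive ((r : ℂ) • (1 : C) - x) := by
  induction j generalizing x r with
  | zero => simpa using h
  | succ j ih =>
    have h1 : IsPositive (((r ^ 2 : ℝ) : ℂ) • (1 : C) - x ^ 2) := by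
      refine ih (by positivity) (by rw [star_pow, hx]) ?_
      rwa [← pow_mul, ← pow_mul, ← pow_succ']
    -- `2 r (r - x) = (r - x)^2 + (r^2 - x^2)`
    have h2 := ((isPositive_star_mul_self ((r : ℂ) • (1 : C) - x)).add h1).smul
      (r := (2 * r)⁻¹) (by positivity)
    convert h2 using 1
    have h3 : star ((r : ℂ) • (1 : C) - x) * ((r : ℂ) • (1 : C) - x) +
        (((r ^ 2 : ℝ) : ℂ) • (1 : C) - x ^ 2) = ((2 * r : ℝ) : ℂ) • ((r : ℂ) • (1 : C) - x) := by
      rw [star_sub, star_smul, star_one, hx, RCLike.star_def, Complex.conj_ofReal]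
      simp only [sub_mul, mul_sub, one_mul, mul_one, smul_mul_assoc, mul_smul_comm, pow_two]
      push_cast
      module
    rw [h3, smul_smul, ← Complex.ofReal_mul, inv_mul_cancel₀ (by positivity),
      Complex.ofReal_one, one_smul]

end Positivity

/-! ### Positive matrices over bounded star-algebras -/

section MatrixPositivity

open Matrix

variable {C : Type*} [Ring C] [StarRing C] [Algebra ℂ C] [StarModule ℂ C]
variable {ι κ : Type*} [Fintype ι] [DecidableEq ι] [Fintype κ] [DecidableEq κ]

theorem conjTranspose_mul_self_mem_sqCone (Z : Matrix κ ι C) :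
    Zᴴ * Z ∈ sqCone (Matrix ι ι C) := by
  rcases isEmpty_or_nonempty ι with h | ⟨⟨p⟩⟩
  · rw [Subsingleton.elim (Zᴴ * Z) 0]
    exact zero_mem _
  -- each row of `Z` is placed in the row `p` of a square matrix
  have h : Zᴴ * Z = ∑ k, star (Matrix.of fun i j => if i = p then Z k j else 0) *
      (Matrix.of fun i j => if i = p then Z k j else 0) := by
    ext i j
    simp [Matrix.sum_apply, Matrix.mul_apply, Matrix.star_apply, apply_ite]
  rw [h]
  exact sum_mem fun k _ => star_mul_self_mem_sqCone _

theorem isPositive_diagonal {b : ι → C} (hb : ∀ i, IsPositive (b i)) :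
    IsPositive (Matrix.diagonal b) := by
  have h1 : ∀ i, ∀ x ∈ sqCone C, Matrix.single i i x ∈ sqCone (Matrix ι ι C) := fun i x hx => by
    induction hx using AddSubmonoid.closure_induction with
    | mem y hy =>
      obtain ⟨y, rfl⟩ := hy
      have h := star_mul_self_mem_sqCone (Matrix.single i i y)
      simpa [Matrix.star_eq_conjTranspose] using h
    | zero => simp
    | add y z _ _ hy hz =>
      rw [Matrix.single_add]
      exact add_mem hy hz
  rw [isPositive_iff]
  intro δ hδ
  have h2 : Matrix.diagonal b + (δ : ℂ) • (1 : Matrix ι ι C) =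
      ∑ i, Matrix.single i i (b i + (δ : ℂ) • (1 : C)) := by
    rw [Matrix.sum_single_eq_diagonal, ← Matrix.diagonal_one, ← Matrix.diagonal_smul,
      Matrix.diagonal_add]
    rfl
  rw [h2]
  exact sum_mem fun i _ => h1 i _ (isPositive_iff.1 (hb i) δ hδ)

/-- A square `M^* M` is at most `n` times its diagonal part. -/
theorem isPositive_card_smul_diagonal_sub (M : Matrix ι ι C) :
    IsPositive (((Fintype.card ι : ℝ) : ℂ) • Matrix.diagonal (fun q => (star M * M) q q) -
      star M * M) := by
  have h := isPositive_card_smul_sub fun q : ι => M * Matrix.single q q (1 : C)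
  have h1 : ∑ q, M * Matrix.single q q (1 : C) = M := by
    rw [← Finset.mul_sum, Matrix.sum_single_eq_diagonal, Matrix.diagonal_one, mul_one]
  have h2 : ∀ q, star (M * Matrix.single q q (1 : C)) * (M * Matrix.single q q (1 : C)) =
      Matrix.single q q ((star M * M) q q) := by
    intro q
    rw [star_mul, mul_assoc, ← mul_assoc (star M), ← mul_assoc, Matrix.star_eq_conjTranspose,
      Matrix.conjTranspose_single, star_one, Matrix.single_mul_mul_single, one_mul, mul_one]
  simpa only [h1, h2, Matrix.sum_single_eq_diagonal] using h

theorem isBddAbove_diagonal {b : ι → C} (hb : ∀ i, IsBddAbove (b i)) :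
    IsBddAbove (Matrix.diagonal b) := by
  choose c hc using hb
  have hc' : ∀ i, c i ≤ ∑ j, |c j| := fun i => (le_abs_self _).trans
    (Finset.single_le_sum (f := fun j => |c j|) (fun _ _ => abs_nonneg _) (Finset.mem_univ i))
  refine ⟨∑ j, |c j|, ?_⟩
  have h := isPositive_diagonal fun i => (hc i).add (isPositive_real (sub_nonneg.2 (hc' i)))
  convert h using 1
  rw [← Matrix.diagonal_one, ← Matrix.diagonal_smul, Matrix.diagonal_sub]
  congr 1
  ext i
  simp only [Pi.smul_apply]
  push_cast
  module

/-- A matrix `M^* M` is bounded by a multiple of its diagonal part, whose entries are bounded. -/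
theorem IsBoundedStarAlgebra.matrix (hC : IsBoundedStarAlgebra C) :
    IsBoundedStarAlgebra (Matrix ι ι C) := by
  intro M
  obtain ⟨c, hc⟩ := isBddAbove_diagonal (b := fun q => (star M * M) q q) fun q =>
    hC.isBddAbove_of_star_eq (by
      rw [← Matrix.star_apply, star_mul, star_star])
  refine ⟨Fintype.card ι * c, ?_⟩
  have h := (hc.smul (r := Fintype.card ι) (by positivity)).add
    (isPositive_card_smul_diagonal_sub M)
  rw [Algebra.algebraMap_eq_smul_one]
  convert h using 1
  push_cast
  module

theorem IsPositive.apply_self {M : Matrix ι ι C} (hM : IsPositive M) (i : ι) :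
    IsPositive (M i i) := by
  have h1 : ∀ X ∈ sqCone (Matrix ι ι C), X i i ∈ sqCone C := fun X hX => by
    induction hX using AddSubmonoid.closure_induction with
    | mem y hy =>
      obtain ⟨y, rfl⟩ := hy
      exact sum_mem fun k _ => star_mul_self_mem_sqCone _
    | zero => exact zero_mem _
    | add y z _ _ hy hz => exact add_mem hy hz
  rw [isPositive_iff] at *
  intro δ hδ
  simpa using h1 _ (hM δ hδ)

theorem IsPositive.conjTranspose_mul_mul (hC : IsBoundedStarAlgebra C) {Q : Matrix ι ι C}
    (hQ : IsPositive Q) (Y : Matrix ι κ C) : IsPositive (Yᴴ * Q * Y) := by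
  have h1 : ∀ X ∈ sqCone (Matrix ι ι C), Yᴴ * X * Y ∈ sqCone (Matrix κ κ C) := fun X hX => by
    induction hX using AddSubmonoid.closure_induction with
    | mem y hy =>
      obtain ⟨y, rfl⟩ := hy
      have h := conjTranspose_mul_self_mem_sqCone (y * Y)
      rwa [Matrix.conjTranspose_mul, Matrix.mul_assoc, ← Matrix.mul_assoc yᴴ,
        ← Matrix.mul_assoc Yᴴ] at h
    | zero => simp
    | add y z _ _ hy hz =>
      rw [Matrix.mul_add, Matrix.add_mul]
      exact add_mem hy hz
  have hb : IsBddAbove (Yᴴ * Y) := hC.matrix.isBddAbove_of_star_eq (by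
    rw [Matrix.star_eq_conjTranspose, Matrix.conjTranspose_mul, Matrix.conjTranspose_conjTranspose])
  refine isPositive_of_forall_add_smul hb fun δ hδ => isPositive_of_mem_sqCone ?_
  have h := h1 _ (isPositive_iff.1 hQ δ hδ)
  simpa [Matrix.mul_add, Matrix.add_mul] using h

/-- Powers of a matrix with central entries are compatible with transposition. -/
theorem transpose_pow_of_central {W : Matrix ι ι C} (hW : ∀ i j c, Commute (W i j) c) (m : ℕ) :
    (W ^ m)ᵀ = Wᵀ ^ m := by
  have hW' : ∀ i j, W i j ∈ Subring.center C := fun i j =>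
    Subring.mem_center_iff.2 fun c => ((hW i j c).eq).symm
  let V : Matrix ι ι (Subring.center C) := fun i j => ⟨W i j, hW' i j⟩
  have hV : (Subring.center C).subtype.mapMatrix V = W := rfl
  have hV' : (Subring.center C).subtype.mapMatrix Vᵀ = Wᵀ := rfl
  rw [← hV', ← hV, ← map_pow, ← map_pow, ← Matrix.transpose_pow]
  rfl

/-- The transpose of a positive matrix with central entries is positive. (For a C*-algebra this is
clear, since the centre is a commutative C*-algebra.) Normalize to `0 ≤ Q ≤ s` and put
`W = s - Q`, so that `0 ≤ W ≤ s` and `W^m ≤ s^m` for the powers `m = 2^j`. The matrices `W^m` and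
`(Wᵀ)^m` have the same diagonal, and the latter is a square; hence `(Wᵀ)^m ≤ n s^m`, where `n` is
the size of the matrices. Taking `m`-th roots yields `Wᵀ ≤ n^(1/m) s`, and `n^(1/m)` tends
to `1`. -/
theorem IsPositive.transpose_of_central (hC : IsBoundedStarAlgebra C) {Q : Matrix ι ι C}
    (hQ : IsPositive Q) (hc : ∀ i j c, Commute (Q i j) c) : IsPositive Qᵀ := by
  obtain ⟨s, hs1, hs⟩ := (hC.matrix.isBddAbove_of_star_eq hQ.star_eq).exists_mem_sqCone
  have hs0 : 0 < s := by linarith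
  obtain ⟨W, hWdef⟩ : ∃ W, W = (s : ℂ) • (1 : Matrix ι ι C) - Q := ⟨_, rfl⟩
  have hW0 : IsPositive W := hWdef ▸ isPositive_of_mem_sqCone hs
  have hWs : IsPositive ((s : ℂ) • (1 : Matrix ι ι C) - W) := by
    rw [hWdef]
    simpa using hQ
  have hWc : ∀ i j c, Commute (W i j) c := by
    intro i j c
    rw [hWdef, Matrix.sub_apply, Matrix.smul_apply, Matrix.one_apply]
    refine Commute.sub_left (Commute.smul_left ?_ _) (hc i j c)
    split_ifs
    · exact Commute.one_left c
    · exact Commute.zero_left c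
  have hWt : star Wᵀ = Wᵀ := by
    have h := congrArg Matrix.transpose hW0.star_eq
    rw [Matrix.star_eq_conjTranspose] at *
    exact h
  have hpow : ∀ j : ℕ, IsPositive (W ^ 2 ^ j) ∧
      IsPositive (((s ^ 2 ^ j : ℝ) : ℂ) • (1 : Matrix ι ι C) - W ^ 2 ^ j) := by
    intro j
    induction j with
    | zero => simpa using ⟨hW0, hWs⟩
    | succ j ih =>
      have h := isPositive_sq_sub_sq hC.matrix (by positivity) ih.1 ih.2
      rw [pow_succ, pow_mul, pow_mul]
      refine ⟨?_, h⟩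
      have h2 := isPositive_star_mul_self (W ^ 2 ^ j)
      rwa [ih.1.star_eq, ← pow_two] at h2
  have hbound : ∀ j : ℕ, IsPositive (((Fintype.card ι * s ^ 2 ^ (j + 1) : ℝ) : ℂ) •
      (1 : Matrix ι ι C) - Wᵀ ^ 2 ^ (j + 1)) := by
    intro j
    have hH : star (Wᵀ ^ 2 ^ j) = Wᵀ ^ 2 ^ j := by rw [star_pow, hWt]
    have h1 := isPositive_card_smul_diagonal_sub (Wᵀ ^ 2 ^ j)
    rw [hH, ← pow_add, ← two_mul, ← pow_succ'] at h1
    have h2 : IsPositive (Matrix.diagonal fun q =>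
        ((s ^ 2 ^ (j + 1) : ℝ) : ℂ) • (1 : C) - (Wᵀ ^ 2 ^ (j + 1)) q q) := by
      refine isPositive_diagonal fun q => ?_
      have h3 := (hpow (j + 1)).2.apply_self q
      rw [← transpose_pow_of_central hWc]
      simpa using h3
    have h4 := (h2.smul (r := Fintype.card ι) (by positivity)).add h1
    convert h4 using 1
    have h5 : (Matrix.diagonal fun q =>
        ((s ^ 2 ^ (j + 1) : ℝ) : ℂ) • (1 : C) - (Wᵀ ^ 2 ^ (j + 1)) q q) =
        ((s ^ 2 ^ (j + 1) : ℝ) : ℂ) • (1 : Matrix ι ι C) -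
          Matrix.diagonal fun q => (Wᵀ ^ 2 ^ (j + 1)) q q := by
      rw [← Matrix.diagonal_one, ← Matrix.diagonal_smul, Matrix.diagonal_sub]
      rfl
    rw [h5]
    push_cast
    module
  rw [isPositive_iff]
  intro δ hδ
  -- `((s + δ/2) / s)^m` exceeds `n` for large `m`
  obtain ⟨N, hN⟩ := pow_unbounded_of_one_lt (Fintype.card ι : ℝ)
    (show 1 < (s + δ / 2) / s by rw [lt_div_iff₀ hs0]; linarith)
  have hN2 : (Fintype.card ι : ℝ) * s ^ 2 ^ (N + 1) ≤ (s + δ / 2) ^ 2 ^ (N + 1) := by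
    have h1 : ((s + δ / 2) / s) ^ N ≤ ((s + δ / 2) / s) ^ 2 ^ (N + 1) :=
      pow_le_pow_right₀ (by rw [le_div_iff₀ hs0]; linarith)
        ((Nat.lt_two_pow_self).le.trans (Nat.pow_le_pow_right two_pos (Nat.le_succ N)))
    have h2 := hN.le.trans h1
    rwa [div_pow, le_div_iff₀ (by positivity)] at h2
  have h1 : IsPositive (((s + δ / 2 : ℝ) : ℂ) • (1 : Matrix ι ι C) - Wᵀ) := by
    refine isPositive_sub_of_pow (by positivity) hWt (N + 1) ?_
    have h2 := (hbound N).add (isPositive_real (sub_nonneg.2 hN2))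
    convert h2 using 1
    push_cast
    module
  have h2 := isPositive_iff.1 h1 (δ / 2) (by positivity)
  convert h2 using 1
  rw [hWdef, Matrix.transpose_sub, Matrix.transpose_smul, Matrix.transpose_one]
  push_cast
  module

/-- Transposition takes the positive matrices over `C` to those over the opposite algebra; in
general `Q ↦ Q.map op` does not preserve positivity. -/
theorem IsPositive.transpose_map_op {Q : Matrix ι ι C} (hQ : IsPositive Q) :
    IsPositive (Qᵀ.map op) := by
  have h1 : ∀ X ∈ sqCone (Matrix ι ι C), Xᵀ.map op ∈ sqCone (Matrix ι ι Cᵐᵒᵖ) := fun X hX => by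
    induction hX using AddSubmonoid.closure_induction with
    | mem y hy =>
      obtain ⟨y, rfl⟩ := hy
      have h := star_mul_self_mem_sqCone ((star y)ᵀ.map op)
      convert h using 1
      ext i j
      simp [Matrix.mul_apply, Matrix.star_apply]
    | zero =>
      convert zero_mem (sqCone (Matrix ι ι Cᵐᵒᵖ)) using 1
      ext i j
      simp
    | add y z _ _ hy hz =>
      convert add_mem hy hz using 1
      ext i j
      simp
  rw [isPositive_iff] at *
  intro δ hδ
  convert h1 _ (hQ δ hδ) using 1
  ext i j
  by_cases h : i = j
  · simp [h]
  · simp [h]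

/-- A mixture of positive matrices, the second one with central entries. -/
theorem IsPositive.sum_mul_of_central (hC : IsBoundedStarAlgebra C) {P : Matrix ι ι C}
    {Q : Matrix (κ × ι) (κ × ι) C} (hP : IsPositive P) (hQ : IsPositive Q)
    (hc : ∀ i j c, Commute (Q i j) c) :
    IsPositive (Matrix.of fun p q : κ => ∑ i, ∑ j, P i j * Q (p, i) (q, j)) := by
  have h1 : ∀ X ∈ sqCone (Matrix ι ι C),
      IsPositive (Matrix.of fun p q : κ => ∑ i, ∑ j, X i j * Q (p, i) (q, j)) := fun X hX => by
    induction hX using AddSubmonoid.closure_induction with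
    | mem y hy =>
      obtain ⟨y, rfl⟩ := hy
      have h : IsPositive (∑ k, (Matrix.of fun (a : κ × ι) (q : κ) =>
          if a.1 = q then y k a.2 else 0)ᴴ * Q * (Matrix.of fun (a : κ × ι) (q : κ) =>
            if a.1 = q then y k a.2 else 0)) :=
        isPositive_sum _ _ fun k _ => hQ.conjTranspose_mul_mul hC _
      convert h using 1
      ext p q
      simp only [Matrix.of_apply, Matrix.sum_apply, Matrix.mul_apply, Matrix.star_apply,
        Matrix.conjTranspose_apply, Fintype.sum_prod_type, apply_ite star, star_zero, ite_mul,
        mul_ite, zero_mul, mul_zero, Finset.sum_ite_irrel, Finset.sum_const_zero,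
        Finset.sum_ite_eq', Finset.mem_univ, if_true, Finset.sum_mul]
      rw [Finset.sum_comm]
      refine (Finset.sum_congr rfl fun _ _ => Finset.sum_comm).trans ?_
      rw [Finset.sum_comm]
      refine Finset.sum_congr rfl fun k _ => Finset.sum_congr rfl fun j _ =>
        Finset.sum_congr rfl fun i _ => ?_
      rw [mul_assoc, mul_assoc, (hc _ _ _).eq]
    | zero =>
      convert isPositive_zero (C := Matrix κ κ C) using 1
      ext p q
      simp
    | add y z _ _ hy hz =>
      convert hy.add hz using 1
      ext p q
      simp [add_mul, Finset.sum_add_distrib]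
  have hb : IsBddAbove (Matrix.of fun p q : κ => ∑ i, Q (p, i) (q, i)) :=
    hC.matrix.isBddAbove_of_star_eq (by
      ext p q
      simp only [Matrix.star_apply, Matrix.of_apply, star_sum]
      refine Finset.sum_congr rfl fun i _ => ?_
      rw [← Matrix.star_apply, hQ.star_eq])
  refine isPositive_of_forall_add_smul hb fun δ hδ => ?_
  convert h1 _ (isPositive_iff.1 hP δ hδ) using 1
  ext p q
  simp [add_mul, Finset.sum_add_distrib, Matrix.one_apply, Finset.smul_sum]

theorem nonneg_of_forall_add_mul {t a : ℂ} (h : ∀ δ : ℝ, 0 < δ → 0 ≤ t + δ * a) : 0 ≤ t := by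
  have h1 := fun δ hδ => (Complex.nonneg_iff.1 (h δ hδ)).1
  have h2 := (Complex.nonneg_iff.1 (h 1 one_pos)).2
  have h3 := (Complex.nonneg_iff.1 (h 2 two_pos)).2
  simp at h1 h2 h3
  refine Complex.nonneg_iff.2 ⟨?_, by linarith⟩
  by_contra! hneg
  have h4 := h1 (-t.re / (2 * (|a.re| + 1))) (by
    apply div_pos <;> [linarith; positivity])
  have h5 : -t.re / (2 * (|a.re| + 1)) * a.re ≤ -t.re / 2 := by
    rw [div_mul_eq_mul_div, div_le_div_iff₀ (by positivity) two_pos]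
    nlinarith [le_abs_self a.re, abs_nonneg a.re]
  linarith

/-- The trace of a product of positive matrices is nonnegative. -/
theorem IsState.sum_mul_nonneg {τ : C →ₗ[ℂ] ℂ} (hτ : IsState τ) (hτ' : IsTracial τ)
    {P Q : Matrix ι ι C} (hP : IsPositive P) (hQ : IsPositive Q) :
    0 ≤ τ (∑ i, ∑ j, P i j * Q j i) := by
  have hlin : ∀ P Q : Matrix ι ι C, ∑ i, ∑ j, P i j * Q j i = (P * Q).trace := fun P Q => by
    simp [Matrix.trace, Matrix.mul_apply]
  have hcyc : ∀ P Q : Matrix ι ι C, τ (P * Q).trace = τ (Q * P).trace := fun P Q => by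
    simp only [← hlin, map_sum, hτ' (P _ _)]
    rw [Finset.sum_comm]
  simp only [hlin]
  have h1 : ∀ X ∈ sqCone (Matrix ι ι C), ∀ Y : Matrix ι ι C,
      0 ≤ τ (X * (star Y * Y)).trace := fun X hX Y => by
    induction hX using AddSubmonoid.closure_induction with
    | mem y hy =>
      obtain ⟨y, rfl⟩ := hy
      have h2 : τ (star y * y * (star Y * Y)).trace =
          τ (star (y * star Y) * (y * star Y)).trace := by
        rw [← mul_assoc, hcyc, star_mul, star_star]
        simp only [mul_assoc]
      rw [h2]
      simp only [Matrix.trace, Matrix.diag, Matrix.mul_apply, Matrix.star_apply, map_sum]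
      exact Finset.sum_nonneg fun i _ => Finset.sum_nonneg fun j _ => hτ.nonneg _
    | zero => simp
    | add y z _ _ hy hz =>
      rw [add_mul, Matrix.trace_add, map_add]
      exact add_nonneg hy hz
  have h2 : ∀ X ∈ sqCone (Matrix ι ι C), ∀ Y ∈ sqCone (Matrix ι ι C),
      0 ≤ τ (X * Y).trace := fun X hX Y hY => by
    induction hY using AddSubmonoid.closure_induction with
    | mem y hy =>
      obtain ⟨y, rfl⟩ := hy
      exact h1 X hX y
    | zero => simp
    | add y z _ _ hy hz =>
      rw [mul_add, Matrix.trace_add, map_add]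
      exact add_nonneg hy hz
  refine nonneg_of_forall_add_mul (a := τ P.trace) fun δ hδ => ?_
  refine nonneg_of_forall_add_mul (a := τ Q.trace + δ * τ (1 : Matrix ι ι C).trace) fun ε hε => ?_
  have h3 := h2 _ (isPositive_iff.1 hP ε hε) _ (isPositive_iff.1 hQ δ hδ)
  convert h3 using 1
  simp [add_mul, mul_add, smul_smul]
  ring

end MatrixPositivity

/-! ### Positivity of the inner product of the Fock space -/

section InnerPositivity

open Matrix

variable {B : Type u} [Ring B] [StarRing B] [Algebra ℂ B] [StarModule ℂ B] {K : Type}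

/-- A covariance is positive if the matrices `[η_{k_s,k_t}(b_s^* b_t)]` are positive. -/
def IsPositiveCovariance (η : K → K → B →ₗ[ℂ] B) : Prop :=
  ∀ (n : ℕ) (k : Fin n → K) (b : Fin n → B),
    IsPositive (Matrix.of fun s t => η (k s) (k t) (star (b s) * b t))

/-- For a diagonal covariance the matrix is the sum over the letters `c` of the compressions of
`[η_c(b_s^* b_t)]` to the indices `s` with `k_s = c`. -/
theorem isPositiveCovariance_diagCovariance (hB : IsBoundedStarAlgebra B) [Finite K]
    [DecidableEq K] {η : K → B →ₗ[ℂ] B} (hη : ∀ k, IsCompletelyPositive (η k)) :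
    IsPositiveCovariance (diagCovariance η) := by
  intro n k b
  have := Fintype.ofFinite K
  have h : IsPositive (∑ c : K, (Matrix.diagonal fun s => if k s = c then (1 : B) else 0)ᴴ *
      (Matrix.of fun s t => star (b s) * b t).map (η c) *
        Matrix.diagonal fun s => if k s = c then (1 : B) else 0) := by
    refine isPositive_sum _ _ fun c _ => IsPositive.conjTranspose_mul_mul hB (hη c n _ ?_) _
    have h1 := isPositive_of_mem_sqCone (conjTranspose_mul_self_mem_sqCone
      (Matrix.of fun (_ : Fin 1) s => b s))
    convert h1 using 1
    ext s t
    simp [Matrix.mul_apply]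
  convert h using 1
  ext s t
  simp only [Matrix.of_apply, Matrix.sum_apply, Matrix.diagonal_conjTranspose,
    Matrix.mul_diagonal, Matrix.diagonal_mul, Matrix.map_apply, Pi.star_apply, apply_ite star,
    star_one, star_zero, ite_mul, mul_ite, one_mul, mul_one, zero_mul, mul_zero]
  rw [Finset.sum_ite_eq Finset.univ (k t)]
  simp only [Finset.mem_univ, if_true, diagCovariance]
  split_ifs with h2
  · rw [h2]
  · rfl

/-- Completely positive maps are hermitian: they are so on positive elements, and in a bounded
star-algebra these span. -/
theorem isHermitianCovariance_diagCovariance (hB : IsBoundedStarAlgebra B)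
    [DecidableEq K] {η : K → B →ₗ[ℂ] B} (hη : ∀ k, IsCompletelyPositive (η k)) :
    IsHermitianCovariance (diagCovariance η) := by
  have hpos : ∀ k (b : B), IsPositive b → star (η k b) = η k b := fun k b hb => by
    have h := hη k 1 (Matrix.diagonal fun _ => b) (isPositive_diagonal fun _ => hb)
    simpa using (h.apply_self 0).star_eq
  -- a hermitian element is a difference of positive elements
  have hsa : ∀ k (b : B), star b = b → star (η k b) = η k b := fun k b hb => by
    obtain ⟨c, hc1, hc⟩ := (hB.isBddAbove_of_star_eq hb).exists_mem_sqCone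
    have h1 := hpos k _ (isPositive_of_mem_sqCone hc)
    have h2 := hpos k _ (isPositive_real (C := B) (zero_le_one.trans hc1))
    rw [map_sub, star_sub, h2] at h1
    exact sub_right_injective h1
  have hstar : ∀ k (b : B), star (η k b) = η k (star b) := fun k b => by
    have h1 := hsa k (b + star b) (by simp [add_comm])
    have h2 := hsa k (Complex.I • (b - star b)) (by
      simp only [star_smul, star_sub, star_star, RCLike.star_def, Complex.conj_I]
      module)
    rw [map_add, star_add] at h1
    rw [map_smul, map_sub, star_smul, star_sub, RCLike.star_def, Complex.conj_I] at h2
    have h3 : star (η k b) - star (η k (star b)) = -(η k b - η k (star b)) := by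
      have h := congrArg (fun x => Complex.I • x) h2
      simpa [smul_smul] using h
    have h4 : (2 : ℂ) • star (η k b) = (2 : ℂ) • η k (star b) :=
      calc (2 : ℂ) • star (η k b) = (star (η k b) + star (η k (star b))) +
            (star (η k b) - star (η k (star b))) := by module
        _ = (2 : ℂ) • η k (star b) := by
          rw [h1, h3]
          module
    exact smul_right_injective B (two_ne_zero' ℂ) h4
  intro k j b
  unfold diagCovariance
  by_cases h : k = j
  · subst h
    simpa using hstar k b
  · simp [h, Ne.symm h]

variable {η : K → K → B →ₗ[ℂ] B}

theorem fockLeft_smul_one (r : ℂ) (w : Fock B K) : fockLeft B K (r • (1 : B)) w = r • w := by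
  rw [map_smul, map_one, LinearMap.smul_apply, Module.End.one_apply]

theorem fockInner_fockLeft_smul_one (η : K → K → B →ₗ[ℂ] B) (r : ℂ) (x y : Fock B K) :
    fockInner η x (fockLeft B K (r • (1 : B)) y) = r • fockInner η x y := by
  rw [fockLeft_smul_one, map_smul]

/-- Vectors with at most one word of each length `< m`, nested in each other:
`a_0 + b_1 Z_{k_1} (a_1 + b_2 Z_{k_2} (⋯))`. -/
def nestedWords (B : Type u) [Ring B] [Algebra ℂ B] (K : Type) : ℕ → Set (Fock B K)
  | 0 => {0}
  | m + 1 => {x | ∃ a b k, ∃ w ∈ nestedWords B K m,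
      x = vac B K a + fockLeft B K b (leftCreate B k w)}

theorem nestedWords_mono [Nonempty K] : Monotone (nestedWords B K) := by
  refine monotone_nat_of_le_succ fun m => ?_
  induction m with
  | zero =>
    rintro x rfl
    exact ⟨0, 0, Classical.arbitrary K, 0, rfl, by simp⟩
  | succ m ih =>
    rintro x ⟨a, b, k, w, hw, rfl⟩
    exact ⟨a, b, k, w, ih hw, rfl⟩

theorem fockLeft_mem_nestedWords (c : B) (m : ℕ) {x : Fock B K} (hx : x ∈ nestedWords B K m) :
    fockLeft B K c x ∈ nestedWords B K m := by
  cases m with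
  | zero =>
    obtain rfl : x = 0 := hx
    rw [map_zero]
    rfl
  | succ m =>
    obtain ⟨a, b, k, w, hw, rfl⟩ := hx
    refine ⟨c * a, c * b, k, w, hw, ?_⟩
    rw [map_add, fockLeft_vac, fockLeft_mul_apply]

theorem exists_mem_span_nestedWords [Nonempty K] (x : Fock B K) :
    ∃ m, x ∈ Submodule.span ℂ (nestedWords B K m) := by
  induction x using fock_induction with
  | zero => exact ⟨0, zero_mem _⟩
  | add x y hx hy =>
    obtain ⟨m, hm⟩ := hx
    obtain ⟨n, hn⟩ := hy
    exact ⟨max m n, add_mem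
      (Submodule.span_mono (nestedWords_mono (le_max_left m n)) hm)
      (Submodule.span_mono (nestedWords_mono (le_max_right m n)) hn)⟩
  | vac b =>
    exact ⟨1, Submodule.subset_span ⟨b, 0, Classical.arbitrary K, 0, rfl, by simp⟩⟩
  | cons b k w h =>
    obtain ⟨m, hm⟩ := h
    refine ⟨m + 1, ?_⟩
    have h : Submodule.span ℂ (nestedWords B K m) ≤
        (Submodule.span ℂ (nestedWords B K (m + 1))).comap
          (fockLeft B K b ∘ₗ leftCreate B k) := by
      rw [Submodule.span_le]
      intro w hw
      exact Submodule.subset_span ⟨0, b, k, w, hw, by simp⟩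
    exact h hm

/-- The Gram matrix of a family of vectors. -/
def gram (η : K → K → B →ₗ[ℂ] B) {ι : Type*} (x : ι → Fock B K) : Matrix ι ι B :=
  Matrix.of fun i j => fockInner η (x i) (x j)

/-- For `x_i = a_i + b_i Z_{k_i} w_i` the Gram matrix has the entries
`a_i^* a_j + ⟨w_i, η_{k_i,k_j}(b_i^* b_j) w_j⟩`. The matrix `[η_{k_i,k_j}(b_i^* b_j)]` is positive,
and if it is a square `y^* y` then the second summand is the sum over `k` of the Gram matrices
of the vectors `y_{k,i} w_i`, to which induction applies. -/
theorem isPositive_gram_nestedWords (hB : IsBoundedStarAlgebra B)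
    (hη : IsHermitianCovariance η) (hη' : IsPositiveCovariance η) (m n : ℕ)
    (x : Fin n → Fock B K) (hx : ∀ i, x i ∈ nestedWords B K m) : IsPositive (gram η x) := by
  induction m generalizing x with
  | zero =>
    convert isPositive_zero (C := Matrix (Fin n) (Fin n) B) using 1
    ext i j
    simp [gram, show x i = 0 from hx i]
  | succ m ih =>
    choose a b k w hw hx using hx
    have h1 : IsPositive (Matrix.of fun i j => star (a i) * a j) := by
      have h := isPositive_of_mem_sqCone (conjTranspose_mul_self_mem_sqCone
        (Matrix.of fun (_ : Fin 1) s => a s))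
      convert h using 1
      ext s t
      simp [Matrix.mul_apply]
    have h2 : ∀ X ∈ sqCone (Matrix (Fin n) (Fin n) B),
        IsPositive (Matrix.of fun i j => fockInner η (w i) (fockLeft B K (X i j) (w j))) := by
      intro X hX
      induction hX using AddSubmonoid.closure_induction with
      | mem y hy =>
        obtain ⟨y, rfl⟩ := hy
        have h : IsPositive (∑ k, gram η fun i => fockLeft B K (y k i) (w i)) :=
          isPositive_sum _ _ fun k _ => ih _ fun i => fockLeft_mem_nestedWords _ _ (hw i)
        convert h using 1
        ext i j
        simp [gram, Matrix.sum_apply, Matrix.mul_apply, fockInner_left, Matrix.star_apply]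
      | zero =>
        convert isPositive_zero (C := Matrix (Fin n) (Fin n) B) using 1
        ext i j
        simp
      | add y z _ _ hy hz =>
        convert hy.add hz using 1
        ext i j
        simp
    have h3 : IsPositive (Matrix.of fun i j =>
        fockInner η (w i) (fockLeft B K (η (k i) (k j) (star (b i) * b j)) (w j))) := by
      have hb : IsBddAbove (Matrix.diagonal fun i => fockInner η (w i) (w i)) :=
        isBddAbove_diagonal fun i => hB.isBddAbove_of_star_eq (star_fockInner hη _ _)
      refine isPositive_of_forall_add_smul hb fun δ hδ => ?_
      convert h2 _ (isPositive_iff.1 (hη' n k b) δ hδ) using 1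
      ext i j
      by_cases hij : i = j
      · subst hij
        simpa using (fockInner_fockLeft_smul_one η δ (w i) (w i)).symm
      · simp [hij]
    convert h1.add h3 using 1
    ext i j
    simp [gram, hx, fockLeft_mul_apply, -map_mul]

/-- Gram matrices of the inner product of the Fock space are positive. -/
theorem isPositive_gram [Nonempty K] (hB : IsBoundedStarAlgebra B)
    (hη : IsHermitianCovariance η) (hη' : IsPositiveCovariance η) {ι : Type*} [Fintype ι]
    [DecidableEq ι] (x : ι → Fock B K) : IsPositive (gram η x) := by
  choose m hm using fun i => exists_mem_span_nestedWords (x i)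
  obtain ⟨M, hM⟩ : ∃ M, ∀ i, m i ≤ M :=
    ⟨Finset.univ.sup m, fun i => Finset.le_sup (Finset.mem_univ i)⟩
  have hx : ∀ i, ∃ l : nestedWords B K M →₀ ℂ,
      Finsupp.linearCombination ℂ Subtype.val l = x i := fun i =>
    (Finsupp.mem_span_iff_linearCombination ℂ _ _).1
      (Submodule.span_mono (nestedWords_mono (hM i)) (hm i))
  choose l hl using hx
  classical
  -- all `x i` are combinations of the same finite family of nested words
  let T : Finset (nestedWords B K M) := Finset.univ.biUnion fun i => (l i).support
  have hT : ∀ i, x i = ∑ t : Fin T.card, l i (T.equivFin.symm t) •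
      ((T.equivFin.symm t : nestedWords B K M) : Fock B K) := by
    intro i
    rw [← hl i, Finsupp.linearCombination_apply, Finsupp.sum_of_support_subset (s := T)]
    · rw [← Finset.sum_coe_sort T, ← Equiv.sum_comp T.equivFin.symm]
    · exact Finset.subset_biUnion_of_mem (fun i => (l i).support) (Finset.mem_univ i)
    · simp
  have h := (isPositive_gram_nestedWords hB hη hη' M T.card
    (fun t => ((T.equivFin.symm t : nestedWords B K M) : Fock B K))
    fun t => Subtype.prop _).conjTranspose_mul_mul hB
      (Matrix.of fun t i => (l i (T.equivFin.symm t)) • (1 : B))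
  convert h using 1
  ext i j
  rw [gram, Matrix.of_apply, hT i, hT j]
  simp [Matrix.mul_apply, gram, Finset.smul_sum]

/-- The operator `S_k` is bounded for the `B`-valued inner product. With `c ≥ η_{k,k}(1)` one has
`l_k^* l_k ≤ c`, hence `(l_k l_k^*)^2 ≤ c l_k l_k^*` and `l_k l_k^* ≤ c`. -/
theorem exists_isPositive_smul_gram_sub [Nonempty K] (hB : IsBoundedStarAlgebra B)
    (hη : IsHermitianCovariance η) (hη' : IsPositiveCovariance η) (k : K) :
    ∃ c : ℝ, ∀ {ι : Type} [Fintype ι] [DecidableEq ι] (x : ι → Fock B K),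
      IsPositive ((c : ℂ) • gram η x - gram η fun i => lsemi η k (x i)) := by
  have hk : star (η k k 1) = η k k 1 := by rw [hη, star_one]
  obtain ⟨c, hc1, hc⟩ := (hB.isBddAbove_of_star_eq hk).exists_mem_sqCone
  have hc0 : 0 < c := by linarith
  refine ⟨2 * c + 2 * c, fun {ι} _ _ x => ?_⟩
  have hd : ∀ d ∈ sqCone B, ∀ x : ι → Fock B K,
      IsPositive (Matrix.of fun i j => fockInner η (x i) (fockLeft B K d (x j))) := by
    intro d hd x
    induction hd using AddSubmonoid.closure_induction with
    | mem y hy =>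
      obtain ⟨y, rfl⟩ := hy
      convert isPositive_gram hB hη hη' fun i => fockLeft B K y (x i) using 1
      ext i j
      simp [gram, fockInner_left]
    | zero =>
      convert isPositive_zero (C := Matrix ι ι B) using 1
      ext i j
      simp
    | add y z _ _ hy hz =>
      convert hy.add hz using 1
      ext i j
      simp
  have h1 : ∀ x : ι → Fock B K,
      IsPositive ((c : ℂ) • gram η x - gram η fun i => leftCreate B k (x i)) := by
    intro x
    convert hd _ hc x using 1
    ext i j
    simpa [gram] using (fockInner_fockLeft_smul_one η c (x i) (x j)).symm
  have h2 : IsPositive ((c : ℂ) • gram η x - gram η fun i => leftAnnih η k (x i)) := by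
    have h3 := (h1 fun i => leftAnnih η k (x i)).add (isPositive_gram hB hη hη' fun i =>
      (c : ℂ) • x i - leftCreate B k (leftAnnih η k (x i)))
    have h4 := h3.smul (r := c⁻¹) (by positivity)
    convert h4 using 1
    ext i j
    have hc' : ((c⁻¹ : ℝ) : ℂ) * c = 1 := by
      rw [← Complex.ofReal_mul, inv_mul_cancel₀ hc0.ne', Complex.ofReal_one]
    simp only [gram, Matrix.sub_apply, Matrix.smul_apply, Matrix.add_apply, Matrix.of_apply,
      map_sub, LinearMap.sub_apply, map_smulₛₗ, LinearMap.smul_apply,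
      fockInner_create, fockInner_annih hη, Complex.conj_ofReal]
    have h5 : ∀ a b d : B, ((c⁻¹ : ℝ) : ℂ) • ((c : ℂ) • b - d +
        ((c : ℂ) • ((c : ℂ) • a - b) - ((c : ℂ) • b - d))) =
        (((c⁻¹ : ℝ) : ℂ) * c) • ((c : ℂ) • a - b) := fun a b d => by module
    rw [RingHom.id_apply, h5, hc', one_smul]
  have h6 := (((h1 x).smul (r := 2) (by norm_num)).add (h2.smul (r := 2) (by norm_num))).add
    (isPositive_gram hB hη hη' fun i => leftCreate B k (x i) - leftAnnih η k (x i))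
  convert h6 using 1
  ext i j
  simp only [gram, Matrix.sub_apply, Matrix.smul_apply, Matrix.add_apply, Matrix.of_apply,
    map_sub, map_add, LinearMap.sub_apply, LinearMap.add_apply, lsemi_apply]
  push_cast
  module

end InnerPositivity

/-! ### The Wick map -/

section Wick

variable {B : Type u} [Ring B] [Algebra ℂ B] {K : Type} (η : K → K → B →ₗ[ℂ] B)

/-- The Wick map `b_0 Z_{k_1} b_1 ⋯ Z_{k_m} b_m ↦ L_{b_0} S_{k_1} L_{b_1} ⋯ S_{k_m} L_{b_m} 1`. It
intertwines the creation operators `l_k`, `r_k` with `S_k`, `D_k`. -/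
def wick : Fock B K →ₗ[ℂ] Fock B K :=
  fockRec (vac B K) fun k =>
    LinearMap.mulRight ℂ (lsemi η k) ∘ₗ (fockLeft B K).toLinearMap

@[simp]
theorem wick_vac (b : B) : wick η (vac B K b) = vac B K b := fockRec_vac _ _ b

@[simp]
theorem wick_cons (b : B) (k : K) (w : Fock B K) :
    wick η (fockLeft B K b (leftCreate B k w)) = fockLeft B K b (lsemi η k (wick η w)) :=
  fockRec_cons _ _ b k w

@[simp]
theorem wick_create (k : K) (w : Fock B K) :
    wick η (leftCreate B k w) = lsemi η k (wick η w) := by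
  have h := wick_cons η 1 k w
  rwa [map_one, Module.End.one_apply, Module.End.one_apply] at h

theorem wick_left (b : B) (w : Fock B K) :
    wick η (fockLeft B K b w) = fockLeft B K b (wick η w) := by
  induction w using fock_induction with
  | zero => simp
  | add x y hx hy => simp [hx, hy]
  | vac c => simp
  | cons c k w h => rw [fockLeft_mul_apply, wick_cons, wick_cons, fockLeft_mul_apply]

theorem wick_rmul (b : B) (w : Fock B K) : wick η (rmul B K b w) = rmul B K b (wick η w) := by
  induction w using fock_induction with
  | zero => simp
  | add x y hx hy => simp [hx, hy]
  | vac c => simp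
  | cons c k w h => rw [rmul_cons, wick_cons, wick_cons, h, ← fockLeft_rmul, rmul_lsemi]

theorem lsemi_vac (k : K) (b : B) : lsemi η k (vac B K b) = leftCreate B k (vac B K b) := by
  simp [lsemi_apply]

theorem rsemi_vac (k : K) (b : B) : rsemi η k (vac B K b) = rightCreate B k (vac B K b) := by
  simp [rsemi_apply]

/-- On words this is the commutation of left and right operators, and on `B` it is
`S_k 1 = D_k 1`. -/
theorem wick_rightCreate (k : K) (w : Fock B K) :
    wick η (rightCreate B k w) = rsemi η k (wick η w) := by
  induction w using fock_induction with
  | zero => simp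
  | add x y hx hy => simp [hx, hy]
  | vac c => simp [lsemi_vac, rsemi_vac]
  | cons c j w h =>
    rw [rightCreate_cons, wick_cons, wick_cons, h, lsemi_rsemi, fockLeft_rsemi]

/-- The inverse of the Wick map together with its compositions with the operators `l_k^*`. The
recursion is `unwick (b Z_k w) = L_b (l_k (unwick w) - unwick (l_k^* w))`. -/
def unwickAux : Fock B K →ₗ[ℂ] Fock B K × (K → Fock B K) :=
  fockRec (LinearMap.inl ℂ _ _ ∘ₗ vac B K) fun k =>
    LinearMap.mk₂ ℂ
      (fun b x => (fockLeft B K b (leftCreate B k x.1 - x.2 k),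
        fun j => fockLeft B K (η j k b) x.1))
      (fun b c x => Prod.ext (by simp) (funext fun j => by simp))
      (fun r b x => Prod.ext (by simp) (funext fun j => by simp))
      (fun b x y => Prod.ext (by simp; abel) (funext fun j => by simp))
      (fun r b x => Prod.ext (by simp [smul_sub]) (funext fun j => by simp))

/-- The inverse of the Wick map. -/
def unwick : Fock B K →ₗ[ℂ] Fock B K := LinearMap.fst ℂ _ _ ∘ₗ unwickAux η

@[simp]
theorem unwick_vac (b : B) : unwick η (vac B K b) = vac B K b := by
  simp [unwick, unwickAux]

theorem unwickAux_cons (b : B) (k : K) (w : Fock B K) :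
    unwickAux η (fockLeft B K b (leftCreate B k w)) =
      (fockLeft B K b (leftCreate B k (unwick η w) - (unwickAux η w).2 k),
        fun j => fockLeft B K (η j k b) (unwick η w)) :=
  fockRec_cons _ _ b k w

theorem unwick_left (b : B) (w : Fock B K) :
    unwick η (fockLeft B K b w) = fockLeft B K b (unwick η w) := by
  induction w using fock_induction with
  | zero => simp
  | add x y hx hy => simp [hx, hy]
  | vac c => simp
  | cons c k w h =>
    rw [fockLeft_mul_apply, unwick, LinearMap.comp_apply, LinearMap.comp_apply, unwickAux_cons,
      unwickAux_cons, LinearMap.fst_apply, LinearMap.fst_apply, fockLeft_mul_apply]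

theorem unwickAux_snd (k : K) (w : Fock B K) :
    (unwickAux η w).2 k = unwick η (leftAnnih η k w) := by
  induction w using fock_induction with
  | zero => simp
  | add x y hx hy => simp [hx, hy]
  | vac c => simp [unwickAux]
  | cons c j w h => rw [unwickAux_cons, leftAnnih_cons, unwick_left]

@[simp]
theorem unwick_cons (b : B) (k : K) (w : Fock B K) :
    unwick η (fockLeft B K b (leftCreate B k w)) =
      fockLeft B K b (leftCreate B k (unwick η w) - unwick η (leftAnnih η k w)) := by
  rw [← unwickAux_snd]
  exact congrArg Prod.fst (unwickAux_cons η b k w)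

theorem unwick_lsemi (k : K) (w : Fock B K) :
    unwick η (lsemi η k w) = leftCreate B k (unwick η w) := by
  have h := unwick_cons η 1 k w
  rw [map_one, Module.End.one_apply, Module.End.one_apply] at h
  rw [lsemi_apply, map_add, h, sub_add_cancel]

@[simp]
theorem unwick_wick (w : Fock B K) : unwick η (wick η w) = w := by
  induction w using fock_induction with
  | zero => simp
  | add x y hx hy => simp [hx, hy]
  | vac c => simp
  | cons c k w h => rw [wick_cons, unwick_left, unwick_lsemi, h]

@[simp]
theorem wick_unwick (w : Fock B K) : wick η (unwick η w) = w := by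
  suffices h : wick η (unwick η w) = w ∧
      ∀ k, wick η (unwick η (leftAnnih η k w)) = leftAnnih η k w from h.1
  induction w using fock_induction with
  | zero => simp
  | add x y hx hy => simp [hx.1, hy.1, hx.2, hy.2]
  | vac c => simp
  | cons c k w h =>
    refine ⟨?_, fun j => ?_⟩
    · rw [unwick_cons, wick_left, map_sub, wick_create, h.1, h.2, lsemi_apply, add_sub_cancel_right]
    · rw [leftAnnih_cons, unwick_left, wick_left, h.1]

theorem unwick_rmul (b : B) (w : Fock B K) :
    unwick η (rmul B K b w) = rmul B K b (unwick η w) := by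
  rw [← wick_unwick η w, ← wick_rmul, unwick_wick, unwick_wick]

theorem unwick_rsemi (k : K) (w : Fock B K) :
    unwick η (rsemi η k w) = rightCreate B k (unwick η w) := by
  rw [← wick_unwick η w, ← wick_rightCreate, unwick_wick, unwick_wick]

variable {η}

/-- The vacuum is cyclic for the left operators, hence separating for their commutant. -/
theorem eq_zero_of_commute_left {T : Module.End ℂ (Fock B K)}
    (hL : ∀ b w, T (fockLeft B K b w) = fockLeft B K b (T w))
    (hS : ∀ k w, T (lsemi η k w) = lsemi η k (T w)) (h1 : T (vac B K 1) = 0) : T = 0 := by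
  have h : ∀ w, T (wick η w) = 0 := by
    intro w
    induction w using fock_induction with
    | zero => simp
    | add x y hx hy => simp [hx, hy]
    | vac b =>
      have h := hL b (vac B K 1)
      rw [h1, map_zero, fockLeft_vac, mul_one] at h
      rw [wick_vac, h]
    | cons b k w h => rw [wick_cons, hL, hS, h, map_zero, map_zero]
  refine LinearMap.ext fun w => ?_
  rw [← wick_unwick η w, h, LinearMap.zero_apply]

/-- The mirror image of `eq_zero_of_commute_left` under the reversal of words. -/
theorem eq_zero_of_commute_right [StarRing B] [StarModule ℂ B] (hη : IsHermitianCovariance η)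
    {T : Module.End ℂ (Fock B K)}
    (hR : ∀ b w, T (rmul B K b w) = rmul B K b (T w))
    (hD : ∀ k w, T (rsemi η k w) = rsemi η k (T w)) (h1 : T (vac B K 1) = 0) : T = 0 := by
  have h : ∀ w, T (fockStar B K (wick η w)) = 0 := by
    intro w
    induction w using fock_induction with
    | zero => simp
    | add x y hx hy => simp [hx, hy]
    | vac b =>
      have h := hR (star b) (vac B K 1)
      rw [h1, map_zero, rmul_vac, one_mul] at h
      rw [wick_vac, fockStar_vac, h]
    | cons b k w h =>
      rw [wick_cons, fockStar_left, fockStar_lsemi hη, hR, hD, h, map_zero, map_zero]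
  refine LinearMap.ext fun w => ?_
  rw [← fockStar_fockStar w, ← wick_unwick η (fockStar B K w), h, LinearMap.zero_apply]

end Wick

/-! ### Restriction to a set of letters and splitting of words -/

section Splitting

variable {B : Type u} [Ring B] [Algebra ℂ B] {K : Type}

/-- The projection of the Fock space onto the span of the words with all letters in `s`. -/
def restrict (B : Type u) [Ring B] [Algebra ℂ B] {K : Type} (s : K → Bool) :
    Fock B K →ₗ[ℂ] Fock B K :=
  fockRec (vac B K) fun k =>
    if s k then LinearMap.mulRight ℂ (leftCreate B k) ∘ₗ (fockLeft B K).toLinearMap else 0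

variable (s : K → Bool)

@[simp]
theorem restrict_vac (b : B) : restrict B s (vac B K b) = vac B K b := fockRec_vac _ _ b

@[simp]
theorem restrict_cons (b : B) (k : K) (w : Fock B K) :
    restrict B s (fockLeft B K b (leftCreate B k w)) =
      if s k then fockLeft B K b (leftCreate B k (restrict B s w)) else 0 := by
  rw [restrict, fockRec_cons]
  split_ifs <;> rfl

@[simp]
theorem restrict_left (b : B) (w : Fock B K) :
    restrict B s (fockLeft B K b w) = fockLeft B K b (restrict B s w) := by
  induction w using fock_induction with
  | zero => simp
  | add x y hx hy => simp [hx, hy]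
  | vac c => simp
  | cons c k w h =>
    rw [fockLeft_mul_apply, restrict_cons, restrict_cons]
    split_ifs
    · rw [fockLeft_mul_apply]
    · rw [map_zero]

@[simp]
theorem restrict_create (k : K) (w : Fock B K) :
    restrict B s (leftCreate B k w) = if s k then leftCreate B k (restrict B s w) else 0 := by
  have h := restrict_cons s 1 k w
  rwa [map_one, Module.End.one_apply, Module.End.one_apply] at h

@[simp]
theorem restrict_rmul (b : B) (w : Fock B K) :
    restrict B s (rmul B K b w) = rmul B K b (restrict B s w) := by
  induction w using fock_induction with
  | zero => simp
  | add x y hx hy => simp [hx, hy]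
  | vac c => simp
  | cons c k w h =>
    rw [rmul_cons, restrict_cons, restrict_cons, h]
    split_ifs
    · rw [rmul_cons]
    · rw [map_zero]

@[simp]
theorem restrict_rightCreate (k : K) (w : Fock B K) :
    restrict B s (rightCreate B k w) = if s k then rightCreate B k (restrict B s w) else 0 := by
  induction w using fock_induction with
  | zero => simp
  | add x y hx hy =>
    simp only [map_add, hx, hy]
    split_ifs <;> simp
  | vac c =>
    rw [rightCreate_vac, restrict_left, restrict_create, restrict_vac]
    split_ifs <;> simp
  | cons c j w h =>
    rw [rightCreate_cons, restrict_cons, restrict_cons, h]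
    split_ifs <;> simp

open scoped Classical in
/-- The splitting of words at the letter `k₀`: the sum of the tensors `x ⊗ y` over all the ways to
write the word as `x Z_{k₀} y`, where the letters of `x` are in `s` and those of `y` are not.
The second component is the projection onto the words without letters in `s`. -/
def splitAux (B : Type u) [Ring B] [Algebra ℂ B] {K : Type} (s : K → Bool) (k₀ : K) :
    Fock B K →ₗ[ℂ] (Fock B K ⊗[ℂ] Fock B K) × Fock B K :=
  fockRec (LinearMap.inr ℂ _ _ ∘ₗ vac B K) fun k =>
    LinearMap.mk₂ ℂ
      (fun b x => ((if s k then ((fockLeft B K b * leftCreate B k).rTensor _) x.1 else 0) +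
          if k = k₀ then vac B K b ⊗ₜ[ℂ] x.2 else 0,
        if s k then 0 else fockLeft B K b (leftCreate B k x.2)))
      (fun b c x => by
        ext <;> split_ifs <;> simp [add_mul, TensorProduct.add_tmul]; abel)
      (fun r b x => by
        ext <;> split_ifs <;> simp [TensorProduct.smul_tmul'])
      (fun b x y => by
        ext <;> split_ifs <;> simp [TensorProduct.tmul_add]; abel)
      (fun r b x => by
        ext <;> split_ifs <;> simp)

/-- The splitting of words at the letter `k₀` into words in `s` and words without letters
in `s`. -/
def split (B : Type u) [Ring B] [Algebra ℂ B] {K : Type} (s : K → Bool) (k₀ : K) :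
    Fock B K →ₗ[ℂ] Fock B K ⊗[ℂ] Fock B K :=
  LinearMap.fst ℂ _ _ ∘ₗ splitAux B s k₀

variable (k₀ : K)

@[simp]
theorem split_vac (b : B) : split B s k₀ (vac B K b) = 0 := by
  simp [split, splitAux]

theorem splitAux_snd (w : Fock B K) :
    (splitAux B s k₀ w).2 = restrict B (fun k => !s k) w := by
  induction w using fock_induction with
  | zero => simp
  | add x y hx hy => simp [hx, hy]
  | vac c => simp [splitAux]
  | cons c k w h =>
    have h2 : (splitAux B s k₀ (fockLeft B K c (leftCreate B k w))).2 =
        if s k then 0 else fockLeft B K c (leftCreate B k (splitAux B s k₀ w).2) :=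
      congrArg Prod.snd (fockRec_cons _ _ c k w : splitAux B s k₀ _ = _)
    rw [h2, restrict_cons, ← h]
    cases s k <;> rfl

open scoped Classical in
theorem split_cons (b : B) (k : K) (w : Fock B K) :
    split B s k₀ (fockLeft B K b (leftCreate B k w)) =
      (if s k then (fockLeft B K b).rTensor _ ((leftCreate B k).rTensor _ (split B s k₀ w))
        else 0) +
        if k = k₀ then vac B K b ⊗ₜ[ℂ] restrict B (fun k => !s k) w else 0 := by
  have h := congrArg Prod.fst (fockRec_cons _ _ b k w : splitAux B s k₀ _ = _)
  rw [← splitAux_snd s k₀, ← LinearMap.comp_apply ((fockLeft B K b).rTensor _),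
    ← LinearMap.rTensor_comp]
  exact h

theorem split_left (b : B) (w : Fock B K) :
    split B s k₀ (fockLeft B K b w) = (fockLeft B K b).rTensor _ (split B s k₀ w) := by
  classical
  induction w using fock_induction with
  | zero => simp
  | add x y hx hy => simp [hx, hy]
  | vac c => simp
  | cons c k w h =>
    rw [fockLeft_mul_apply, split_cons, split_cons, map_add]
    congr 1
    · split_ifs
      · rw [map_mul, ← LinearMap.comp_apply ((fockLeft B K b).rTensor _), ← LinearMap.rTensor_comp]
        rfl
      · rw [map_zero]
    · split_ifs <;> simp

open scoped Classical in
theorem split_create (k : K) (w : Fock B K) :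
    split B s k₀ (leftCreate B k w) =
      (if s k then (leftCreate B k).rTensor _ (split B s k₀ w) else 0) +
        if k = k₀ then vac B K 1 ⊗ₜ[ℂ] restrict B (fun k => !s k) w else 0 := by
  have h := split_cons s k₀ 1 k w
  rw [map_one, Module.End.one_apply, Module.End.one_eq_id, LinearMap.rTensor_id] at h
  exact h

theorem split_rmul (b : B) (w : Fock B K) :
    split B s k₀ (rmul B K b w) = (rmul B K b).lTensor _ (split B s k₀ w) := by
  classical
  induction w using fock_induction with
  | zero => simp
  | add x y hx hy => simp [hx, hy]
  | vac c => simp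
  | cons c k w h =>
    rw [rmul_cons, split_cons, split_cons, map_add, h, restrict_rmul]
    congr 1
    · split_ifs
      · generalize split B s k₀ w = t
        induction t with
        | zero => simp
        | add x y hx hy => simp only [map_add, hx, hy]
        | tmul x y => simp
      · rw [map_zero]
    · split_ifs <;> simp

open scoped Classical in
theorem split_rightCreate {j : K} (hj : s j = false) (w : Fock B K) :
    split B s k₀ (rightCreate B j w) = (rightCreate B j).lTensor _ (split B s k₀ w) +
      if j = k₀ then restrict B s w ⊗ₜ[ℂ] vac B K 1 else 0 := by
  induction w using fock_induction with
  | zero => simp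
  | add x y hx hy =>
    simp only [map_add, hx, hy, TensorProduct.add_tmul]
    split_ifs
    · abel
    · abel
  | vac c =>
    rw [rightCreate_vac, split_cons]
    simp [hj]
  | cons c k w h =>
    have h2 : ∀ t : Fock B K ⊗[ℂ] Fock B K,
        (fockLeft B K c).rTensor _ ((leftCreate B k).rTensor _ ((rightCreate B j).lTensor _ t)) =
        (rightCreate B j).lTensor _ ((fockLeft B K c).rTensor _
          ((leftCreate B k).rTensor _ t)) := by
      intro t
      induction t with
      | zero => simp
      | add x y hx hy => simp only [map_add, hx, hy]
      | tmul x y => simp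
    rw [rightCreate_cons, split_cons, split_cons, h, restrict_cons, map_add, restrict_rightCreate]
    simp only [hj, Bool.not_false, if_true, map_add, h2]
    by_cases hk : s k = true
    · simp only [hk, if_true]
      split_ifs <;> simp
      abel
    · simp only [hk, Bool.false_eq_true, if_false]
      split_ifs <;> simp

end Splitting

/-! ### The left and right faces and their tensor product -/

section Faces

variable {B : Type u} [Ring B] [Algebra ℂ B] {I J : Type} {η : I ⊕ J → I ⊕ J → B →ₗ[ℂ] B}

theorem fockLeft_mem_leftFace (η : I ⊕ J → I ⊕ J → B →ₗ[ℂ] B) (b : B) :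
    fockLeft B (I ⊕ J) b ∈ leftFace η :=
  Algebra.subset_adjoin (Or.inl ⟨b, rfl⟩)

theorem lsemi_mem_leftFace (η : I ⊕ J → I ⊕ J → B →ₗ[ℂ] B) (i : I) :
    lsemi η (Sum.inl i) ∈ leftFace η :=
  Algebra.subset_adjoin (Or.inr ⟨i, rfl⟩)

theorem rmul_mem_rightFace (η : I ⊕ J → I ⊕ J → B →ₗ[ℂ] B) (b : B) :
    rmul B (I ⊕ J) b ∈ rightFace η :=
  Algebra.subset_adjoin (Or.inl ⟨op b, rfl⟩)

theorem rsemi_mem_rightFace (η : I ⊕ J → I ⊕ J → B →ₗ[ℂ] B) (j : J) :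
    rsemi η (Sum.inr j) ∈ rightFace η :=
  Algebra.subset_adjoin (Or.inr ⟨j, rfl⟩)

@[elab_as_elim]
theorem leftFace_induction
    {P : (T : Module.End ℂ (Fock B (I ⊕ J))) → T ∈ leftFace η → Prop}
    (left : ∀ b, P (fockLeft B (I ⊕ J) b) (fockLeft_mem_leftFace η b))
    (semi : ∀ i, P (lsemi η (Sum.inl i)) (lsemi_mem_leftFace η i))
    (add : ∀ x y hx hy, P x hx → P y hy → P (x + y) (add_mem hx hy))
    (mul : ∀ x y hx hy, P x hx → P y hy → P (x * y) (mul_mem hx hy))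
    {T : Module.End ℂ (Fock B (I ⊕ J))} (hT : T ∈ leftFace η) : P T hT := by
  induction hT using Algebra.adjoin_induction with
  | mem x hx =>
    rcases hx with ⟨b, rfl⟩ | ⟨i, rfl⟩
    · exact left b
    · exact semi i
  | algebraMap r =>
    have h := left (algebraMap ℂ B r)
    simp only [(fockLeft B (I ⊕ J)).commutes r] at h
    exact h
  | add x y hx hy h1 h2 => exact add x y hx hy h1 h2
  | mul x y hx hy h1 h2 => exact mul x y hx hy h1 h2

@[elab_as_elim]
theorem rightFace_induction
    {P : (T : Module.End ℂ (Fock B (I ⊕ J))) → T ∈ rightFace η → Prop}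
    (right : ∀ b, P (rmul B (I ⊕ J) b) (rmul_mem_rightFace η b))
    (semi : ∀ j, P (rsemi η (Sum.inr j)) (rsemi_mem_rightFace η j))
    (add : ∀ x y hx hy, P x hx → P y hy → P (x + y) (add_mem hx hy))
    (mul : ∀ x y hx hy, P x hx → P y hy → P (x * y) (mul_mem hx hy))
    {T : Module.End ℂ (Fock B (I ⊕ J))} (hT : T ∈ rightFace η) : P T hT := by
  induction hT using Algebra.adjoin_induction with
  | mem x hx =>
    rcases hx with ⟨b, rfl⟩ | ⟨i, rfl⟩
    · exact right b.unop
    · exact semi i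
  | algebraMap r =>
    have h := right (algebraMap ℂ B r)
    have h2 : rmul B (I ⊕ J) (algebraMap ℂ B r) = algebraMap ℂ _ r :=
      (fockRight B (I ⊕ J)).commutes r
    simp only [h2] at h
    exact h
  | add x y hx hy h1 h2 => exact add x y hx hy h1 h2
  | mul x y hx hy h1 h2 => exact mul x y hx hy h1 h2

/-- Operators that commute with all `R_b` and all `D_k` (also for `k ∈ I`). -/
def CommutesRight (η : I ⊕ J → I ⊕ J → B →ₗ[ℂ] B) (T : Module.End ℂ (Fock B (I ⊕ J))) : Prop :=
  (∀ b w, T (rmul B (I ⊕ J) b w) = rmul B (I ⊕ J) b (T w)) ∧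
    ∀ k w, T (rsemi η k w) = rsemi η k (T w)

/-- Operators that commute with all `L_b` and all `S_k` (also for `k ∈ J`). -/
def CommutesLeft (η : I ⊕ J → I ⊕ J → B →ₗ[ℂ] B) (T : Module.End ℂ (Fock B (I ⊕ J))) : Prop :=
  (∀ b w, T (fockLeft B (I ⊕ J) b w) = fockLeft B (I ⊕ J) b (T w)) ∧
    ∀ k w, T (lsemi η k w) = lsemi η k (T w)

/-- The left face commutes with right operators for all letters, not only for those in `J`. This is
what makes the vacuum separating for the left face. -/
theorem commutesRight_of_mem {a : Module.End ℂ (Fock B (I ⊕ J))} (ha : a ∈ leftFace η) :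
    CommutesRight η a := by
  induction ha using leftFace_induction with
  | left b => exact ⟨fun c w => fockLeft_rmul b c w, fun k w => fockLeft_rsemi η k b w⟩
  | semi i => exact ⟨fun c w => (rmul_lsemi η _ c w).symm, fun k w => lsemi_rsemi η _ k w⟩
  | add x y _ _ hx hy =>
    exact ⟨fun c w => by simp [hx.1, hy.1], fun k w => by simp [hx.2, hy.2]⟩
  | mul x y _ _ hx hy =>
    exact ⟨fun c w => by simp [hx.1, hy.1], fun k w => by simp [hx.2, hy.2]⟩

theorem commutesLeft_of_mem {c : Module.End ℂ (Fock B (I ⊕ J))} (hc : c ∈ rightFace η) :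
    CommutesLeft η c := by
  induction hc using rightFace_induction with
  | right b =>
    exact ⟨fun c w => (fockLeft_rmul c b w).symm, fun k w => rmul_lsemi η k b w⟩
  | semi i =>
    exact ⟨fun c w => (fockLeft_rsemi η _ c w).symm, fun k w => (lsemi_rsemi η k _ w).symm⟩
  | add x y _ _ hx hy =>
    exact ⟨fun c w => by simp [hx.1, hy.1], fun k w => by simp [hx.2, hy.2]⟩
  | mul x y _ _ hx hy =>
    exact ⟨fun c w => by simp [hx.1, hy.1], fun k w => by simp [hx.2, hy.2]⟩

theorem commute_of_mem {a c : Module.End ℂ (Fock B (I ⊕ J))} (ha : a ∈ leftFace η)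
    (hc : c ∈ rightFace η) : Commute a c := by
  induction ha using leftFace_induction with
  | left b => exact LinearMap.ext fun w => ((commutesLeft_of_mem hc).1 b w).symm
  | semi i => exact LinearMap.ext fun w => ((commutesLeft_of_mem hc).2 _ w).symm
  | add x y _ _ hx hy => exact hx.add_left hy
  | mul x y _ _ hx hy => exact hx.mul_left hy

theorem leftFace_le (η : I ⊕ J → I ⊕ J → B →ₗ[ℂ] B) : leftFace η ≤ biSemiAlgebra η :=
  le_sup_left

theorem rightFace_le (η : I ⊕ J → I ⊕ J → B →ₗ[ℂ] B) : rightFace η ≤ biSemiAlgebra η :=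
  le_sup_right

theorem commute_inclusion (a : leftFace η) (c : rightFace η) :
    Commute (Subalgebra.inclusion (leftFace_le η) a)
      (Subalgebra.inclusion (rightFace_le η) c) := by
  rw [commute_iff_eq]
  apply Subtype.ext
  rw [Subalgebra.coe_mul, Subalgebra.coe_mul, Subalgebra.coe_inclusion, Subalgebra.coe_inclusion]
  exact commute_of_mem a.2 c.2

theorem coe_lift_inclusion {R : Type*} [Ring R] [Algebra ℂ R] {S T U : Subalgebra ℂ R}
    (hS : S ≤ U) (hT : T ≤ U)
    (h : ∀ a c, Commute (Subalgebra.inclusion hS a) (Subalgebra.inclusion hT c)) (a : S) (c : T) :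
    (Algebra.TensorProduct.lift (Subalgebra.inclusion hS) (Subalgebra.inclusion hT) h (a ⊗ₜ c) :
      R) = a * c := by
  rw [Algebra.TensorProduct.lift_tmul, Subalgebra.coe_mul, Subalgebra.coe_inclusion,
    Subalgebra.coe_inclusion]

/-- Multiplication `leftFace ⊗ rightFace → A`. -/
def faceMul (η : I ⊕ J → I ⊕ J → B →ₗ[ℂ] B) :
    leftFace η ⊗[ℂ] rightFace η →ₐ[ℂ] biSemiAlgebra η :=
  Algebra.TensorProduct.lift
    (Subalgebra.inclusion (leftFace_le η)) (Subalgebra.inclusion (rightFace_le η))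
    commute_inclusion

theorem coe_faceMul_tmul (a : leftFace η) (c : rightFace η) :
    (faceMul η (a ⊗ₜ c) : Module.End ℂ (Fock B (I ⊕ J))) =
      (a : Module.End ℂ (Fock B (I ⊕ J))) * (c : Module.End ℂ (Fock B (I ⊕ J))) :=
  coe_lift_inclusion _ _ commute_inclusion a c

theorem faceMul_surjective : Function.Surjective (faceMul η) := by
  have h : biSemiAlgebra η ≤ ((biSemiAlgebra η).val.comp (faceMul η)).range := by
    refine sup_le (fun a ha => ⟨(⟨a, ha⟩ : leftFace η) ⊗ₜ 1, ?_⟩)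
      fun c hc => ⟨1 ⊗ₜ (⟨c, hc⟩ : rightFace η), ?_⟩
    · exact (coe_faceMul_tmul _ _).trans (mul_one a)
    · exact (coe_faceMul_tmul _ _).trans (one_mul c)
  rintro ⟨T, hT⟩
  obtain ⟨t, ht⟩ := h hT
  exact ⟨t, Subtype.ext ht⟩

/-- `L_b` as an element of `A`. -/
def semiL (η : I ⊕ J → I ⊕ J → B →ₗ[ℂ] B) (b : B) : biSemiAlgebra η :=
  ⟨fockLeft B (I ⊕ J) b, fockLeft_mem η b⟩

/-- `R_b` as an element of `A`. -/
def semiR (η : I ⊕ J → I ⊕ J → B →ₗ[ℂ] B) (b : B) : biSemiAlgebra η :=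
  ⟨rmul B (I ⊕ J) b, fockRight_mem η (op b)⟩

theorem biSemiEps_tmul (b c : B) :
    biSemiEps η (b ⊗ₜ op c) = semiL η b * semiR η c :=
  Algebra.TensorProduct.lift_tmul _ _ _ b (op c)

theorem semiL_one : semiL η 1 = 1 :=
  Subtype.ext (map_one (fockLeft B (I ⊕ J)))

theorem semiR_one : semiR η 1 = 1 :=
  Subtype.ext (map_one (fockRight B (I ⊕ J)))

theorem leftB_biSemiEps (b : B) :
    leftB (A := biSemiAlgebra η) (biSemiEps η) b = semiL η b := by
  refine (biSemiEps_tmul b 1).trans ?_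
  rw [semiR_one, mul_one]

theorem rightB_biSemiEps (b : B) :
    rightB (A := biSemiAlgebra η) (biSemiEps η) b = semiR η b := by
  refine (biSemiEps_tmul 1 b).trans ?_
  rw [semiL_one, one_mul]

theorem faceMul_tmul_one (a : leftFace η) :
    faceMul η (a ⊗ₜ 1) = ⟨a, leftFace_le η a.2⟩ :=
  Subtype.ext ((coe_faceMul_tmul a 1).trans (mul_one a.1))

theorem faceMul_one_tmul (c : rightFace η) :
    faceMul η (1 ⊗ₜ c) = ⟨c, rightFace_le η c.2⟩ :=
  Subtype.ext ((coe_faceMul_tmul 1 c).trans (one_mul c.1))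

theorem biSemiExpectation_apply (x : biSemiAlgebra η) :
    biSemiExpectation η x = vacProj B _ (x.1 (vac B _ 1)) := rfl

/-- The Wick-transformed splitting of words at the letter `k₀` into words in `I` and words
in `J`. -/
def wickSplit (η : I ⊕ J → I ⊕ J → B →ₗ[ℂ] B) (k₀ : I ⊕ J) :
    Fock B (I ⊕ J) →ₗ[ℂ] Fock B (I ⊕ J) ⊗[ℂ] Fock B (I ⊕ J) :=
  TensorProduct.map (wick η) (wick η) ∘ₗ split B Sum.isLeft k₀ ∘ₗ unwick η

/-- The vectors on which `wickSplit` intertwines the faces: a word must contain a letter of the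
kind of `k₀`. -/
def IsSplittable (η : I ⊕ J → I ⊕ J → B →ₗ[ℂ] B) (k₀ : I ⊕ J) (w : Fock B (I ⊕ J)) : Prop :=
  restrict B (fun k => k.isLeft != k₀.isLeft) (unwick η w) = 0

theorem wickSplit_leftFace (k₀ : I ⊕ J) {a : Module.End ℂ (Fock B (I ⊕ J))}
    (ha : a ∈ leftFace η) (w : Fock B (I ⊕ J)) (hw : IsSplittable η k₀ w) :
    IsSplittable η k₀ (a w) ∧ wickSplit η k₀ (a w) = a.rTensor _ (wickSplit η k₀ w) := by
  have hmap : ∀ {X Y : Module.End ℂ (Fock B (I ⊕ J))},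
      (∀ v, wick η (X v) = Y (wick η v)) → ∀ t, TensorProduct.map (wick η) (wick η)
        (X.rTensor _ t) = Y.rTensor _ (TensorProduct.map (wick η) (wick η) t) := by
    intro X Y h t
    induction t with
    | zero => simp
    | add x y hx hy => simp only [map_add, hx, hy]
    | tmul x y => simp [h]
  induction ha using leftFace_induction generalizing w with
  | left b =>
    refine ⟨?_, ?_⟩
    · rw [IsSplittable, unwick_left, restrict_left, hw, map_zero]
    · rw [wickSplit, LinearMap.comp_apply, LinearMap.comp_apply, unwick_left, split_left,
        hmap (wick_left η b)]
      rfl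
  | semi i =>
    refine ⟨?_, ?_⟩
    · rw [IsSplittable, unwick_lsemi, restrict_create, hw, map_zero, ite_self]
    · rw [wickSplit, LinearMap.comp_apply, LinearMap.comp_apply, unwick_lsemi, split_create,
        if_pos Sum.isLeft_inl, map_add, hmap (wick_create η _)]
      have h : Sum.inl i = k₀ → vac B (I ⊕ J) 1 ⊗ₜ[ℂ]
          restrict B (fun k : I ⊕ J => !k.isLeft) (unwick η w) = 0 := by
        rintro rfl
        have h2 : (fun k : I ⊕ J => !k.isLeft) =
            fun k => k.isLeft != (Sum.inl i : I ⊕ J).isLeft := by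
          ext k
          cases k <;> rfl
        rw [h2, show restrict B _ (unwick η w) = 0 from hw, TensorProduct.tmul_zero]
      split_ifs with hk
      · rw [h hk, map_zero, add_zero]
        rfl
      · rw [map_zero, add_zero]
        rfl
  | add x y _ _ hx hy =>
    refine ⟨?_, ?_⟩
    · have h1 := (hx w hw).1
      have h2 := (hy w hw).1
      rw [IsSplittable] at *
      rw [LinearMap.add_apply, map_add, map_add, h1, h2, add_zero]
    · rw [LinearMap.add_apply, map_add, (hx w hw).2, (hy w hw).2, LinearMap.rTensor_add,
        LinearMap.add_apply]
  | mul x y _ _ hx hy =>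
    obtain ⟨h1, h2⟩ := hy w hw
    refine ⟨(hx _ h1).1, ?_⟩
    rw [Module.End.mul_apply, (hx _ h1).2, h2, ← LinearMap.comp_apply, ← LinearMap.rTensor_comp]
    rfl

theorem wickSplit_rightFace (k₀ : I ⊕ J) {c : Module.End ℂ (Fock B (I ⊕ J))}
    (hc : c ∈ rightFace η) (w : Fock B (I ⊕ J)) (hw : IsSplittable η k₀ w) :
    IsSplittable η k₀ (c w) ∧ wickSplit η k₀ (c w) = c.lTensor _ (wickSplit η k₀ w) := by
  have hmap : ∀ {X Y : Module.End ℂ (Fock B (I ⊕ J))},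
      (∀ v, wick η (X v) = Y (wick η v)) → ∀ t, TensorProduct.map (wick η) (wick η)
        (X.lTensor _ t) = Y.lTensor _ (TensorProduct.map (wick η) (wick η) t) := by
    intro X Y h t
    induction t with
    | zero => simp
    | add x y hx hy => simp only [map_add, hx, hy]
    | tmul x y => simp [h]
  induction hc using rightFace_induction generalizing w with
  | right b =>
    refine ⟨?_, ?_⟩
    · rw [IsSplittable, unwick_rmul, restrict_rmul, hw, map_zero]
    · rw [wickSplit, LinearMap.comp_apply, LinearMap.comp_apply, unwick_rmul, split_rmul,
        hmap (wick_rmul η b)]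
      rfl
  | semi j =>
    refine ⟨?_, ?_⟩
    · rw [IsSplittable, unwick_rsemi, restrict_rightCreate, hw, map_zero, ite_self]
    · rw [wickSplit, LinearMap.comp_apply, LinearMap.comp_apply, unwick_rsemi,
        split_rightCreate Sum.isLeft k₀ rfl, map_add, hmap (wick_rightCreate η _)]
      have h : Sum.inr j = k₀ → restrict B Sum.isLeft (unwick η w) ⊗ₜ[ℂ]
          vac B (I ⊕ J) 1 = 0 := by
        rintro rfl
        have h2 : (Sum.isLeft : I ⊕ J → Bool) =
            fun k => k.isLeft != (Sum.inr j : I ⊕ J).isLeft := by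
          ext k
          cases k <;> rfl
        rw [h2, show restrict B _ (unwick η w) = 0 from hw, TensorProduct.zero_tmul]
      split_ifs with hk
      · rw [h hk, map_zero, add_zero]
        rfl
      · rw [map_zero, add_zero]
        rfl
  | add x y _ _ hx hy =>
    refine ⟨?_, ?_⟩
    · have h1 := (hx w hw).1
      have h2 := (hy w hw).1
      rw [IsSplittable] at *
      rw [LinearMap.add_apply, map_add, map_add, h1, h2, add_zero]
    · rw [LinearMap.add_apply, map_add, (hx w hw).2, (hy w hw).2, LinearMap.lTensor_add,
        LinearMap.add_apply]
  | mul x y _ _ hx hy =>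
    obtain ⟨h1, h2⟩ := hy w hw
    refine ⟨(hx _ h1).1, ?_⟩
    rw [Module.End.mul_apply, (hx _ h1).2, h2, ← LinearMap.comp_apply, ← LinearMap.lTensor_comp]
    rfl

/-- The vector `1 Z_k 1` is separating for the tensor product of the faces: `wickSplit` takes
`a c (1 Z_k 1)` to `a 1 ⊗ c 1`. -/
theorem wickSplit_mul (k₀ : I ⊕ J) {a c : Module.End ℂ (Fock B (I ⊕ J))} (ha : a ∈ leftFace η)
    (hc : c ∈ rightFace η) :
    wickSplit η k₀ (a (c (leftCreate B k₀ (vac B _ 1)))) =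
      a (vac B _ 1) ⊗ₜ[ℂ] c (vac B _ 1) := by
  have h0 : unwick η (leftCreate B k₀ (vac B (I ⊕ J) 1)) = leftCreate B k₀ (vac B _ 1) := by
    have h := unwick_lsemi η k₀ (vac B (I ⊕ J) 1)
    rwa [lsemi_vac, unwick_vac] at h
  have h1 : IsSplittable η k₀ (leftCreate B k₀ (vac B _ 1)) := by
    rw [IsSplittable, h0]
    simp
  have h2 : wickSplit η k₀ (leftCreate B k₀ (vac B _ 1)) = vac B _ 1 ⊗ₜ[ℂ] vac B _ 1 := by
    rw [wickSplit, LinearMap.comp_apply, LinearMap.comp_apply, h0, split_create]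
    simp
  obtain ⟨h3, h4⟩ := wickSplit_rightFace k₀ hc _ h1
  rw [(wickSplit_leftFace k₀ ha _ h3).2, h4, h2]
  simp

variable [StarRing B] [StarModule ℂ B]

/-- The algebra `A` is the tensor product of its faces. If `1 Z_k 1` is taken for the vector,
`wickSplit` recovers `∑ a 1 ⊗ c 1` from `∑ a c`, and the vacuum is separating for each of the
faces. -/
theorem faceMul_injective [Nonempty (I ⊕ J)] (hη : IsHermitianCovariance η) :
    Function.Injective (faceMul η) := by
  let k₀ : I ⊕ J := Classical.arbitrary _
  let evl : leftFace η →ₗ[ℂ] Fock B (I ⊕ J) :=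
    LinearMap.applyₗ (vac B _ 1) ∘ₗ (leftFace η).val.toLinearMap
  let evr : rightFace η →ₗ[ℂ] Fock B (I ⊕ J) :=
    LinearMap.applyₗ (vac B _ 1) ∘ₗ (rightFace η).val.toLinearMap
  have hl : Function.Injective evl := by
    rw [injective_iff_map_eq_zero]
    intro a ha
    have h := commutesRight_of_mem a.2
    exact Subtype.ext (eq_zero_of_commute_right hη h.1 h.2 ha)
  have hr : Function.Injective evr := by
    rw [injective_iff_map_eq_zero]
    intro a ha
    have h := commutesLeft_of_mem a.2
    exact Subtype.ext (eq_zero_of_commute_left h.1 h.2 ha)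
  have : Module.Free ℂ (leftFace η) := Module.Free.of_divisionRing ℂ (leftFace η)
  have : Module.Free ℂ (rightFace η) := Module.Free.of_divisionRing ℂ (rightFace η)
  have hinj := TensorProduct.map_injective_of_flat_flat evl evr hl hr
  have key : ∀ t, wickSplit η k₀ ((faceMul η t : Module.End ℂ (Fock B (I ⊕ J)))
      (leftCreate B k₀ (vac B _ 1))) = TensorProduct.map evl evr t := by
    intro t
    induction t with
    | zero => simp
    | add x y hx hy => simp only [map_add, Subalgebra.coe_add, LinearMap.add_apply, hx, hy]
    | tmul a c =>
      rw [coe_faceMul_tmul, Module.End.mul_apply, wickSplit_mul k₀ a.2 c.2]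
      rfl
  intro t t' h
  apply hinj
  rw [← key, ← key, h]

end Faces

/-! ### The involution -/

section Involution

variable {B : Type u} [Ring B] [StarRing B] [Algebra ℂ B] [StarModule ℂ B]

/-- An algebra of operators on the Fock space for which the vacuum is separating, which is closed
under the operation `T ↦ T*` given by `T* 1 = J (T 1)`, and which commutes with its conjugate by
`J`, carries this operation as an involution. Here `J` is the reversal `fockStar`, and the
commutation makes the operation antimultiplicative: `(a c)^* 1 = J a J (c^* 1) = c^* J a J 1 =
c^* a^* 1`. -/
theorem exists_starRing_of_separating {K : Type} {S : Subalgebra ℂ (Module.End ℂ (Fock B K))}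
    (hsep : ∀ a ∈ S, a (vac B K 1) = 0 → a = 0)
    (hex : ∀ a ∈ S, ∃ a' ∈ S, a' (vac B K 1) = fockStar B K (a (vac B K 1)))
    (hcomm : ∀ a ∈ S, ∀ a' ∈ S, ∀ w, a' (fockStar B K (a (fockStar B K w))) =
      fockStar B K (a (fockStar B K (a' w)))) :
    ∃ (_ : StarRing S) (_ : StarModule ℂ S), ∀ a : S,
      (star a : S).1 (vac B K 1) = fockStar B K (a.1 (vac B K 1)) := by
  have hex' : ∀ a : S, ∃ a' : S, a'.1 (vac B K 1) = fockStar B K (a.1 (vac B K 1)) := fun a =>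
    let ⟨a', h, h'⟩ := hex a.1 a.2
    ⟨⟨a', h⟩, h'⟩
  choose st hst using hex'
  have hext : ∀ a a' : S, a.1 (vac B K 1) = a'.1 (vac B K 1) → a = a' := by
    intro a a' h
    rw [← sub_eq_zero]
    refine Subtype.ext (hsep _ (a - a').2 ?_)
    rw [Subalgebra.coe_sub, LinearMap.sub_apply, h, sub_self]
  let _ : StarRing S :=
    { star := st
      star_involutive := fun a => hext _ _ (by rw [hst, hst, fockStar_fockStar])
      star_mul := fun a c => hext _ _ (by
        have h := hcomm a.1 a.2 (st c).1 (st c).2 (vac B K 1)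
        rw [fockStar_vac, star_one, hst c, fockStar_fockStar] at h
        rw [hst, Subalgebra.coe_mul, Subalgebra.coe_mul, Module.End.mul_apply,
          Module.End.mul_apply, hst a, h])
      star_add := fun a c => hext _ _ (by
        rw [hst, Subalgebra.coe_add, Subalgebra.coe_add, LinearMap.add_apply, LinearMap.add_apply,
          hst, hst, map_add]) }
  refine ⟨inferInstance, ⟨fun r a => hext _ _ ?_⟩, hst⟩
  have h : (r • a : S).1 (vac B K 1) = r • a.1 (vac B K 1) := rfl
  have h' : (star r • st a : S).1 (vac B K 1) = star r • (st a).1 (vac B K 1) := rfl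
  change (st (r • a)).1 _ = (star r • st a : S).1 _
  rw [h', hst, hst, h, map_smulₛₗ]
  rfl

theorem rsemi_vac_one {K : Type} (η : K → K → B →ₗ[ℂ] B) (k : K) :
    rsemi η k (vac B K 1) = lsemi η k (vac B K 1) := by
  rw [lsemi_vac, rsemi_vac, rightCreate_vac, show fockLeft B K 1 = 1 from map_one _,
    Module.End.one_apply]

variable {I J : Type} {η : I ⊕ J → I ⊕ J → B →ₗ[ℂ] B}

theorem eq_zero_of_mem_leftFace (hη : IsHermitianCovariance η) {a : Module.End ℂ (Fock B (I ⊕ J))}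
    (ha : a ∈ leftFace η) (h : a (vac B _ 1) = 0) : a = 0 :=
  eq_zero_of_commute_right hη (commutesRight_of_mem ha).1 (commutesRight_of_mem ha).2 h

theorem eq_zero_of_mem_rightFace {a : Module.End ℂ (Fock B (I ⊕ J))}
    (ha : a ∈ rightFace η) (h : a (vac B _ 1) = 0) : a = 0 :=
  eq_zero_of_commute_left (commutesLeft_of_mem ha).1 (commutesLeft_of_mem ha).2 h

/-- Reversal of words takes left operators to right operators, hence `J a J` commutes with the left
face. -/
theorem leftFace_conj_comm (hη : IsHermitianCovariance η)
    {a a' : Module.End ℂ (Fock B (I ⊕ J))} (ha : a ∈ leftFace η) (ha' : a' ∈ leftFace η)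
    (w : Fock B (I ⊕ J)) : a' (fockStar B _ (a (fockStar B _ w))) =
      fockStar B _ (a (fockStar B _ (a' w))) := by
  have h := commutesRight_of_mem ha
  induction ha' using leftFace_induction generalizing w with
  | left b => rw [fockStar_left, h.1, ← star_star b, ← fockStar_rmul, star_star]
  | semi i => rw [fockStar_lsemi hη, h.2, fockStar_rsemi hη]
  | add x y _ _ hx hy => simp only [LinearMap.add_apply, map_add, hx, hy]
  | mul x y _ _ hx hy => rw [Module.End.mul_apply, Module.End.mul_apply, hy, hx]

theorem rightFace_conj_comm (hη : IsHermitianCovariance η)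
    {a a' : Module.End ℂ (Fock B (I ⊕ J))} (ha : a ∈ rightFace η) (ha' : a' ∈ rightFace η)
    (w : Fock B (I ⊕ J)) : a' (fockStar B _ (a (fockStar B _ w))) =
      fockStar B _ (a (fockStar B _ (a' w))) := by
  have h := commutesLeft_of_mem ha
  induction ha' using rightFace_induction generalizing w with
  | right b => rw [fockStar_rmul, h.1, ← star_star b, ← fockStar_left, star_star]
  | semi i => rw [fockStar_rsemi hη, h.2, fockStar_lsemi hη]
  | add x y _ _ hx hy => simp only [LinearMap.add_apply, map_add, hx, hy]
  | mul x y _ _ hx hy => rw [Module.End.mul_apply, Module.End.mul_apply, hy, hx]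

/-- The vector `J (a a' 1)` is `(J a J) J (a' 1) = (J a J) a'^* 1 = a'^* (J a J) 1 = a'^* a^* 1`. -/
theorem exists_mem_leftFace_star (hη : IsHermitianCovariance η)
    {a : Module.End ℂ (Fock B (I ⊕ J))} (ha : a ∈ leftFace η) :
    ∃ a' ∈ leftFace η, a' (vac B _ 1) = fockStar B _ (a (vac B _ 1)) := by
  induction ha using leftFace_induction with
  | left b => exact ⟨_, fockLeft_mem_leftFace η (star b), by simp⟩
  | semi i =>
    refine ⟨_, lsemi_mem_leftFace η i, ?_⟩
    rw [fockStar_lsemi hη, fockStar_vac, star_one, rsemi_vac_one]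
  | add x y _ _ hx hy =>
    obtain ⟨x', h1, h2⟩ := hx
    obtain ⟨y', h3, h4⟩ := hy
    exact ⟨_, add_mem h1 h3, by simp [h2, h4]⟩
  | mul x y hx' hy' hx hy =>
    obtain ⟨x', h1, h2⟩ := hx
    obtain ⟨y', h3, h4⟩ := hy
    refine ⟨_, mul_mem h3 h1, ?_⟩
    have h := leftFace_conj_comm hη hx' h3 (vac B _ 1)
    rwa [fockStar_vac, star_one, h4, fockStar_fockStar, ← h2] at h

theorem exists_mem_rightFace_star (hη : IsHermitianCovariance η)
    {a : Module.End ℂ (Fock B (I ⊕ J))} (ha : a ∈ rightFace η) :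
    ∃ a' ∈ rightFace η, a' (vac B _ 1) = fockStar B _ (a (vac B _ 1)) := by
  induction ha using rightFace_induction with
  | right b => exact ⟨_, rmul_mem_rightFace η (star b), by simp⟩
  | semi i =>
    refine ⟨_, rsemi_mem_rightFace η i, ?_⟩
    rw [fockStar_rsemi hη, fockStar_vac, star_one, rsemi_vac_one]
  | add x y _ _ hx hy =>
    obtain ⟨x', h1, h2⟩ := hx
    obtain ⟨y', h3, h4⟩ := hy
    exact ⟨_, add_mem h1 h3, by simp [h2, h4]⟩
  | mul x y hx' hy' hx hy =>
    obtain ⟨x', h1, h2⟩ := hx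
    obtain ⟨y', h3, h4⟩ := hy
    refine ⟨_, mul_mem h3 h1, ?_⟩
    have h := rightFace_conj_comm hη hx' h3 (vac B _ 1)
    rwa [fockStar_vac, star_one, h4, fockStar_fockStar, ← h2] at h

/-- The involution of a tensor product, transported along an algebra isomorphism. -/
theorem exists_starRing_of_tensor {V : Type*} [Ring V] [Algebra ℂ V] {R S A : Subalgebra ℂ V}
    [StarRing R] [StarModule ℂ R] [StarRing S] [StarModule ℂ S] (e : R ⊗[ℂ] S ≃ₐ[ℂ] A) :
    ∃ (_ : StarRing A) (_ : StarModule ℂ A),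
      ∀ a c, star (e (a ⊗ₜ c)) = e (star a ⊗ₜ star c) := by
  let _ : StarRing A :=
    { star := fun x => e (star (e.symm x))
      star_involutive := fun x => by simp
      star_mul := fun x y => by simp
      star_add := fun x y => by simp }
  refine ⟨inferInstance, ⟨fun r x => ?_⟩, fun a c => ?_⟩
  · change e (star (e.symm (r • x))) = star r • e (star (e.symm x))
    rw [map_smul, star_smul, map_smul]
  · change e (star (e.symm (e (a ⊗ₜ c)))) = _
    rw [AlgEquiv.symm_apply_apply, TensorProduct.star_tmul]

/-- The involution of `A`: the faces carry the involutions given by `T^* 1 = J (T 1)`, and `A` is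
their tensor product. -/
theorem exists_starRing_biSemiAlgebra [Nonempty (I ⊕ J)] (hη : IsHermitianCovariance η) :
    ∃ (_ : StarRing (biSemiAlgebra η)) (_ : StarModule ℂ (biSemiAlgebra η)),
      (∀ b, star (semiL η b) = semiL η (star b)) ∧ (∀ b, star (semiR η b) = semiR η (star b)) ∧
      (∀ i, star (semiS η i) = semiS η i) ∧ ∀ j, star (semiD η j) = semiD η j := by
  obtain ⟨_, _, hl⟩ := exists_starRing_of_separating (S := leftFace η)
    (fun a ha => eq_zero_of_mem_leftFace hη ha) (fun a ha => exists_mem_leftFace_star hη ha)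
    (fun a ha a' ha' => leftFace_conj_comm hη ha ha')
  obtain ⟨_, _, hr⟩ := exists_starRing_of_separating (S := rightFace η)
    (fun a ha => eq_zero_of_mem_rightFace ha) (fun a ha => exists_mem_rightFace_star hη ha)
    (fun a ha a' ha' => rightFace_conj_comm hη ha ha')
  have hl' : ∀ a a' : leftFace η, a'.1 (vac B _ 1) = fockStar B _ (a.1 (vac B _ 1)) →
      star a = a' := by
    intro a a' h
    rw [← sub_eq_zero]
    refine Subtype.ext (eq_zero_of_mem_leftFace hη (star a - a').2 ?_)
    rw [Subalgebra.coe_sub, LinearMap.sub_apply, h, hl, sub_self]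
  have hr' : ∀ a a' : rightFace η, a'.1 (vac B _ 1) = fockStar B _ (a.1 (vac B _ 1)) →
      star a = a' := by
    intro a a' h
    rw [← sub_eq_zero]
    refine Subtype.ext (eq_zero_of_mem_rightFace (star a - a').2 ?_)
    rw [Subalgebra.coe_sub, LinearMap.sub_apply, h, hr, sub_self]
  let e := AlgEquiv.ofBijective (faceMul η) ⟨faceMul_injective hη, faceMul_surjective⟩
  obtain ⟨i1, i2, h⟩ := exists_starRing_of_tensor e
  have hL : ∀ a a' : leftFace η, a'.1 (vac B _ 1) = fockStar B _ (a.1 (vac B _ 1)) →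
      star (⟨a, leftFace_le η a.2⟩ : biSemiAlgebra η) = ⟨a', leftFace_le η a'.2⟩ := by
    intro a a' h'
    rw [← faceMul_tmul_one, ← faceMul_tmul_one]
    refine (h a 1).trans ?_
    rw [hl' a a' h', star_one]
    rfl
  have hR : ∀ a a' : rightFace η, a'.1 (vac B _ 1) = fockStar B _ (a.1 (vac B _ 1)) →
      star (⟨a, rightFace_le η a.2⟩ : biSemiAlgebra η) = ⟨a', rightFace_le η a'.2⟩ := by
    intro a a' h'
    rw [← faceMul_one_tmul, ← faceMul_one_tmul]
    refine (h 1 a).trans ?_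
    rw [hr' a a' h', star_one]
    rfl
  refine ⟨i1, i2, fun b => ?_, fun b => ?_, fun i => ?_, fun j => ?_⟩
  · exact hL ⟨_, fockLeft_mem_leftFace η b⟩ ⟨_, fockLeft_mem_leftFace η (star b)⟩ (by simp)
  · exact hR ⟨_, rmul_mem_rightFace η b⟩ ⟨_, rmul_mem_rightFace η (star b)⟩ (by simp)
  · refine hL ⟨_, lsemi_mem_leftFace η i⟩ ⟨_, lsemi_mem_leftFace η i⟩ ?_
    rw [fockStar_lsemi hη, fockStar_vac, star_one, rsemi_vac_one]
  · refine hR ⟨_, rsemi_mem_rightFace η j⟩ ⟨_, rsemi_mem_rightFace η j⟩ ?_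
    rw [fockStar_rsemi hη, fockStar_vac, star_one, rsemi_vac_one]

end Involution

/-! ### Concatenation of words -/

section Concatenation

variable {B : Type u} [Ring B] [Algebra ℂ B] {K : Type} {η : K → K → B →ₗ[ℂ] B}

/-- Concatenation with `y` from the right:
`b_0 Z_{k_1} ⋯ Z_{k_m} b_m ↦ b_0 Z_{k_1} ⋯ Z_{k_m} b_m y`. -/
def concat (y : Fock B K) : Fock B K →ₗ[ℂ] Fock B K :=
  fockRec (LinearMap.applyₗ y ∘ₗ (fockLeft B K).toLinearMap) fun k =>
    LinearMap.mulRight ℂ (leftCreate B k) ∘ₗ (fockLeft B K).toLinearMap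

@[simp]
theorem concat_vac (y : Fock B K) (b : B) : concat y (vac B K b) = fockLeft B K b y :=
  fockRec_vac _ _ b

@[simp]
theorem concat_cons (y : Fock B K) (b : B) (k : K) (w : Fock B K) :
    concat y (fockLeft B K b (leftCreate B k w)) =
      fockLeft B K b (leftCreate B k (concat y w)) :=
  fockRec_cons _ _ b k w

theorem concat_vac_one (y : Fock B K) : concat y (vac B K 1) = y := by
  rw [concat_vac, show fockLeft B K 1 = 1 from map_one _, Module.End.one_apply]

theorem concat_left (y : Fock B K) (b : B) (w : Fock B K) :
    concat y (fockLeft B K b w) = fockLeft B K b (concat y w) := by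
  induction w using fock_induction with
  | zero => simp
  | add x y hx hy => simp [hx, hy]
  | vac c => rw [fockLeft_vac, concat_vac, concat_vac, fockLeft_mul_apply]
  | cons c k w h => rw [fockLeft_mul_apply, concat_cons, concat_cons, fockLeft_mul_apply]

theorem concat_create (y : Fock B K) (k : K) (w : Fock B K) :
    concat y (leftCreate B k w) = leftCreate B k (concat y w) := by
  have h := concat_cons y 1 k w
  rwa [map_one, Module.End.one_apply, Module.End.one_apply] at h

/-- Concatenation with `y` commutes with `S_k` if `l_k^*` annihilates `B y`, for then `l_k^*` never
reaches the letters of `y`. -/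
theorem concat_lsemi {y : Fock B K} {k : K} (hy : ∀ b, leftAnnih η k (fockLeft B K b y) = 0)
    (w : Fock B K) : concat y (lsemi η k w) = lsemi η k (concat y w) := by
  rw [lsemi_apply, lsemi_apply, map_add, concat_create]
  congr 1
  induction w using fock_induction with
  | zero => simp
  | add x y hx hy => simp [hx, hy]
  | vac c => rw [concat_vac, hy, leftAnnih_vac, map_zero]
  | cons c k w h => rw [concat_cons, leftAnnih_cons, leftAnnih_cons, concat_left]

theorem vacProj_concat (x y : Fock B K) :
    vacProj B K (concat y x) = vacProj B K x * vacProj B K y := by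
  induction x using fock_induction with
  | zero => simp
  | add x z hx hy => simp [hx, hy, add_mul]
  | vac c => simp
  | cons c k w h => simp

/-- The operator `l_k^*` commutes with `D_j` if `η_{k,j} = 0`: they only interact on `B`. -/
theorem leftAnnih_rsemi {k j : K} (hkj : η k j = 0) (w : Fock B K) :
    leftAnnih η k (rsemi η j w) = rsemi η j (leftAnnih η k w) := by
  rw [rsemi_apply, rsemi_apply, map_add]
  induction w using fock_induction with
  | zero => simp
  | add x y hx hy =>
    simp only [map_add] at *
    rw [add_add_add_comm, hx, hy, add_add_add_comm]
  | vac c => simp [hkj]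
  | cons c m w h => simp [fockLeft_rightCreate, fockLeft_rightAnnih]

end Concatenation

/-! ### Expectations of products of left and right operators -/

section Expectation

variable {B : Type u} [Ring B] [StarRing B] [Algebra ℂ B] [StarModule ℂ B]
  {I J : Type} {η : I ⊕ J → I ⊕ J → B →ₗ[ℂ] B}

theorem leftAnnih_rightFace (hη0 : ∀ i j, η (Sum.inl i) (Sum.inr j) = 0)
    {c : Module.End ℂ (Fock B (I ⊕ J))} (hc : c ∈ rightFace η) (i : I) (w : Fock B (I ⊕ J)) :
    leftAnnih η (Sum.inl i) (c w) = c (leftAnnih η (Sum.inl i) w) := by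
  induction hc using rightFace_induction generalizing w with
  | right b => exact (rmul_leftAnnih η _ b w).symm
  | semi j => exact leftAnnih_rsemi (hη0 i j) w
  | add x y _ _ hx hy => simp [hx, hy]
  | mul x y _ _ hx hy => simp [hx, hy]

theorem leftFace_concat (hη0 : ∀ i j, η (Sum.inl i) (Sum.inr j) = 0)
    {a c : Module.End ℂ (Fock B (I ⊕ J))} (ha : a ∈ leftFace η) (hc : c ∈ rightFace η)
    (w : Fock B (I ⊕ J)) :
    a (concat (c (vac B _ 1)) w) = concat (c (vac B _ 1)) (a w) := by
  induction ha using leftFace_induction generalizing w with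
  | left b => rw [concat_left]
  | semi i =>
    rw [concat_lsemi]
    intro b
    rw [← (commutesLeft_of_mem hc).1, leftAnnih_rightFace hη0 hc, fockLeft_vac, leftAnnih_vac,
      map_zero]
  | add x y _ _ hx hy => simp [hx, hy]
  | mul x y _ _ hx hy => simp [hx, hy]

/-- The expectation is multiplicative on products of left and right operators. Since the covariance
between `I` and `J` vanishes, `a` acts on `c 1` by acting on the vacuum and concatenating with
`c 1`. -/
theorem biSemiExpectation_mul (hη0 : ∀ i j, η (Sum.inl i) (Sum.inr j) = 0)
    {a c : biSemiAlgebra η} (ha : a.1 ∈ leftFace η) (hc : c.1 ∈ rightFace η) :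
    biSemiExpectation η (a * c) = biSemiExpectation η a * biSemiExpectation η c := by
  rw [biSemiExpectation_apply, biSemiExpectation_apply, biSemiExpectation_apply,
    Subalgebra.coe_mul, Module.End.mul_apply, ← vacProj_concat, ← leftFace_concat hη0 ha hc,
    concat_vac_one]

theorem mul_comm_of_faces {a c : biSemiAlgebra η} (ha : a.1 ∈ leftFace η)
    (hc : c.1 ∈ rightFace η) : c * a = a * c :=
  Subtype.ext (by
    rw [Subalgebra.coe_mul, Subalgebra.coe_mul]
    exact (commute_of_mem ha hc).symm.eq)

theorem biSemiExpectation_semiL_mul (b : B) (x : biSemiAlgebra η) :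
    biSemiExpectation η (semiL η b * x) = b * biSemiExpectation η x := by
  rw [biSemiExpectation_apply, biSemiExpectation_apply, Subalgebra.coe_mul, Module.End.mul_apply]
  exact vacProj_left _ _

theorem biSemiExpectation_semiR_mul (b : B) (x : biSemiAlgebra η) :
    biSemiExpectation η (semiR η b * x) = biSemiExpectation η x * b := by
  rw [biSemiExpectation_apply, biSemiExpectation_apply, Subalgebra.coe_mul, Module.End.mul_apply]
  exact vacProj_rmul _ _

theorem biSemiExpectation_mul_semiL (b : B) (x : biSemiAlgebra η) :
    biSemiExpectation η (x * semiL η b) = biSemiExpectation η (x * semiR η b) := by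
  rw [biSemiExpectation_apply, biSemiExpectation_apply, Subalgebra.coe_mul, Subalgebra.coe_mul,
    Module.End.mul_apply, Module.End.mul_apply]
  change vacProj B _ (x.1 (fockLeft B _ b _)) = vacProj B _ (x.1 (rmul B _ b _))
  rw [fockLeft_vac, rmul_vac, mul_one, one_mul]

theorem semiL_add (b c : B) : semiL η (b + c) = semiL η b + semiL η c :=
  Subtype.ext (map_add (fockLeft B (I ⊕ J)) b c)

theorem semiL_mul (b c : B) : semiL η (b * c) = semiL η b * semiL η c :=
  Subtype.ext (map_mul (fockLeft B (I ⊕ J)) b c)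

theorem semiL_smul_one (r : ℂ) : semiL η (r • 1) = r • (1 : biSemiAlgebra η) :=
  Subtype.ext ((map_smul (fockLeft B (I ⊕ J)) r 1).trans (by rw [map_one]; rfl))

theorem semiR_add (b c : B) : semiR η (b + c) = semiR η b + semiR η c :=
  Subtype.ext (map_add (fockRight B (I ⊕ J)) (op b) (op c))

theorem semiR_mul (b c : B) : semiR η (b * c) = semiR η c * semiR η b :=
  Subtype.ext (map_mul (fockRight B (I ⊕ J)) (op c) (op b))

theorem semiR_smul_one (r : ℂ) : semiR η (r • 1) = r • (1 : biSemiAlgebra η) :=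
  Subtype.ext ((map_smul (fockRight B (I ⊕ J)) r 1).trans (by rw [map_one]; rfl))

theorem semiL_mem (b : B) : (semiL η b).1 ∈ leftFace η := fockLeft_mem_leftFace η b

theorem semiR_mem (b : B) : (semiR η b).1 ∈ rightFace η := rmul_mem_rightFace η b

/-- The involution of `A` satisfies `L_b^* = L_{b^*}`, `R_b^* = R_{b^*}`, `S_i^* = S_i` and
`D_j^* = D_j`. -/
structure IsSemicircularStar (η : I ⊕ J → I ⊕ J → B →ₗ[ℂ] B) [StarRing (biSemiAlgebra η)] :
    Prop where
  semiL : ∀ b, star (semiL η b) = semiL η (star b)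
  semiR : ∀ b, star (semiR η b) = semiR η (star b)
  semiS : ∀ i, star (semiS η i) = semiS η i
  semiD : ∀ j, star (semiD η j) = semiD η j

variable [StarRing (biSemiAlgebra η)]

/-- On the left face the involution is the adjoint for the `B`-valued inner product. -/
theorem IsSemicircularStar.leftFace (hst : IsSemicircularStar η) (hη : IsHermitianCovariance η)
    {T : Module.End ℂ (Fock B (I ⊕ J))} (hT : T ∈ leftFace η) :
    (star (⟨T, leftFace_le η hT⟩ : biSemiAlgebra η)).1 ∈ leftFace η ∧
      ∀ x y, fockInner η (T x) y =
        fockInner η x ((star (⟨T, leftFace_le η hT⟩ : biSemiAlgebra η)).1 y) := by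
  induction hT using leftFace_induction with
  | left b =>
    have h := congrArg Subtype.val (hst.semiL b)
    change (star (⟨fockLeft B _ b, _⟩ : biSemiAlgebra η)).1 = fockLeft B _ (star b) at h
    rw [h]
    exact ⟨fockLeft_mem_leftFace η _, fun x y => fockInner_left η b x y⟩
  | semi i =>
    have h := congrArg Subtype.val (hst.semiS i)
    change (star (⟨lsemi η (Sum.inl i), _⟩ : biSemiAlgebra η)).1 = lsemi η (Sum.inl i) at h
    rw [h]
    exact ⟨lsemi_mem_leftFace η i, fun x y => fockInner_lsemi hη _ x y⟩
  | add S T hS hT h1 h2 =>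
    have h : star (⟨S + T, leftFace_le η (add_mem hS hT)⟩ : biSemiAlgebra η) =
        star ⟨S, leftFace_le η hS⟩ + star ⟨T, leftFace_le η hT⟩ :=
      star_add (⟨S, leftFace_le η hS⟩ : biSemiAlgebra η) ⟨T, leftFace_le η hT⟩
    rw [h, Subalgebra.coe_add]
    refine ⟨add_mem h1.1 h2.1, fun x y => ?_⟩
    rw [LinearMap.add_apply, map_add, LinearMap.add_apply, h1.2, h2.2, LinearMap.add_apply,
      map_add]
  | mul S T hS hT h1 h2 =>
    have h : star (⟨S * T, leftFace_le η (mul_mem hS hT)⟩ : biSemiAlgebra η) =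
        star ⟨T, leftFace_le η hT⟩ * star ⟨S, leftFace_le η hS⟩ :=
      star_mul (⟨S, leftFace_le η hS⟩ : biSemiAlgebra η) ⟨T, leftFace_le η hT⟩
    rw [h, Subalgebra.coe_mul]
    refine ⟨mul_mem h2.1 h1.1, fun x y => ?_⟩
    rw [Module.End.mul_apply, h1.2, h2.2, Module.End.mul_apply]

/-- On the right face the involution is the adjoint for the inner product conjugated by the
reversal of words; with respect to the inner product itself `R_b` has no adjoint in general. -/
theorem IsSemicircularStar.rightFace (hst : IsSemicircularStar η) (hη : IsHermitianCovariance η)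
    {T : Module.End ℂ (Fock B (I ⊕ J))} (hT : T ∈ rightFace η) :
    (star (⟨T, rightFace_le η hT⟩ : biSemiAlgebra η)).1 ∈ rightFace η ∧
      ∀ x y, fockInner η (fockStar B _ (T (fockStar B _ x))) y = fockInner η x (fockStar B _
        ((star (⟨T, rightFace_le η hT⟩ : biSemiAlgebra η)).1 (fockStar B _ y))) := by
  induction hT using rightFace_induction with
  | right b =>
    have h := congrArg Subtype.val (hst.semiR b)
    change (star (⟨rmul B _ b, _⟩ : biSemiAlgebra η)).1 = rmul B _ (star b) at h
    rw [h]
    refine ⟨rmul_mem_rightFace η _, fun x y => ?_⟩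
    rw [fockStar_rmul, fockStar_rmul, fockStar_fockStar, fockStar_fockStar, fockInner_left]
  | semi i =>
    have h := congrArg Subtype.val (hst.semiD i)
    change (star (⟨rsemi η (Sum.inr i), _⟩ : biSemiAlgebra η)).1 = rsemi η (Sum.inr i) at h
    rw [h]
    refine ⟨rsemi_mem_rightFace η i, fun x y => ?_⟩
    rw [fockStar_rsemi hη, fockStar_rsemi hη, fockStar_fockStar, fockStar_fockStar,
      fockInner_lsemi hη]
  | add S T hS hT h1 h2 =>
    have h : star (⟨S + T, rightFace_le η (add_mem hS hT)⟩ : biSemiAlgebra η) =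
        star ⟨S, rightFace_le η hS⟩ + star ⟨T, rightFace_le η hT⟩ :=
      star_add (⟨S, rightFace_le η hS⟩ : biSemiAlgebra η) ⟨T, rightFace_le η hT⟩
    rw [h, Subalgebra.coe_add]
    refine ⟨add_mem h1.1 h2.1, fun x y => ?_⟩
    rw [LinearMap.add_apply, map_add, map_add, LinearMap.add_apply, h1.2, h2.2,
      LinearMap.add_apply, map_add, map_add]
  | mul S T hS hT h1 h2 =>
    have h : star (⟨S * T, rightFace_le η (mul_mem hS hT)⟩ : biSemiAlgebra η) =
        star ⟨T, rightFace_le η hT⟩ * star ⟨S, rightFace_le η hS⟩ :=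
      star_mul (⟨S, rightFace_le η hS⟩ : biSemiAlgebra η) ⟨T, rightFace_le η hT⟩
    rw [h, Subalgebra.coe_mul]
    refine ⟨mul_mem h2.1 h1.1, fun x y => ?_⟩
    have h3 := h1.2 (fockStar B _ (T (fockStar B _ x))) y
    rw [fockStar_fockStar] at h3
    rw [Module.End.mul_apply, h3, h2.2, fockStar_fockStar, Module.End.mul_apply]

theorem IsSemicircularStar.expectation_left (hst : IsSemicircularStar η)
    (hη : IsHermitianCovariance η) {a : biSemiAlgebra η} (ha : a.1 ∈ BiFree.leftFace η)
    (a' : biSemiAlgebra η) :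
    biSemiExpectation η (star a * a') = fockInner η (a.1 (vac B _ 1)) (a'.1 (vac B _ 1)) := by
  rw [(hst.leftFace hη ha).2, fockInner_vac, star_one, one_mul, biSemiExpectation_apply,
    Subalgebra.coe_mul]
  rfl

/-- The order of the arguments on the right is interchanged, because the inner product is
conjugated by the antilinear reversal of words. -/
theorem IsSemicircularStar.expectation_right (hst : IsSemicircularStar η)
    (hη : IsHermitianCovariance η) {c : biSemiAlgebra η} (hc : c.1 ∈ BiFree.rightFace η)
    (c' : biSemiAlgebra η) :
    biSemiExpectation η (star c * c') = fockInner η (fockStar B _ (c'.1 (vac B _ 1)))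
      (fockStar B _ (c.1 (vac B _ 1))) := by
  have h := (hst.rightFace hη hc).2 (vac B _ 1) (fockStar B _ (c'.1 (vac B _ 1)))
  rw [fockStar_fockStar, fockStar_vac, star_one] at h
  rw [← star_fockInner hη, h, fockInner_vac, star_one, one_mul, vacProj_fockStar, star_star,
    biSemiExpectation_apply, Subalgebra.coe_mul]
  rfl

/-- The mixed moments of products `a c` with `a` in the left and `c` in the right face. -/
theorem IsSemicircularStar.expectation_mul (hst : IsSemicircularStar η)
    (hη : IsHermitianCovariance η) (hη0 : ∀ i j, η (Sum.inl i) (Sum.inr j) = 0)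
    {a a' c c' : biSemiAlgebra η} (ha : a.1 ∈ BiFree.leftFace η) (ha' : a'.1 ∈ BiFree.leftFace η)
    (hc : c.1 ∈ BiFree.rightFace η) (hc' : c'.1 ∈ BiFree.rightFace η) :
    biSemiExpectation η (star (a * c) * (a' * c')) =
      biSemiExpectation η (star a * a') * biSemiExpectation η (star c * c') := by
  have h1 := (hst.leftFace hη ha).1
  have h2 := (hst.rightFace hη hc).1
  have h3 : (star a * a').1 ∈ BiFree.leftFace η := by
    rw [Subalgebra.coe_mul]
    exact mul_mem h1 ha'
  have h4 : (star c * c').1 ∈ BiFree.rightFace η := by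
    rw [Subalgebra.coe_mul]
    exact mul_mem h2 hc'
  rw [← biSemiExpectation_mul hη0 h3 h4, star_mul, mul_assoc, ← mul_assoc (star a),
    ← mul_assoc (star c), mul_comm_of_faces h3 h2, mul_assoc]

/-- Every element of `A` is a sum of products of left and right operators. -/
theorem exists_eq_sum_mul (x : biSemiAlgebra η) :
    ∃ (n : ℕ) (a c : Fin n → biSemiAlgebra η), (∀ i, (a i).1 ∈ BiFree.leftFace η) ∧
      (∀ i, (c i).1 ∈ BiFree.rightFace η) ∧ x = ∑ i, a i * c i := by
  obtain ⟨t, rfl⟩ := faceMul_surjective x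
  induction t with
  | zero => exact ⟨0, fun _ => 0, fun _ => 0, by simp, by simp, by simp⟩
  | tmul a c =>
    exact ⟨1, fun _ => ⟨a, leftFace_le η a.2⟩, fun _ => ⟨c, rightFace_le η c.2⟩, fun _ => a.2,
      fun _ => c.2, by
        rw [Fin.sum_univ_one]
        exact Subtype.ext (coe_faceMul_tmul a c)⟩
  | add s t hs ht =>
    obtain ⟨m, a, c, h1, h2, h3⟩ := hs
    obtain ⟨n, a', c', h1', h2', h3'⟩ := ht
    refine ⟨m + n, Fin.append a a', Fin.append c c', fun i => ?_, fun i => ?_, ?_⟩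
    · refine Fin.addCases (fun i => ?_) (fun i => ?_) i
      · rw [Fin.append_left]
        exact h1 i
      · rw [Fin.append_right]
        exact h1' i
    · refine Fin.addCases (fun i => ?_) (fun i => ?_) i
      · rw [Fin.append_left]
        exact h2 i
      · rw [Fin.append_right]
        exact h2' i
    · rw [map_add, h3, h3', Fin.sum_univ_add]
      simp

/-- The expectation of a hermitian square is the trace of a product of two Gram matrices. -/
theorem IsSemicircularStar.expectation_sum (hst : IsSemicircularStar η)
    (hη : IsHermitianCovariance η) (hη0 : ∀ i j, η (Sum.inl i) (Sum.inr j) = 0) {ι : Type}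
    [Fintype ι] {a c : ι → biSemiAlgebra η} (ha : ∀ i, (a i).1 ∈ BiFree.leftFace η)
    (hc : ∀ i, (c i).1 ∈ BiFree.rightFace η) :
    biSemiExpectation η (star (∑ i, a i * c i) * ∑ i, a i * c i) =
      ∑ i, ∑ j, gram η (fun i => (a i).1 (vac B _ 1)) i j *
        gram η (fun i => fockStar B _ ((c i).1 (vac B _ 1))) j i := by
  rw [star_sum, Finset.sum_mul_sum, map_sum]
  refine Finset.sum_congr rfl fun i _ => ?_
  rw [map_sum]
  refine Finset.sum_congr rfl fun j _ => ?_
  rw [hst.expectation_mul hη hη0 (ha i) (ha j) (hc i) (hc j), hst.expectation_left hη (ha i),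
    hst.expectation_right hη (hc i)]
  rfl

end Expectation

/-! ### The state -/

section State

variable {B : Type u} [Ring B] [StarRing B] [Algebra ℂ B] [StarModule ℂ B]
  {I J : Type} {η : I ⊕ J → I ⊕ J → B →ₗ[ℂ] B} [StarRing (biSemiAlgebra η)]
  {τ : B →ₗ[ℂ] ℂ}

/-- Positivity is that of the trace of a product of two positive matrices, and requires the tracial
state. -/
theorem isState_comp_biSemiExpectation [Nonempty (I ⊕ J)] (hB : IsBoundedStarAlgebra B)
    (hst : IsSemicircularStar η) (hη : IsHermitianCovariance η) (hη' : IsPositiveCovariance η)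
    (hη0 : ∀ i j, η (Sum.inl i) (Sum.inr j) = 0) (hτ : IsState τ) (hτ' : IsTracial τ) :
    IsState (C := biSemiAlgebra η) (τ ∘ₗ biSemiExpectation η) := by
  refine ⟨?_, fun x => ?_⟩
  · rw [LinearMap.comp_apply, biSemiExpectation_apply]
    change τ (vacProj B _ (vac B _ 1)) = 1
    rw [vacProj_vac, hτ.map_one]
  · obtain ⟨n, a, c, ha, hc, rfl⟩ := exists_eq_sum_mul x
    rw [LinearMap.comp_apply, hst.expectation_sum hη hη0 ha hc]
    exact hτ.sum_mul_nonneg hτ' (isPositive_gram hB hη hη' _) (isPositive_gram hB hη hη' _)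

/-- The elements `a` that act boundedly on the GNS space of `τ ∘ E`. -/
def IsGNSBounded (η : I ⊕ J → I ⊕ J → B →ₗ[ℂ] B) [StarRing (biSemiAlgebra η)] (τ : B →ₗ[ℂ] ℂ)
    (a : biSemiAlgebra η) : Prop :=
  ∃ c : ℝ, ∀ x : biSemiAlgebra η, (τ (biSemiExpectation η (star (a * x) * (a * x)))).re ≤
    c * (τ (biSemiExpectation η (star x * x))).re

/-- The parallelogram inequality. -/
theorem IsState.re_add_le {C : Type*} [Ring C] [StarRing C] [Algebra ℂ C] {φ : C →ₗ[ℂ] ℂ}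
    (hφ : IsState φ) (x y : C) : (φ (star (x + y) * (x + y))).re ≤
      2 * (φ (star x * x)).re + 2 * (φ (star y * y)).re := by
  have h := (Complex.nonneg_iff.1 (hφ.nonneg (x - y))).1
  simp only [star_add, star_sub, mul_add, mul_sub, add_mul, sub_mul, map_add, map_sub,
    Complex.add_re, Complex.sub_re] at *
  linarith

theorem IsGNSBounded.add (hs : IsState (C := biSemiAlgebra η) (τ ∘ₗ biSemiExpectation η))
    {a a' : biSemiAlgebra η} (h : IsGNSBounded η τ a) (h' : IsGNSBounded η τ a') :
    IsGNSBounded η τ (a + a') := by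
  obtain ⟨c, hc⟩ := h
  obtain ⟨c', hc'⟩ := h'
  refine ⟨2 * c + 2 * c', fun x => ?_⟩
  have h0 := hs.re_add_le (a * x) (a' * x)
  simp only [LinearMap.comp_apply] at h0
  have h1 := hc x
  have h2 := hc' x
  rw [add_mul a a' x]
  linarith

theorem IsGNSBounded.mul (hs : IsState (C := biSemiAlgebra η) (τ ∘ₗ biSemiExpectation η))
    {a a' : biSemiAlgebra η} (h : IsGNSBounded η τ a) (h' : IsGNSBounded η τ a') :
    IsGNSBounded η τ (a * a') := by
  obtain ⟨c, hc⟩ := h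
  obtain ⟨c', hc'⟩ := h'
  refine ⟨max c 0 * c', fun x => ?_⟩
  have h0 := (Complex.nonneg_iff.1 (hs.nonneg (a' * x))).1
  rw [LinearMap.comp_apply] at h0
  have h1 := hc (a' * x)
  have h2 := hc' x
  rw [mul_assoc a a' x]
  calc _ ≤ _ := h1
    _ ≤ max c 0 * _ := mul_le_mul_of_nonneg_right (le_max_left c 0) h0
    _ ≤ max c 0 * _ := mul_le_mul_of_nonneg_left h2 (le_max_right c 0)
    _ = _ := by rw [mul_assoc]

theorem isGNSBounded_semiL (hB : IsBoundedStarAlgebra B)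
    (hst : IsSemicircularStar η)
    (hs : IsState (C := biSemiAlgebra η) (τ ∘ₗ biSemiExpectation η)) (b : B) :
    IsGNSBounded η τ (semiL η b) := by
  obtain ⟨c, -, hc⟩ := (hB.isBddAbove b).exists_mem_sqCone
  refine ⟨c, fun x => ?_⟩
  have h : ∀ u ∈ sqCone B, 0 ≤ τ (biSemiExpectation η (star x * (semiL η u * x))) := by
    intro u hu
    induction hu using AddSubmonoid.closure_induction with
    | mem y hy =>
      obtain ⟨y, rfl⟩ := hy
      have h := hs.nonneg (semiL η y * x)
      rwa [LinearMap.comp_apply, star_mul, hst.semiL, mul_assoc, ← mul_assoc (semiL η _),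
        ← semiL_mul] at h
    | zero =>
      have h0 : semiL η (0 : B) = 0 := Subtype.ext (map_zero (fockLeft B (I ⊕ J)))
      rw [h0, zero_mul, mul_zero, map_zero, map_zero]
    | add y z _ _ hy hz =>
      rw [semiL_add, add_mul, mul_add, map_add, map_add]
      exact add_nonneg hy hz
  have h1 := (Complex.nonneg_iff.1 (h _ hc)).1
  have h2 : (c : ℂ) • (1 : B) = (c : ℂ) • (1 : B) - star b * b + star b * b := by abel
  have h3 : star x * (semiL η ((c : ℂ) • (1 : B)) * x) = (c : ℂ) • (star x * x) := by
    rw [semiL_smul_one, smul_mul_assoc, one_mul, mul_smul_comm]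
  rw [h2, semiL_add, add_mul, mul_add] at h3
  have h4 := congrArg (fun t => (τ (biSemiExpectation η t)).re) h3
  simp only [map_add, map_smul, Complex.add_re, smul_eq_mul, Complex.re_ofReal_mul] at h4
  rw [star_mul, hst.semiL, mul_assoc, ← mul_assoc (semiL η _), ← semiL_mul]
  linarith

theorem isGNSBounded_semiR (hB : IsBoundedStarAlgebra B)
    (hst : IsSemicircularStar η)
    (hs : IsState (C := biSemiAlgebra η) (τ ∘ₗ biSemiExpectation η)) (b : B) :
    IsGNSBounded η τ (semiR η b) := by
  obtain ⟨c, -, hc⟩ := (hB.isBddAbove (star b)).exists_mem_sqCone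
  rw [star_star] at hc
  refine ⟨c, fun x => ?_⟩
  have h : ∀ u ∈ sqCone B, 0 ≤ τ (biSemiExpectation η (star x * (semiR η u * x))) := by
    intro u hu
    induction hu using AddSubmonoid.closure_induction with
    | mem y hy =>
      obtain ⟨y, rfl⟩ := hy
      have h := hs.nonneg (semiR η (star y) * x)
      rwa [LinearMap.comp_apply, star_mul, hst.semiR, star_star, mul_assoc,
        ← mul_assoc (semiR η _), ← semiR_mul] at h
    | zero =>
      have h0 : semiR η (0 : B) = 0 := Subtype.ext (map_zero (fockRight B (I ⊕ J)))
      rw [h0, zero_mul, mul_zero, map_zero, map_zero]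
    | add y z _ _ hy hz =>
      rw [semiR_add, add_mul, mul_add, map_add, map_add]
      exact add_nonneg hy hz
  have h1 := (Complex.nonneg_iff.1 (h _ hc)).1
  have h2 : (c : ℂ) • (1 : B) = (c : ℂ) • (1 : B) - b * star b + b * star b := by abel
  have h3 : star x * (semiR η ((c : ℂ) • (1 : B)) * x) = (c : ℂ) • (star x * x) := by
    rw [semiR_smul_one, smul_mul_assoc, one_mul, mul_smul_comm]
  rw [h2, semiR_add, add_mul, mul_add] at h3
  have h4 := congrArg (fun t => (τ (biSemiExpectation η t)).re) h3
  simp only [map_add, map_smul, Complex.add_re, smul_eq_mul, Complex.re_ofReal_mul] at h4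
  rw [star_mul, hst.semiR, mul_assoc, ← mul_assoc (semiR η _), ← semiR_mul]
  linarith

/-- The bound for `S_i` on the Fock space applies to the first Gram matrix of
`IsSemicircularStar.expectation_sum`. -/
theorem isGNSBounded_semiS [Nonempty (I ⊕ J)] (hB : IsBoundedStarAlgebra B)
    (hst : IsSemicircularStar η) (hη : IsHermitianCovariance η) (hη' : IsPositiveCovariance η)
    (hη0 : ∀ i j, η (Sum.inl i) (Sum.inr j) = 0) (hτ : IsState τ) (hτ' : IsTracial τ) (i : I) :
    IsGNSBounded η τ (semiS η i) := by
  obtain ⟨r, hr⟩ := exists_isPositive_smul_gram_sub hB hη hη' (Sum.inl i)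
  refine ⟨r, fun x => ?_⟩
  obtain ⟨n, a, c, ha, hc, rfl⟩ := exists_eq_sum_mul x
  have h1 : semiS η i * ∑ j, a j * c j = ∑ j, (semiS η i * a j) * c j := by
    simp only [Finset.mul_sum, mul_assoc]
  have ha' : ∀ j, (semiS η i * a j).1 ∈ leftFace η := fun j => by
    rw [Subalgebra.coe_mul]
    exact mul_mem (lsemi_mem_leftFace η i) (ha j)
  rw [h1, hst.expectation_sum hη hη0 ha hc, hst.expectation_sum hη hη0 ha' hc]
  have h2 := hτ.sum_mul_nonneg hτ' (hr fun j => (a j).1 (vac B _ 1))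
    (isPositive_gram hB hη hη' fun j => fockStar B _ ((c j).1 (vac B _ 1)))
  simp only [Matrix.sub_apply, Matrix.smul_apply, sub_mul, smul_mul_assoc, Finset.sum_sub_distrib,
    ← Finset.smul_sum, map_sub, map_smul, smul_eq_mul] at h2
  have h3 := (Complex.nonneg_iff.1 h2).1
  rw [Complex.sub_re, Complex.re_ofReal_mul, sub_nonneg] at h3
  exact h3

/-- With `J D_k c 1 = S_k J c 1` the bound for `S_k` on the Fock space applies to the second Gram
matrix. -/
theorem isGNSBounded_semiD [Nonempty (I ⊕ J)] (hB : IsBoundedStarAlgebra B)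
    (hst : IsSemicircularStar η) (hη : IsHermitianCovariance η) (hη' : IsPositiveCovariance η)
    (hη0 : ∀ i j, η (Sum.inl i) (Sum.inr j) = 0) (hτ : IsState τ) (hτ' : IsTracial τ) (k : J) :
    IsGNSBounded η τ (semiD η k) := by
  obtain ⟨r, hr⟩ := exists_isPositive_smul_gram_sub hB hη hη' (Sum.inr k)
  refine ⟨r, fun x => ?_⟩
  obtain ⟨n, a, c, ha, hc, rfl⟩ := exists_eq_sum_mul x
  have hD : (semiD η k).1 ∈ rightFace η := rsemi_mem_rightFace η k
  have h1 : semiD η k * ∑ j, a j * c j = ∑ j, a j * (semiD η k * c j) := by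
    rw [Finset.mul_sum]
    refine Finset.sum_congr rfl fun j _ => ?_
    rw [← mul_assoc, mul_comm_of_faces (ha j) hD, mul_assoc]
  have hc' : ∀ j, (semiD η k * c j).1 ∈ rightFace η := fun j => by
    rw [Subalgebra.coe_mul]
    exact mul_mem hD (hc j)
  rw [h1, hst.expectation_sum hη hη0 ha hc, hst.expectation_sum hη hη0 ha hc']
  have h2 := hτ.sum_mul_nonneg hτ' (isPositive_gram hB hη hη' fun j => (a j).1 (vac B _ 1))
    (hr fun j => fockStar B _ ((c j).1 (vac B _ 1)))
  simp only [Matrix.sub_apply, Matrix.smul_apply, mul_sub, mul_smul_comm, Finset.sum_sub_distrib,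
    ← Finset.smul_sum, map_sub, map_smul, smul_eq_mul] at h2
  have h3 := (Complex.nonneg_iff.1 h2).1
  rw [Complex.sub_re, Complex.re_ofReal_mul, sub_nonneg] at h3
  have h4 : ∀ j, fockStar B _ ((semiD η k * c j).1 (vac B _ 1)) =
      lsemi η (Sum.inr k) (fockStar B _ ((c j).1 (vac B _ 1))) := fun j => by
    rw [Subalgebra.coe_mul, Module.End.mul_apply]
    exact fockStar_rsemi hη _ _
  simp only [h4]
  exact h3

theorem isGNSBounded [Nonempty (I ⊕ J)] (hB : IsBoundedStarAlgebra B)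
    (hst : IsSemicircularStar η) (hη : IsHermitianCovariance η) (hη' : IsPositiveCovariance η)
    (hη0 : ∀ i j, η (Sum.inl i) (Sum.inr j) = 0) (hτ : IsState τ) (hτ' : IsTracial τ)
    (x : biSemiAlgebra η) : IsGNSBounded η τ x := by
  have hs := isState_comp_biSemiExpectation hB hst hη hη' hη0 hτ hτ'
  have hl : ∀ (T) (hT : T ∈ leftFace η), IsGNSBounded η τ ⟨T, leftFace_le η hT⟩ := by
    intro T hT
    induction hT using leftFace_induction with
    | left b => exact isGNSBounded_semiL hB hst hs b
    | semi i => exact isGNSBounded_semiS hB hst hη hη' hη0 hτ hτ' i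
    | add x y hx hy h1 h2 =>
      exact IsGNSBounded.add (a := ⟨x, leftFace_le η hx⟩) (a' := ⟨y, leftFace_le η hy⟩) hs h1 h2
    | mul x y hx hy h1 h2 =>
      exact IsGNSBounded.mul (a := ⟨x, leftFace_le η hx⟩) (a' := ⟨y, leftFace_le η hy⟩) hs h1 h2
  have hr : ∀ (T) (hT : T ∈ rightFace η), IsGNSBounded η τ ⟨T, rightFace_le η hT⟩ := by
    intro T hT
    induction hT using rightFace_induction with
    | right b => exact isGNSBounded_semiR hB hst hs b
    | semi i => exact isGNSBounded_semiD hB hst hη hη' hη0 hτ hτ' i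
    | add x y hx hy h1 h2 =>
      exact IsGNSBounded.add (a := ⟨x, rightFace_le η hx⟩) (a' := ⟨y, rightFace_le η hy⟩) hs h1 h2
    | mul x y hx hy h1 h2 =>
      exact IsGNSBounded.mul (a := ⟨x, rightFace_le η hx⟩) (a' := ⟨y, rightFace_le η hy⟩) hs h1 h2
  obtain ⟨n, a, c, ha, hc, rfl⟩ := exists_eq_sum_mul x
  have hac : ∀ i, IsGNSBounded η τ (a i * c i) := fun i =>
    IsGNSBounded.mul hs (hl (a i).1 (ha i)) (hr (c i).1 (hc i))
  have h0 : IsGNSBounded η τ 0 := ⟨0, fun x => by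
    rw [zero_mul, star_zero, zero_mul, map_zero, map_zero, zero_mul, Complex.zero_re]⟩
  have hsum : ∀ s : Finset (Fin n), IsGNSBounded η τ (∑ i ∈ s, a i * c i) := by
    intro s
    induction s using Finset.induction_on with
    | empty => rwa [Finset.sum_empty]
    | insert i s hi h =>
      rw [Finset.sum_insert hi]
      exact IsGNSBounded.add hs (hac i) h
  exact hsum _

end State

/-! ### Complete positivity of the expectation -/

section CompletePositivity

/-- Finitely many elements of `R ⊗ S` that commute with `1 ⊗ d` for `d ∈ D` can be written with
common first factors and with second factors that commute with `D`. -/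
theorem exists_expansion_of_commute {V : Type u} [Ring V] [Algebra ℂ V] {R S : Subalgebra ℂ V}
    {κ : Type*} [Fintype κ] (t : κ → R ⊗[ℂ] S) (D : Set S)
    (h : ∀ p, ∀ d ∈ D, t p * (1 ⊗ₜ d) = (1 ⊗ₜ d) * t p) :
    ∃ (ι : Type u) (_ : Fintype ι) (e : ι → R) (c : κ → ι → S),
      (∀ p, t p = ∑ i, e i ⊗ₜ c p i) ∧ ∀ p i, ∀ d ∈ D, c p i * d = d * c p i := by
  classical
  let 𝓑 := Module.Basis.ofVectorSpace ℂ R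
  let f := TensorProduct.equivFinsuppOfBasisLeft (N := S) 𝓑
  have h1 : ∀ (t : R ⊗[ℂ] S) (d : S) i, f (t * (1 ⊗ₜ d)) i = f t i * d := by
    intro t d i
    induction t with
    | zero => simp
    | add x y hx hy => rw [add_mul, map_add, Finsupp.add_apply, hx, hy, map_add,
        Finsupp.add_apply, add_mul]
    | tmul x y =>
      rw [Algebra.TensorProduct.tmul_mul_tmul, mul_one,
        TensorProduct.equivFinsuppOfBasisLeft_apply_tmul_apply,
        TensorProduct.equivFinsuppOfBasisLeft_apply_tmul_apply, smul_mul_assoc]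
  have h2 : ∀ (t : R ⊗[ℂ] S) (d : S) i, f ((1 ⊗ₜ d) * t) i = d * f t i := by
    intro t d i
    induction t with
    | zero => simp
    | add x y hx hy => rw [mul_add, map_add, Finsupp.add_apply, hx, hy, map_add,
        Finsupp.add_apply, mul_add]
    | tmul x y =>
      rw [Algebra.TensorProduct.tmul_mul_tmul, one_mul,
        TensorProduct.equivFinsuppOfBasisLeft_apply_tmul_apply,
        TensorProduct.equivFinsuppOfBasisLeft_apply_tmul_apply, mul_smul_comm]
  let s : Finset _ := Finset.univ.biUnion fun p => (f (t p)).support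
  refine ⟨s, inferInstance, fun i => 𝓑 i, fun p i => f (t p) i, fun p => ?_, fun p i d hd => ?_⟩
  · have h3 : t p = f.symm (f (t p)) := (f.symm_apply_apply _).symm
    rw [TensorProduct.equivFinsuppOfBasisLeft_symm_apply, Finsupp.sum_of_support_subset (s := s) _
      (Finset.subset_biUnion_of_mem (fun p => (f (t p)).support) (Finset.mem_univ p)) _
      (fun i _ => TensorProduct.tmul_zero _ _)] at h3
    rw [h3]
    exact (Finset.sum_coe_sort s fun i => 𝓑 i ⊗ₜ[ℂ] f (t p) i).symm
  · rw [← h1, ← h2, h p d hd]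

variable {B : Type u} [Ring B] [StarRing B] [Algebra ℂ B] [StarModule ℂ B]
  {I J : Type} {η : I ⊕ J → I ⊕ J → B →ₗ[ℂ] B}

/-- Elements of the left algebra need not belong to the left face; their coefficients in the right
face commute with all `R_b`. -/
theorem exists_expansion_of_commute_semiR [Nonempty (I ⊕ J)] (hη : IsHermitianCovariance η)
    {κ : Type*} [Fintype κ] (T : κ → biSemiAlgebra η)
    (hT : ∀ p b, T p * semiR η b = semiR η b * T p) :
    ∃ (ι : Type u) (_ : Fintype ι) (a : ι → biSemiAlgebra η) (c : κ → ι → biSemiAlgebra η),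
      (∀ i, (a i).1 ∈ leftFace η) ∧ (∀ p i, (c p i).1 ∈ rightFace η) ∧
      (∀ p i b, c p i * semiR η b = semiR η b * c p i) ∧ ∀ p, T p = ∑ i, a i * c p i := by
  choose t ht using fun p => faceMul_surjective (T p)
  obtain ⟨ι, hι, e, c, h1, h2⟩ := exists_expansion_of_commute t
    (Set.range fun b => (⟨rmul B _ b, rmul_mem_rightFace η b⟩ : rightFace η)) (by
      rintro p _ ⟨b, rfl⟩
      apply faceMul_injective hη
      have h3 := hT p b
      rw [← ht p] at h3
      rw [map_mul, map_mul, faceMul_one_tmul]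
      exact h3)
  refine ⟨ι, hι, fun i => ⟨e i, leftFace_le η (e i).2⟩, fun p i => ⟨c p i,
    rightFace_le η (c p i).2⟩, fun i => (e i).2, fun p i => (c p i).2, fun p i b => ?_,
    fun p => ?_⟩
  · have h3 : (c p i).1 * rmul B _ b = rmul B _ b * (c p i).1 :=
      congrArg Subtype.val (h2 p i _ ⟨b, rfl⟩)
    exact Subtype.ext h3
  · rw [← ht p, h1 p, map_sum]
    exact Finset.sum_congr rfl fun i _ => Subtype.ext (coe_faceMul_tmul _ _)

theorem exists_expansion_of_commute_semiL [Nonempty (I ⊕ J)] (hη : IsHermitianCovariance η)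
    {κ : Type*} [Fintype κ] (T : κ → biSemiAlgebra η)
    (hT : ∀ p b, T p * semiL η b = semiL η b * T p) :
    ∃ (ι : Type u) (_ : Fintype ι) (a : κ → ι → biSemiAlgebra η) (c : ι → biSemiAlgebra η),
      (∀ p i, (a p i).1 ∈ leftFace η) ∧ (∀ i, (c i).1 ∈ rightFace η) ∧
      (∀ p i b, a p i * semiL η b = semiL η b * a p i) ∧ ∀ p, T p = ∑ i, a p i * c i := by
  choose t ht using fun p => faceMul_surjective (T p)
  let e := Algebra.TensorProduct.comm ℂ (leftFace η) (rightFace η)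
  obtain ⟨ι, hι, c, a, h1, h2⟩ := exists_expansion_of_commute (fun p => e (t p))
    (Set.range fun b => (⟨fockLeft B _ b, fockLeft_mem_leftFace η b⟩ : leftFace η)) (by
      rintro p _ ⟨b, rfl⟩
      have h4 : t p * ((⟨fockLeft B _ b, fockLeft_mem_leftFace η b⟩ : leftFace η) ⊗ₜ 1) =
          ((⟨fockLeft B _ b, fockLeft_mem_leftFace η b⟩ : leftFace η) ⊗ₜ 1) * t p := by
        apply faceMul_injective hη
        have h3 := hT p b
        rw [← ht p] at h3
        rw [map_mul, map_mul, faceMul_tmul_one]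
        exact h3
      have h5 := congrArg e h4
      rw [map_mul, map_mul] at h5
      exact h5)
  refine ⟨ι, hι, fun p i => ⟨a p i, leftFace_le η (a p i).2⟩, fun i => ⟨c i,
    rightFace_le η (c i).2⟩, fun p i => (a p i).2, fun i => (c i).2, fun p i b => ?_,
    fun p => ?_⟩
  · have h3 : (a p i).1 * fockLeft B _ b = fockLeft B _ b * (a p i).1 :=
      congrArg Subtype.val (h2 p i _ ⟨b, rfl⟩)
    exact Subtype.ext h3
  · have h3 : t p = ∑ i, a p i ⊗ₜ c i := by
      apply e.injective
      rw [h1 p, map_sum]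
      rfl
    rw [← ht p, h3, map_sum]
    exact Finset.sum_congr rfl fun i _ => Subtype.ext (coe_faceMul_tmul _ _)

/-- The expectation of such a coefficient is central:
`E(x) b = E(R_b x) = E(x R_b) = E(x L_b) = E(L_b x) = b E(x)`. -/
theorem commute_expectation_of_mem_rightFace {x : biSemiAlgebra η} (hx : x.1 ∈ rightFace η)
    (h : ∀ b, x * semiR η b = semiR η b * x) (b : B) : Commute (biSemiExpectation η x) b := by
  rw [commute_iff_eq, ← biSemiExpectation_semiR_mul, ← biSemiExpectation_semiL_mul, ← h,
    ← biSemiExpectation_mul_semiL, mul_comm_of_faces (semiL_mem b) hx]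

theorem commute_expectation_of_mem_leftFace {x : biSemiAlgebra η} (hx : x.1 ∈ leftFace η)
    (h : ∀ b, x * semiL η b = semiL η b * x) (b : B) : Commute (biSemiExpectation η x) b := by
  rw [commute_iff_eq, ← biSemiExpectation_semiR_mul, ← biSemiExpectation_semiL_mul, ← h,
    biSemiExpectation_mul_semiL, mul_comm_of_faces hx (semiR_mem b)]

variable [StarRing (biSemiAlgebra η)]

theorem star_mul_comm_semiR (hst : IsSemicircularStar η) {x y : biSemiAlgebra η}
    (hx : ∀ b, x * semiR η b = semiR η b * x) (hy : ∀ b, y * semiR η b = semiR η b * y) (b : B) :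
    star x * y * semiR η b = semiR η b * (star x * y) := by
  have h := congrArg star (hx (star b))
  rw [star_mul, star_mul, hst.semiR, star_star] at h
  rw [mul_assoc, hy, ← mul_assoc, ← h, mul_assoc]

theorem star_mul_comm_semiL (hst : IsSemicircularStar η) {x y : biSemiAlgebra η}
    (hx : ∀ b, x * semiL η b = semiL η b * x) (hy : ∀ b, y * semiL η b = semiL η b * y) (b : B) :
    star x * y * semiL η b = semiL η b * (star x * y) := by
  have h := congrArg star (hx (star b))
  rw [star_mul, star_mul, hst.semiL, star_star] at h
  rw [mul_assoc, hy, ← mul_assoc, ← h, mul_assoc]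

/-- Complete positivity on the left algebra. For `T_p = ∑ a_i c_{p,i}` one has
`E(T_p^* T_q) = ∑ E(a_i^* a_j) E(c_{p,i}^* c_{q,j})`. The first factors form a positive matrix. The
second ones form the transpose of a Gram matrix, and positivity of this transpose follows from their
being central. -/
theorem isPositive_expectation_left [Nonempty (I ⊕ J)] (hB : IsBoundedStarAlgebra B)
    (hst : IsSemicircularStar η) (hη : IsHermitianCovariance η) (hη' : IsPositiveCovariance η)
    (hη0 : ∀ i j, η (Sum.inl i) (Sum.inr j) = 0) {n : ℕ} (T : Fin n → biSemiAlgebra η)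
    (hT : ∀ p b, T p * semiR η b = semiR η b * T p) :
    IsPositive (Matrix.of fun p q => biSemiExpectation η (star (T p) * T q)) := by
  classical
  obtain ⟨ι, hι, a, c, ha, hc, hcR, hTs⟩ := exists_expansion_of_commute_semiR hη T hT
  have hcs : ∀ p i q j, (star (c p i) * c q j).1 ∈ rightFace η := fun p i q j => by
    rw [Subalgebra.coe_mul]
    exact mul_mem (hst.rightFace hη (hc p i)).1 (hc q j)
  have hP := isPositive_gram hB hη hη' fun i => (a i).1 (vac B _ 1)
  have hQ := isPositive_gram hB hη hη' fun p : Fin n × ι => fockStar B _ ((c p.1 p.2).1 (vac B _ 1))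
  have hQ' : ∀ s t : Fin n × ι, gram η (fun p : Fin n × ι => fockStar B _ ((c p.1 p.2).1
      (vac B _ 1))) s t = biSemiExpectation η (star (c t.1 t.2) * c s.1 s.2) := fun s t => by
    rw [hst.expectation_right hη (hc _ _)]
    rfl
  have hcen : ∀ s t b, Commute (gram η (fun p : Fin n × ι => fockStar B _ ((c p.1 p.2).1
      (vac B _ 1))) s t) b := fun s t b => by
    rw [hQ']
    exact commute_expectation_of_mem_rightFace (hcs _ _ _ _)
      (star_mul_comm_semiR hst (hcR _ _) (hcR _ _)) b
  have h := hP.sum_mul_of_central hB (hQ.transpose_of_central hB hcen) fun s t => hcen t s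
  convert h using 1
  ext p q
  rw [Matrix.of_apply, Matrix.of_apply, hTs p, hTs q, star_sum, Finset.sum_mul_sum, map_sum]
  refine Finset.sum_congr rfl fun i _ => ?_
  rw [map_sum]
  refine Finset.sum_congr rfl fun j _ => ?_
  rw [hst.expectation_mul hη hη0 (ha i) (ha j) (hc p i) (hc q j), hst.expectation_left hη (ha i),
    Matrix.transpose_apply, hQ']
  rfl

theorem isBoundedStarAlgebra_op (hB : IsBoundedStarAlgebra B) : IsBoundedStarAlgebra Bᵐᵒᵖ := by
  intro b
  obtain ⟨c, hc⟩ := hB (star b.unop)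
  refine ⟨c, fun δ hδ => ?_⟩
  have h : ∀ u ∈ sqCone B, op u ∈ sqCone Bᵐᵒᵖ := by
    intro u hu
    induction hu using AddSubmonoid.closure_induction with
    | mem y hy =>
      obtain ⟨y, rfl⟩ := hy
      have h := star_mul_self_mem_sqCone (op (star y))
      rwa [← MulOpposite.op_star, star_star, ← MulOpposite.op_mul] at h
    | zero => exact zero_mem _
    | add y z _ _ hy hz => exact add_mem hy hz
  have h1 := h _ (hc δ hδ)
  rw [star_star] at h1
  exact h1

/-- Complete positivity on the right algebra, with values in the opposite algebra. The roles of the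
faces are interchanged: here the coefficients in the left face have central expectations. -/
theorem isPositive_expectation_right [Nonempty (I ⊕ J)] (hB : IsBoundedStarAlgebra B)
    (hst : IsSemicircularStar η) (hη : IsHermitianCovariance η) (hη' : IsPositiveCovariance η)
    (hη0 : ∀ i j, η (Sum.inl i) (Sum.inr j) = 0) {n : ℕ} (T : Fin n → biSemiAlgebra η)
    (hT : ∀ p b, T p * semiL η b = semiL η b * T p) :
    IsPositive (Matrix.of fun p q => op (biSemiExpectation η (star (T p) * T q))) := by
  classical
  obtain ⟨ι, hι, a, c, ha, hc, haL, hTs⟩ := exists_expansion_of_commute_semiL hη T hT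
  have has : ∀ p i q j, (star (a p i) * a q j).1 ∈ leftFace η := fun p i q j => by
    rw [Subalgebra.coe_mul]
    exact mul_mem (hst.leftFace hη (ha p i)).1 (ha q j)
  have hQ := isPositive_gram hB hη hη' fun i => fockStar B _ ((c i).1 (vac B _ 1))
  have hP := isPositive_gram hB hη hη' fun p : Fin n × ι => (a p.1 p.2).1 (vac B _ 1)
  have hP' : ∀ s t : Fin n × ι, gram η (fun p : Fin n × ι => (a p.1 p.2).1 (vac B _ 1)) s t =
      biSemiExpectation η (star (a s.1 s.2) * a t.1 t.2) := fun s t => by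
    rw [hst.expectation_left hη (ha _ _)]
    rfl
  have hcen : ∀ s t b, Commute (gram η (fun p : Fin n × ι => (a p.1 p.2).1 (vac B _ 1)) s t) b :=
    fun s t b => by
      rw [hP']
      exact commute_expectation_of_mem_leftFace (has _ _ _ _)
        (star_mul_comm_semiL hst (haL _ _) (haL _ _)) b
  have h := hQ.transpose_map_op.sum_mul_of_central (isBoundedStarAlgebra_op hB)
    (hP.transpose_of_central hB hcen).transpose_map_op
    fun s t b => (hcen s t b.unop).op
  convert h using 1
  ext p q
  rw [Matrix.of_apply, Matrix.of_apply, hTs p, hTs q, star_sum, Finset.sum_mul_sum, map_sum,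
    Finset.op_sum]
  refine Finset.sum_congr rfl fun i _ => ?_
  rw [map_sum, Finset.op_sum]
  refine Finset.sum_congr rfl fun j _ => ?_
  rw [hst.expectation_mul hη hη0 (ha p i) (ha q j) (hc i) (hc j), hst.expectation_right hη (hc i),
    ← hP' (p, i) (q, j), MulOpposite.op_mul]
  rfl

/-- A linear map is completely positive once it is positive on the matrices `[x_p^* x_q]`. -/
theorem isCompletelyPositive_of_star_mul {C D : Type*} [Ring C] [StarRing C] [Algebra ℂ C]
    [Ring D] [StarRing D] [Algebra ℂ D] [StarModule ℂ D] {φ : C →ₗ[ℂ] D}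
    (h1 : φ 1 = 1)
    (h : ∀ (n : ℕ) (x : Fin n → C), IsPositive (Matrix.of fun p q => φ (star (x p) * x q))) :
    IsCompletelyPositive φ := by
  intro n M hM
  have h2 : ∀ X ∈ sqCone (Matrix (Fin n) (Fin n) C), IsPositive (X.map φ) := by
    intro X hX
    induction hX using AddSubmonoid.closure_induction with
    | mem Y hY =>
      obtain ⟨Y, rfl⟩ := hY
      change IsPositive ((star Y * Y).map φ)
      have h3 := isPositive_sum Finset.univ _ fun k _ => h n fun p => Y k p
      convert h3 using 1
      ext p q
      rw [Matrix.sum_apply, Matrix.map_apply, Matrix.mul_apply, map_sum]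
      rfl
    | zero =>
      convert isPositive_zero (C := Matrix (Fin n) (Fin n) D) using 1
      ext p q
      simp
    | add Y Z _ _ hY hZ =>
      convert hY.add hZ using 1
      ext p q
      simp
  refine isPositive_of_forall_add_smul (d := 1) ⟨1, by simpa using isPositive_zero⟩ fun δ hδ => ?_
  convert h2 _ (hM δ hδ) using 1
  ext p q
  rw [Matrix.map_apply, Matrix.add_apply, Matrix.add_apply, map_add, Matrix.smul_apply,
    Matrix.map_apply, Algebra.algebraMap_eq_smul_one, Matrix.smul_apply, map_smul, Matrix.one_apply,
    Matrix.one_apply]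
  congr 2
  split_ifs
  · rw [h1]
  · rw [map_zero]

theorem isAnalyticBBProbabilitySpace_biSemi [StarModule ℂ (biSemiAlgebra η)] [Nonempty (I ⊕ J)]
    (hB : IsBoundedStarAlgebra B)
    (hst : IsSemicircularStar η) (hη : IsHermitianCovariance η) (hη' : IsPositiveCovariance η)
    (hη0 : ∀ i j, η (Sum.inl i) (Sum.inr j) = 0) {τ : B →ₗ[ℂ] ℂ} (hτ : IsState τ)
    (hτ' : IsTracial τ) :
    IsAnalyticBBProbabilitySpace (A := biSemiAlgebra η) (biSemiEps η) (biSemiExpectation η)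
        (τ ∘ₗ biSemiExpectation η) := by
  have h1 : biSemiExpectation η 1 = 1 := vacProj_vac 1
  have hL : ∀ b, biSemiExpectation η (semiL η b) = b := fun b => by
    rw [← mul_one (semiL η b), biSemiExpectation_semiL_mul, h1, mul_one]
  have hR : ∀ b, biSemiExpectation η (semiR η b) = b := fun b => by
    rw [← mul_one (semiR η b), biSemiExpectation_semiR_mul, h1, one_mul]
  refine
    { map_star := fun x => ?_
      left_injective := fun b c h => ?_
      right_injective := fun b c h => ?_
      map_one := h1
      map_mul := fun b₁ b₂ a => ?_
      left_eq_right := fun a b => ?_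
      isState := isState_comp_biSemiExpectation hB hst hη hη' hη0 hτ hτ'
      compatible_left := fun a => ?_
      compatible_right := fun a => ?_
      tracial := fun b₁ b₂ => ?_
      bounded := isGNSBounded hB hst hη hη' hη0 hτ hτ'
      cp_left := isCompletelyPositive_of_star_mul h1 fun n x => ?_
      cp_right := isCompletelyPositive_of_star_mul (congrArg op h1) fun n x => ?_ }
  · induction x with
    | zero => rw [star_zero, map_zero, star_zero]
    | add x y hx hy => rw [star_add, map_add, map_add, star_add, hx, hy]
    | tmul b c =>
      rw [TensorProduct.star_tmul]
      refine (biSemiEps_tmul (star b) (star c.unop)).trans ?_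
      refine Eq.trans ?_ (congrArg star (biSemiEps_tmul b c.unop)).symm
      rw [star_mul, hst.semiL, hst.semiR, mul_comm_of_faces (semiL_mem _) (semiR_mem _)]
  · rw [leftB_biSemiEps, leftB_biSemiEps] at h
    rw [← hL b, h, hL]
  · rw [rightB_biSemiEps, rightB_biSemiEps] at h
    rw [← hR b, h, hR]
  · rw [biSemiEps_tmul, mul_assoc, biSemiExpectation_semiL_mul, biSemiExpectation_semiR_mul,
      mul_assoc]
  · rw [leftB_biSemiEps, rightB_biSemiEps, biSemiExpectation_mul_semiL]
  · rw [leftB_biSemiEps, LinearMap.comp_apply, LinearMap.comp_apply, hL]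
  · rw [rightB_biSemiEps, LinearMap.comp_apply, LinearMap.comp_apply, hR]
  · rw [leftB_biSemiEps, leftB_biSemiEps, LinearMap.comp_apply, LinearMap.comp_apply, hL, hL, hτ']
  · refine isPositive_expectation_left hB hst hη hη' hη0 (fun p => (x p).1) fun p b => ?_
    have h := ((StarSubalgebra.mem_centralizer_iff ℂ).1 (x p).2 _ ⟨b, rfl⟩).1
    rw [rightB_biSemiEps] at h
    exact h.symm
  · refine isPositive_expectation_right hB hst hη hη' hη0 (fun p => (x p).1) fun p b => ?_
    have h := ((StarSubalgebra.mem_centralizer_iff ℂ).1 (x p).2 _ ⟨b, rfl⟩).1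
    rw [leftB_biSemiEps] at h
    exact h.symm

theorem semiS_mem_leftAlgebra [StarModule ℂ (biSemiAlgebra η)] (hst : IsSemicircularStar η)
    (i : I) : semiS η i ∈ leftAlgebra (A := biSemiAlgebra η) (biSemiEps η) := by
  refine (StarSubalgebra.mem_centralizer_iff ℂ).2 ?_
  rintro _ ⟨b, rfl⟩
  rw [rightB_biSemiEps, hst.semiR]
  exact ⟨mul_comm_of_faces (lsemi_mem_leftFace η i) (semiR_mem _),
    mul_comm_of_faces (lsemi_mem_leftFace η i) (semiR_mem _)⟩

theorem semiD_mem_rightAlgebra [StarModule ℂ (biSemiAlgebra η)] (hst : IsSemicircularStar η)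
    (j : J) : semiD η j ∈ rightAlgebra (A := biSemiAlgebra η) (biSemiEps η) := by
  refine (StarSubalgebra.mem_centralizer_iff ℂ).2 ?_
  rintro _ ⟨b, rfl⟩
  rw [leftB_biSemiEps, hst.semiL]
  exact ⟨(mul_comm_of_faces (semiL_mem _) (rsemi_mem_rightFace η j)).symm,
    (mul_comm_of_faces (semiL_mem _) (rsemi_mem_rightFace η j)).symm⟩

end CompletePositivity

/-! ### Moments of products of semicircular operators -/

section WordMoments

variable {B : Type u} [Ring B] [Algebra ℂ B] {K : Type}

/-- The operator `L_b S_k L_{b'}` for `z = (b, k, b')`. -/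
def semiOp (η : K → K → B →ₗ[ℂ] B) (z : B × K × B) : Module.End ℂ (Fock B K) :=
  fockLeft B K z.1 * lsemi η z.2.1 * fockLeft B K z.2.2

/-- The product of the operators `semiOp η z`, for `z` in the list `w`, applied to the
vector `v`. -/
def semiApply (η : K → K → B →ₗ[ℂ] B) (w : List (B × K × B)) (v : Fock B K) : Fock B K :=
  w.foldr (fun z v => semiOp η z v) v

/-- The moment `E(∏ L_b S_k L_{b'})` of a list of triples `(b, k, b')`. -/
def semiMoment (η : K → K → B →ₗ[ℂ] B) (w : List (B × K × B)) : B :=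
  vacProj B K (semiApply η w (vac B K 1))

variable {η : K → K → B →ₗ[ℂ] B}

theorem semiOp_apply (z : B × K × B) (v : Fock B K) :
    semiOp η z v = fockLeft B K z.1 (lsemi η z.2.1 (fockLeft B K z.2.2 v)) := rfl

theorem semiApply_cons (z : B × K × B) (w : List (B × K × B)) (v : Fock B K) :
    semiApply η (z :: w) v = semiOp η z (semiApply η w v) := rfl

theorem semiApply_append (w w' : List (B × K × B)) (v : Fock B K) :
    semiApply η (w ++ w') v = semiApply η w (semiApply η w' v) :=
  List.foldr_append

theorem semiApply_commute {w : List (B × K × B)} {T : Fock B K →ₗ[ℂ] Fock B K}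
    (hL : ∀ b v, T (fockLeft B K b v) = fockLeft B K b (T v))
    (hS : ∀ z ∈ w, ∀ v, T (lsemi η z.2.1 v) = lsemi η z.2.1 (T v)) (v : Fock B K) :
    T (semiApply η w v) = semiApply η w (T v) := by
  induction w with
  | nil => rfl
  | cons z w ih =>
    rw [semiApply_cons, semiApply_cons, semiOp_apply, semiOp_apply, hL, hS z List.mem_cons_self,
      hL, ih fun z hz => hS z (List.mem_cons_of_mem _ hz)]

theorem restrict_lsemi {s : K → Bool} {k : K} (hk : s k = true)
    (h : ∀ j, s j = false → η k j = 0) (v : Fock B K) :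
    restrict B s (lsemi η k v) = lsemi η k (restrict B s v) := by
  rw [lsemi_apply, lsemi_apply, map_add, restrict_create, if_pos hk]
  congr 1
  induction v using fock_induction with
  | zero => simp
  | add x y hx hy => simp [hx, hy]
  | vac c => simp
  | cons c j w _ =>
    rw [leftAnnih_cons, restrict_cons, restrict_left]
    split_ifs with hj
    · rw [leftAnnih_cons]
    · rw [h j (by simpa using hj)]
      simp

theorem leftAnnih_restrict {s : K → Bool} {k : K} (h : ∀ j, s j = true → η k j = 0)
    (v : Fock B K) : leftAnnih η k (restrict B s v) = 0 := by
  induction v using fock_induction with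
  | zero => simp
  | add x y hx hy => simp [hx, hy]
  | vac c => simp
  | cons c j w _ =>
    rw [restrict_cons]
    split_ifs with hj
    · rw [leftAnnih_cons, h j hj]
      simp
    · simp

theorem vacProj_restrict (s : K → Bool) (v : Fock B K) :
    vacProj B K (restrict B s v) = vacProj B K v := by
  induction v using fock_induction with
  | zero => simp
  | add x y hx hy => simp [hx, hy]
  | vac c => simp
  | cons c j w _ =>
    rw [restrict_cons]
    split_ifs <;> simp

/-- Only the vacuum component of `v` contributes to the words of `v y` without letters in `s`. -/
theorem restrict_concat_restrict (s : K → Bool) (y v : Fock B K) :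
    restrict B (fun k => !s k) (concat y (restrict B s v)) =
      fockLeft B K (vacProj B K v) (restrict B (fun k => !s k) y) := by
  induction v using fock_induction with
  | zero => simp
  | add x y hx hy => simp [hx, hy]
  | vac c => simp
  | cons c j w _ =>
    rw [restrict_cons, vacProj_cons]
    split_ifs with hj
    · rw [concat_cons, restrict_cons]
      simp [hj]
    · simp

/-- Freeness: if the covariance vanishes between the letters in `s` and the letters outside of
`s`, then a product `v` of operators with letters in `s` may be replaced by its expectation. -/
theorem semiMoment_append_of_free {s : K → Bool} (hs : ∀ k j, s k ≠ s j → η k j = 0)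
    {w v y : List (B × K × B)} (hw : ∀ z ∈ w, s z.2.1 = false) (hv : ∀ z ∈ v, s z.2.1 = true)
    (hy : ∀ z ∈ y, s z.2.1 = false) :
    semiMoment η (w ++ v ++ y) =
      vacProj B K (semiApply η w (fockLeft B K (semiMoment η v)
        (semiApply η y (vac B K 1)))) := by
  let P := restrict B fun k => !s k
  have hP : ∀ u : List (B × K × B), (∀ z ∈ u, s z.2.1 = false) → ∀ x,
      P (semiApply η u x) = semiApply η u (P x) := fun u hu x =>
    semiApply_commute (restrict_left _) (fun z hz => restrict_lsemi (by rw [hu z hz]; rfl)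
      fun j hj => hs _ _ (by rw [hu z hz]; intro h; rw [← h] at hj; exact absurd hj (by decide))) x
  have hyP : P (semiApply η y (vac B K 1)) = semiApply η y (vac B K 1) := by
    rw [hP y hy, restrict_vac]
  have hvs : restrict B s (semiApply η v (vac B K 1)) = semiApply η v (vac B K 1) := by
    rw [semiApply_commute (restrict_left _) (fun z hz => restrict_lsemi (hv z hz)
      fun j hj => hs _ _ (by rw [hv z hz, hj]; decide)), restrict_vac]
  have hvy : semiApply η v (semiApply η y (vac B K 1)) =
      concat (semiApply η y (vac B K 1)) (semiApply η v (vac B K 1)) := by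
    rw [semiApply_commute (concat_left _) (fun z hz => concat_lsemi fun b => ?_), concat_vac_one]
    rw [← hyP, ← restrict_left]
    exact leftAnnih_restrict (fun j hj => hs _ _ (by
      rw [hv z hz]; intro h; rw [← h] at hj; exact absurd hj (by decide))) _
  rw [semiMoment, semiApply_append, semiApply_append, hvy, ← vacProj_restrict fun k => !s k,
    hP w hw, ← hvs, restrict_concat_restrict, ← vacProj_restrict (fun k => !s k)
      (semiApply η w (fockLeft B K _ _)), hP w hw, restrict_left]
  change vacProj B K (semiApply η w (fockLeft B K _ (P (P _)))) = _
  rw [hyP, hyP]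
  rfl

/-- The words with letters in `s`, relabelled by `g`; the other words are mapped to zero. -/
def relabel (B : Type u) [Ring B] [Algebra ℂ B] {K K' : Type} (s : K' → Prop) (g : K' → K) :
    Fock B K' →ₗ[ℂ] Fock B K :=
  open scoped Classical in
  fockRec (vac B K) fun k =>
    if s k then LinearMap.mulRight ℂ (leftCreate B (g k)) ∘ₗ (fockLeft B K).toLinearMap else 0

section Relabel

variable {K' : Type} (s : K' → Prop) (g : K' → K)

theorem relabel_vac (b : B) : relabel B s g (vac B K' b) = vac B K b := fockRec_vac _ _ b

open scoped Classical in
theorem relabel_cons (b : B) (k : K') (w : Fock B K') :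
    relabel B s g (fockLeft B K' b (leftCreate B k w)) =
      if s k then fockLeft B K b (leftCreate B (g k) (relabel B s g w)) else 0 := by
  rw [relabel, fockRec_cons]
  split_ifs <;> rfl

theorem relabel_left (b : B) (w : Fock B K') :
    relabel B s g (fockLeft B K' b w) = fockLeft B K b (relabel B s g w) := by
  induction w using fock_induction with
  | zero => simp
  | add x y hx hy => simp [hx, hy]
  | vac c => simp [relabel_vac]
  | cons c k w h =>
    rw [fockLeft_mul_apply, relabel_cons, relabel_cons]
    split_ifs
    · rw [fockLeft_mul_apply]
    · rw [map_zero]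

theorem vacProj_relabel (w : Fock B K') :
    vacProj B K (relabel B s g w) = vacProj B K' w := by
  induction w using fock_induction with
  | zero => simp
  | add x y hx hy => simp [hx, hy]
  | vac c => simp [relabel_vac]
  | cons c k w h =>
    rw [relabel_cons]
    split_ifs <;> simp

variable {s g}

theorem relabel_lsemi {η' : K' → K' → B →ₗ[ℂ] B} {k : K'} (hk : s k)
    (h : ∀ j, s j → η' k j = η (g k) (g j)) (h0 : ∀ j, ¬ s j → η' k j = 0) (w : Fock B K') :
    relabel B s g (lsemi η' k w) = lsemi η (g k) (relabel B s g w) := by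
  rw [lsemi_apply, lsemi_apply, map_add]
  congr 1
  · have h1 := relabel_cons s g 1 k w
    rwa [if_pos hk, map_one, map_one, Module.End.one_apply, Module.End.one_apply] at h1
  · induction w using fock_induction with
    | zero => simp
    | add x y hx hy => simp [hx, hy]
    | vac c => simp [relabel_vac]
    | cons c j w _ =>
      rw [leftAnnih_cons, relabel_cons, relabel_left]
      split_ifs with hj
      · rw [leftAnnih_cons, h j hj]
      · rw [h0 j hj]
        simp

/-- Moments do not change if the letters are renamed compatibly with the covariance. -/
theorem semiMoment_relabel {η' : K' → K' → B →ₗ[ℂ] B}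
    (h : ∀ k j, s k → s j → η' k j = η (g k) (g j)) (h0 : ∀ k j, s k → ¬ s j → η' k j = 0)
    {w : List (B × K' × B)} (hw : ∀ z ∈ w, s z.2.1) :
    semiMoment η' w = semiMoment η (w.map fun z => (z.1, g z.2.1, z.2.2)) := by
  rw [semiMoment, semiMoment, ← vacProj_relabel s g]
  congr 1
  induction w with
  | nil => exact relabel_vac s g 1
  | cons z w ih =>
    have hz := hw z List.mem_cons_self
    rw [List.map_cons, semiApply_cons, semiApply_cons, semiOp_apply, semiOp_apply, relabel_left,
      relabel_lsemi hz (fun j => h _ j hz) (fun j => h0 _ j hz), relabel_left,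
      ih fun z hz => hw z (List.mem_cons_of_mem _ hz)]

end Relabel

end WordMoments

/-! ### The bi-free moment functions of the semicircular operators -/

section BiFreeMoments

variable {B : Type u} [Ring B] [Algebra ℂ B] {K : Type}

open scoped Classical in
/-- The covariance for letters that are labelled by indices: letters are independent if their
labels are in different blocks of `π`. -/
def blockCovariance (η : K → K → B →ₗ[ℂ] B) {n : ℕ} (π : Setoid (Fin n)) :
    K × Fin n → K × Fin n → B →ₗ[ℂ] B :=
  fun k k' => if π k.2 k'.2 then η k.1 k'.1 else 0

/-- The triple `(b, k, b')` at the index `x`, with its letter labelled by the index. -/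
def labelled {n : ℕ} (d : Fin n → B × K × B) (x : Fin n) : B × (K × Fin n) × B :=
  ((d x).1, ((d x).2.1, x), (d x).2.2)

/-- The left operator `L_b S_k L_{b'}` or the right operator `R_{b'} D_k R_b`, according to the
side, for the triple `(b, k, b')`. -/
def sideOp (η : K → K → B →ₗ[ℂ] B) : Side → B × K × B → Module.End ℂ (Fock B K)
  | .left, z => semiOp η z
  | .right, z => rmul B K z.2.2 * rsemi η z.2.1 * rmul B K z.1

variable {η : K → K → B →ₗ[ℂ] B}

theorem sideOp_right_vac (z : B × K × B) :
    sideOp η .right z (vac B K 1) = semiOp η z (vac B K 1) := by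
  simp [sideOp, semiOp_apply, rsemi_vac, lsemi_vac]

theorem sideOp_right_semiApply (z : B × K × B) (w : List (B × K × B)) (v : Fock B K) :
    sideOp η .right z (semiApply η w v) = semiApply η w (sideOp η .right z v) := by
  refine semiApply_commute (fun b v => ?_) (fun z' _ v => ?_) v
  · simp only [sideOp, Module.End.mul_apply, fockLeft_rmul, fockLeft_rsemi]
  · simp only [sideOp, Module.End.mul_apply, rmul_lsemi, ← lsemi_rsemi]

variable {n : ℕ} {χ : Fin n → Side} {d : Fin n → B × K × B}

open scoped Classical in
/-- The `χ`-order appears when a product of left and right operators in their natural order is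
applied to the vacuum: the right operators may be replaced by left operators in opposite order. -/
theorem prod_sideOp_vac (l : List (Fin n)) :
    (l.map fun x => sideOp η (χ x) (d x)).prod (vac B K 1) =
      semiApply η (((l.filter fun x => χ x = Side.left) ++
        (l.filter fun x => χ x = Side.right).reverse).map d) (vac B K 1) := by
  induction l with
  | nil => rfl
  | cons x l ih =>
    rw [List.map_cons, List.prod_cons, Module.End.mul_apply, ih]
    rcases hx : χ x with _ | _
    · rw [List.filter_cons_of_pos (by simpa using hx), List.filter_cons_of_neg (by simp [hx])]
      rfl
    · rw [sideOp_right_semiApply, sideOp_right_vac, List.filter_cons_of_neg (by simp [hx]),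
        List.filter_cons_of_pos (by simpa using hx), List.reverse_cons, ← List.append_assoc,
        List.map_append (l₁ := _ ++ _), semiApply_append]
      rfl

variable {A : Type*} [Ring A] [Algebra ℂ A] {ε : B ⊗[ℂ] Bᵐᵒᵖ →ₐ[ℂ] A} {E : A →ₗ[ℂ] B}
  {f : A →ₐ[ℂ] Module.End ℂ (Fock B K)} {π : Setoid (Fin n)}

open scoped Classical in
/-- The expectation of the product over a block, in terms of labelled letters. -/
theorem expectation_blockProd (hE : ∀ x, E x = vacProj B K (f x (vac B K 1))) {Z : Fin n → A}
    (hZ : ∀ k, f (Z k) = sideOp η (χ k) (d k)) (i : Fin n) :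
    E (blockProd π Z i) = semiMoment (blockCovariance η π)
      (((chiList χ).filter fun x => π i x).map (labelled d)) := by
  rw [semiMoment_relabel (s := fun k => π i k.2) (g := Prod.fst) (η := η), hE, blockProd,
    map_list_prod, List.map_map, semiMoment]
  · have h := prod_sideOp_vac (η := η) (χ := χ) (d := d)
      ((List.finRange n).filter fun x => π i x)
    have h2 : (⇑f ∘ Z) = fun x => sideOp η (χ x) (d x) := funext hZ
    rw [h2, h, List.map_map]
    congr 2
    rw [chiList, List.filter_append, List.filter_reverse, List.filter_filter, List.filter_filter,
      List.filter_filter, List.filter_filter]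
    simp only [Bool.and_comm]
    rfl
  · intro k j hk hj
    exact if_pos (π.trans (π.symm hk) hj)
  · intro k j hk hj
    exact if_neg fun h => hj (π.trans hk h)
  · intro z hz
    obtain ⟨x, hx, rfl⟩ := List.mem_map.1 hz
    exact of_decide_eq_true (List.mem_filter.1 hx).2

/-- If in the list no element with `q` precedes one with `p`, filtering by `p` or `q` appends the
two filtered lists. -/
theorem filter_or_eq_append {α : Type*} (p q : α → Bool) {l : List α}
    (h : l.Pairwise fun a b => q a = true → p b = true → False)
    (hpq : ∀ a ∈ l, p a = true → q a = false) :
    l.filter (fun a => p a || q a) = l.filter p ++ l.filter q := by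
  induction l with
  | nil => rfl
  | cons a l ih =>
    rw [List.pairwise_cons] at h
    have ih := ih h.2 fun b hb => hpq b (List.mem_cons_of_mem _ hb)
    rcases hp : p a with _ | _
    · rcases hq : q a with _ | _
      · rw [List.filter_cons_of_neg (by simp [hp, hq]), List.filter_cons_of_neg (by simp [hp]),
          List.filter_cons_of_neg (by simp [hq]), ih]
      · have h0 : l.filter p = [] :=
          List.filter_eq_nil_iff.2 fun b hb hb' => h.1 b hb hq hb'
        rw [List.filter_cons_of_pos (by simp [hq]), List.filter_cons_of_neg (by simp [hp]),
          List.filter_cons_of_pos hq, ih, h0]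
        rfl
    · have hq := hpq a List.mem_cons_self hp
      rw [List.filter_cons_of_pos (by simp [hp]), List.filter_cons_of_pos hp,
        List.filter_cons_of_neg (by simp [hq]), ih]
      rfl

theorem mem_chiList (x : Fin n) : x ∈ chiList χ := by
  rcases hx : χ x with _ | _ <;> simp [chiList, hx]

/-- The list `chiList χ` enumerates the indices in the `χ`-order. -/
theorem pairwise_chiList : (chiList χ).Pairwise (chiLT χ) := by
  classical
  have h : (List.finRange n).Pairwise (· < ·) := List.pairwise_lt_finRange n
  rw [chiList, List.pairwise_append, List.pairwise_reverse]
  refine ⟨?_, ?_, fun x hx y hy => ?_⟩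
  · refine (h.filter _).imp_of_mem fun {a b} ha hb hab => ?_
    have ha := (List.mem_filter.1 ha).2
    have hb := (List.mem_filter.1 hb).2
    simp only [decide_eq_true_eq] at ha hb
    rw [chiLT, ha, hb]
    exact hab
  · refine (h.filter _).imp_of_mem fun {a b} ha hb hab => ?_
    have ha := (List.mem_filter.1 ha).2
    have hb := (List.mem_filter.1 hb).2
    simp only [decide_eq_true_eq] at ha hb
    rw [chiLT, ha, hb]
    exact hab
  · have hx := (List.mem_filter.1 hx).2
    have hy := (List.mem_filter.1 (List.mem_reverse.1 hy)).2
    simp only [decide_eq_true_eq] at hx hy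
    rw [chiLT, hx, hy]
    trivial

theorem chiLT_asymm {x y : Fin n} (h : chiLT χ x y) (h' : chiLT χ y x) : False := by
  unfold chiLT at h h'
  rcases hx : χ x with _ | _ <;> rcases hy : χ y with _ | _ <;> simp only [hx, hy] at h h'
  · exact lt_asymm h h'
  · exact lt_asymm h h'

theorem nodup_chiList : (chiList χ).Nodup :=
  pairwise_chiList.imp fun h h' => by
    subst h'
    exact chiLT_asymm h h

open scoped Classical in
/-- Removing blocks one after the other computes the moment of the words whose letters are
labelled by the blocks: by the non-crossing condition the block to be removed is an interval of
what is left, and by freeness it may be replaced by its expectation. -/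
theorem reduceBlocks_eq (hE : ∀ x, E x = vacProj B K (f x (vac B K 1)))
    (hL : ∀ b, f (leftB ε b) = fockLeft B K b) (hR : ∀ b, f (rightB ε b) = rmul B K b)
    (hπ : IsBiNonCrossing χ π) (r s : List (Fin n)) (hr : r ≠ []) (hrs : chiList χ = r.reverse ++ s)
    (Z : Fin n → A) (d : Fin n → B × K × B) (hZ : ∀ k, f (Z k) = sideOp η (χ k) (d k)) :
    reduceBlocks ε E χ π r Z = semiMoment (blockCovariance η π)
      (((chiList χ).filter fun x => ∃ k ∈ r, π x k).map (labelled d)) := by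
  induction r generalizing s Z d with
  | nil => exact absurd rfl hr
  | cons i r ih =>
    rcases r with _ | ⟨p, l⟩
    · rw [reduceBlocks, expectation_blockProd hE hZ]
      congr 3
      ext x
      simp only [List.mem_singleton, exists_eq_left, decide_eq_decide]
      exact ⟨π.symm, π.symm⟩
    rw [reduceBlocks]
    split_ifs with hi
    · -- the block of `i` is an interval of the list of the remaining indices
      have hpw := pairwise_chiList (χ := χ)
      have hnd := nodup_chiList (χ := χ)
      rw [hrs, List.reverse_cons] at hpw hnd
      have hsplit : ∀ P : Fin n → Bool, (∀ k ∈ p :: l, P k = true) → P i = false →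
          (chiList χ).filter P = (p :: l).reverse ++ s.filter P := by
        intro P h1 h2
        rw [hrs, List.reverse_cons, List.filter_append, List.filter_append,
          List.filter_eq_self.2 fun k hk => h1 k (List.mem_reverse.1 hk),
          List.filter_cons_of_neg (by simp [h2]), List.filter_nil, List.append_nil]
      have hV : (chiList χ).filter (fun x => decide (π i x)) =
          i :: s.filter (fun x => decide (π i x)) := by
        have h1 : (p :: l).reverse.filter (fun x => decide (π i x)) = [] :=
          List.filter_eq_nil_iff.2 fun k hk => by
            simpa only [decide_eq_true_eq] using hi k (List.mem_reverse.1 hk)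
        rw [hrs, List.reverse_cons, List.filter_append, List.filter_append, h1,
          List.filter_cons_of_pos (by simp)]
        rfl
      have hrem : (chiList χ).filter (fun x => decide (∃ k ∈ i :: p :: l, π x k)) =
          (p :: l).reverse ++ (i :: s.filter (fun x => decide (π i x))) ++
            s.filter (fun x => decide (∃ k ∈ p :: l, π x k)) := by
        have h1 : (fun x => decide (∃ k ∈ i :: p :: l, π x k)) =
            fun x => decide (π i x) || decide (∃ k ∈ p :: l, π x k) := by
          funext x
          rw [← Bool.decide_or, decide_eq_decide, List.exists_mem_cons_iff]
          exact or_congr_left ⟨π.symm, π.symm⟩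
        have h2 : s.filter (fun x => decide (π i x) || decide (∃ k ∈ p :: l, π x k)) =
            s.filter (fun x => decide (π i x)) ++
              s.filter (fun x => decide (∃ k ∈ p :: l, π x k)) := by
          refine filter_or_eq_append _ _ ?_ ?_
          · rw [List.pairwise_append, List.pairwise_append] at hpw
            obtain ⟨⟨-, -, h3⟩, h4, h5⟩ := hpw
            refine h4.imp_of_mem fun {a b} ha hb hab h6 h7 => ?_
            obtain ⟨k, hk, hak⟩ := of_decide_eq_true h6
            exact hi k hk (π.symm (hπ k i a b (h3 k (List.mem_reverse.2 hk) i (by simp))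
              (h5 i (by simp) a ha) hab (π.symm hak) (of_decide_eq_true h7)))
          · intro a _ h6
            refine decide_eq_false ?_
            rintro ⟨k, hk, hak⟩
            exact hi k hk (π.trans (of_decide_eq_true h6) hak)
        have h3 : (p :: l).reverse.filter (fun x => decide (π i x) ||
            decide (∃ k ∈ p :: l, π x k)) = (p :: l).reverse :=
          List.filter_eq_self.2 fun k hk => by
            have : ∃ k' ∈ p :: l, π k k' := ⟨k, List.mem_reverse.1 hk, π.refl k⟩
            simp only [this, decide_true, Bool.or_true]
        rw [h1, hrs, List.reverse_cons, List.filter_append, List.filter_append, h3,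
          List.filter_cons_of_pos (by simp), List.filter_nil, h2]
        simp
      have hrem' := hsplit (fun x => decide (∃ k ∈ p :: l, π x k))
        (fun k hk => decide_eq_true ⟨k, hk, π.refl k⟩)
        (decide_eq_false fun ⟨k, hk, hik⟩ => hi k hk hik)
      set c := E (blockProd π Z i) with hc
      have hc' := hc.trans (expectation_blockProd (π := π) hE hZ i)
      rw [hV] at hc'
      let d' : Fin n → B × K × B :=
        Function.update d p ((d p).1, (d p).2.1, (d p).2.2 * c)
      rw [ih (i :: s) (by simp) (by rw [hrs]; simp) _ d' ?_, hrem, hrem']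
      · have hp : p ∉ l.reverse ++ s.filter (fun x => decide (∃ k ∈ p :: l, π x k)) := by
          simp only [List.reverse_cons, List.append_assoc, List.cons_append, List.nil_append] at hnd
          rw [List.nodup_middle, List.nodup_cons] at hnd
          intro h
          apply hnd.1
          rcases List.mem_append.1 h with h | h
          · exact List.mem_append_left _ h
          · exact List.mem_append_right _ (List.mem_cons_of_mem _ (List.mem_of_mem_filter h))
        have hd' : ∀ x, x ≠ p → labelled d' x = labelled d x := fun x hx => by
          rw [labelled, labelled]
          simp only [d', Function.update_of_ne hx]
        have hl1 : (l.reverse.map (labelled d')) = l.reverse.map (labelled d) :=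
          List.map_congr_left fun x hx => hd' x fun h => hp (List.mem_append_left _ (h ▸ hx))
        have hl2 : ((s.filter (fun x => decide (∃ k ∈ p :: l, π x k))).map (labelled d')) =
            (s.filter (fun x => decide (∃ k ∈ p :: l, π x k))).map (labelled d) :=
          List.map_congr_left fun x hx => hd' x fun h => hp (List.mem_append_right _ (h ▸ hx))
        rw [List.map_append, List.map_append (l₁ := (p :: l).reverse ++ _),
          List.map_append (l₁ := (p :: l).reverse),
          semiMoment_append_of_free (s := fun k => decide (π i k.2)), ← hc', List.reverse_cons,
          List.map_append, List.map_append, hl1, hl2, semiMoment, semiApply_append,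
          semiApply_append, semiApply_append]
        · congr 2
          simp only [List.map_cons, List.map_nil, semiApply_cons, semiOp_apply]
          simp only [labelled, d', Function.update_self]
          rw [← fockLeft_mul_apply]
          rfl
        · intro k j hkj
          refine if_neg fun h => hkj ?_
          rw [decide_eq_decide]
          exact ⟨fun h' => π.trans h' h, fun h' => π.trans h' (π.symm h)⟩
        · intro z hz
          obtain ⟨x, hx, rfl⟩ := List.mem_map.1 hz
          exact decide_eq_false (hi x (List.mem_reverse.1 hx))
        · intro z hz
          obtain ⟨x, hx, rfl⟩ := List.mem_map.1 hz
          refine decide_eq_true ?_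
          rcases List.mem_cons.1 hx with rfl | hx
          · exact π.refl _
          · exact of_decide_eq_true (List.mem_filter.1 hx).2
        · intro z hz
          obtain ⟨x, hx, rfl⟩ := List.mem_map.1 hz
          obtain ⟨k, hk, hxk⟩ := of_decide_eq_true (List.mem_filter.1 hx).2
          exact decide_eq_false fun h => hi k hk (π.trans h hxk)
      · intro k
        rcases eq_or_ne k p with rfl | hk
        · simp only [d', Function.update_self]
          rcases hk : χ k with _ | _
          · simp only [map_mul, hZ, hk, hL]
            refine LinearMap.ext fun v => ?_
            simp only [sideOp, Module.End.mul_apply, semiOp_apply, fockLeft_mul_apply]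
          · simp only [map_mul, hZ, hk, hR]
            refine LinearMap.ext fun v => ?_
            simp only [sideOp, Module.End.mul_apply, rmul_mul_apply]
        · simp only [d', Function.update_of_ne hk, hZ]
    · rw [ih (i :: s) (by simp) (by rw [hrs]; simp) Z d hZ]
      congr 3
      funext x
      rw [decide_eq_decide, List.exists_mem_cons_iff (a := i)]
      push Not at hi
      obtain ⟨k, hk, hik⟩ := hi
      refine ⟨Or.inr, ?_⟩
      rintro (h | h)
      · exact ⟨k, hk, π.trans h hik⟩
      · exact h

open scoped Classical in
/-- The moment function at `π` is a moment of the word in `χ`-order, for the covariance that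
separates the blocks of `π`. -/
theorem bifreeMoment_eq (hE : ∀ x, E x = vacProj B K (f x (vac B K 1)))
    (hL : ∀ b, f (leftB ε b) = fockLeft B K b) (hR : ∀ b, f (rightB ε b) = rmul B K b)
    (hn : n ≠ 0) (π : BNC χ) {Z : Fin n → A} (hZ : ∀ k, f (Z k) = sideOp η (χ k) (d k)) :
    bifreeMoment ε E χ π Z =
      semiMoment (blockCovariance η π.1) ((chiList χ).map (labelled d)) := by
  have h0 : (chiList χ).reverse ≠ [] := by
    intro h
    have h1 := mem_chiList (χ := χ) ⟨0, Nat.pos_of_ne_zero hn⟩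
    rw [List.reverse_eq_nil_iff.1 h] at h1
    exact absurd h1 List.not_mem_nil
  rw [bifreeMoment, reduceBlocks_eq hE hL hR π.2 _ [] h0 (by simp) Z d hZ,
    List.filter_eq_self.2 fun x hx => decide_eq_true ⟨x, List.mem_reverse.2 hx, π.1.refl x⟩]

end BiFreeMoments

/-! ### Vanishing of the cumulants -/

section Cumulants

variable {B : Type u} [Ring B] [Algebra ℂ B] {K : Type} {n : ℕ}

/-- The words `b_0 Z_{k_1} b_1 ⋯ Z_{k_m} b_m` whose letters carry the given list of labels. -/
inductive IsLabelledWord : List (Fin n) → Fock B (K × Fin n) → Prop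
  | vac (b : B) : IsLabelledWord [] (vac B _ b)
  | cons (b : B) (k : K) (x : Fin n) (t : List (Fin n)) (w : Fock B (K × Fin n))
      (h : IsLabelledWord t w) :
      IsLabelledWord (x :: t) (fockLeft B _ b (leftCreate B (k, x) w))

theorem IsLabelledWord.left {t : List (Fin n)} {w : Fock B (K × Fin n)} (h : IsLabelledWord t w)
    (c : B) : IsLabelledWord t (fockLeft B _ c w) := by
  cases h with
  | vac b =>
    rw [fockLeft_vac]
    exact .vac _
  | cons b k x t w h =>
    rw [fockLeft_mul_apply]
    exact .cons _ k x t w h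

/-- The list `l` is split into pairs `P` and remaining indices `t`. Unless there are no pairs, two
indices that are neighbours in `l` form a pair. -/
structure IsPairing (l : List (Fin n)) (P : List (Fin n × Fin n)) (t : List (Fin n)) : Prop where
  perm : (P.flatMap (fun q => [q.1, q.2]) ++ t).Perm l
  adjacent : (P = [] ∧ t = l) ∨ ∃ x y l₁ l₂, (x, y) ∈ P ∧ l = l₁ ++ x :: y :: l₂

open scoped Classical in
/-- The sums of the functions `π ↦ [P ≤ π] w`, for a pairing `(P, t)` of `l` and a word `w` with
labels `t`. -/
def pairingCone (B : Type u) [Ring B] [Algebra ℂ B] (K : Type) (l : List (Fin n)) :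
    AddSubmonoid (Setoid (Fin n) → Fock B (K × Fin n)) :=
  AddSubmonoid.closure {f | ∃ P t w, IsPairing l P t ∧ IsLabelledWord t w ∧
    f = fun π => if ∀ q ∈ P, π q.1 q.2 then w else 0}

variable {η : K → K → B →ₗ[ℂ] B}

/-- The operator `S` at the index `x` either creates a letter labelled `x`, or contracts `x`
with the first label `y` of the word, which is possible only if `x` and `y` are in the same
block. The first pair to be formed consists of neighbours. -/
theorem semiOp_mem_pairingCone {l : List (Fin n)} {f : Setoid (Fin n) → Fock B (K × Fin n)}
    (hf : f ∈ pairingCone B K l) (d : Fin n → B × K × B) (x : Fin n) :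
    (fun π => semiOp (blockCovariance η π) (labelled d x) (f π)) ∈ pairingCone B K (x :: l) := by
  classical
  induction hf using AddSubmonoid.closure_induction with
  | zero =>
    convert zero_mem (pairingCone B K (x :: l)) using 1
    funext π
    exact map_zero _
  | add f g _ _ hf hg =>
    convert add_mem hf hg using 1
    funext π
    exact map_add _ _ _
  | mem f hf =>
    obtain ⟨P, t, w, hP, hw, rfl⟩ := hf
    obtain ⟨b, k, b', hd⟩ : ∃ b k b', d x = (b, k, b') := ⟨_, _, _, rfl⟩
    have h1 : (fun π : Setoid (Fin n) => if ∀ q ∈ P, π q.1 q.2 then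
        fockLeft B _ b (leftCreate B (k, x) (fockLeft B _ b' w)) else 0) ∈
          pairingCone B K (x :: l) := by
      refine AddSubmonoid.subset_closure ⟨P, x :: t, _, ⟨?_, ?_⟩, .cons _ _ _ _ _ (hw.left b'),
        rfl⟩
      · exact List.perm_middle.trans (hP.perm.cons x)
      · rcases hP.adjacent with ⟨h, rfl⟩ | ⟨y, z, l₁, l₂, h, rfl⟩
        · exact Or.inl ⟨h, rfl⟩
        · exact Or.inr ⟨y, z, x :: l₁, l₂, h, rfl⟩
    have h2 : (fun π : Setoid (Fin n) => if ∀ q ∈ P, π q.1 q.2 then fockLeft B _ b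
        (leftAnnih (blockCovariance η π) (k, x) (fockLeft B _ b' w)) else 0) ∈
          pairingCone B K (x :: l) := by
      cases hw with
      | vac c =>
        convert zero_mem (pairingCone B K (x :: l)) using 1
        funext π
        rw [fockLeft_vac, leftAnnih_vac, map_zero, ite_self]
        rfl
      | cons c j y t w hw =>
        refine AddSubmonoid.subset_closure ⟨(x, y) :: P, t,
          fockLeft B _ b (fockLeft B _ (η k j (b' * c)) w), ⟨?_, ?_⟩, (hw.left _).left _, ?_⟩
        · have h := hP.perm
          rw [List.flatMap_cons]
          exact (List.perm_middle.symm.trans h).cons x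
        · refine Or.inr ?_
          rcases hP.adjacent with ⟨h, rfl⟩ | ⟨y', z, l₁, l₂, h, rfl⟩
          · exact ⟨x, y, [], t, List.mem_cons_self, rfl⟩
          · exact ⟨y', z, x :: l₁, l₂, List.mem_cons_of_mem _ h, rfl⟩
        · funext π
          rw [fockLeft_mul_apply, leftAnnih_cons, blockCovariance]
          simp only [List.forall_mem_cons]
          by_cases hxy : π x y
          · simp only [hxy, if_true, true_and]
          · simp [hxy]
    convert add_mem h1 h2 using 1
    funext π
    have hz : labelled d x = (b, (k, x), b') := by rw [labelled, hd]
    by_cases hPπ : ∀ q ∈ P, π q.1 q.2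
    · simp only [Pi.add_apply, if_pos hPπ, semiOp_apply, hz, lsemi_apply, map_add]
    · simp only [Pi.add_apply, if_neg hPπ, map_zero, add_zero]

theorem semiApply_mem_pairingCone (d : Fin n → B × K × B) (l : List (Fin n)) :
    (fun π => semiApply (blockCovariance η π) (l.map (labelled d)) (vac B _ 1)) ∈
      pairingCone B K l := by
  classical
  induction l with
  | nil =>
    refine AddSubmonoid.subset_closure ⟨[], [], _, ⟨List.Perm.refl _, Or.inl ⟨rfl, rfl⟩⟩, .vac 1,
      ?_⟩
    funext π
    rw [if_pos fun q hq => absurd hq List.not_mem_nil]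
    rfl
  | cons x l ih => exact semiOp_mem_pairingCone ih d x

variable {χ : Fin n → Side}

theorem isBiNonCrossing_sInf {S : Set (Setoid (Fin n))} (hS : ∀ σ ∈ S, IsBiNonCrossing χ σ) :
    IsBiNonCrossing χ (sInf S) := fun v₁ w₁ v₂ w₂ h1 h2 h3 h4 h5 σ hσ =>
  hS σ hσ v₁ w₁ v₂ w₂ h1 h2 h3 (h4 σ hσ) (h5 σ hσ)

open scoped Classical in
/-- The bi-non-crossing partitions that join the given pairs form an interval `[c, 1_χ]`, so that
the sum of the values of the Möbius function vanishes unless `c = 1_χ`. -/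
theorem sum_moebiusBNC_eq_zero {P : List (Fin n × Fin n)} {π₀ : BNC χ} (h0 : π₀ ≠ BNC.one χ)
    (hP : ∀ q ∈ P, π₀.1 q.1 q.2) :
    ∑ σ : BNC χ with σ ≤ BNC.one χ,
      (if ∀ q ∈ P, σ.1 q.1 q.2 then moebiusBNC χ σ (BNC.one χ) else 0) = 0 := by
  let c : BNC χ := ⟨sInf {σ | IsBiNonCrossing χ σ ∧ ∀ q ∈ P, σ q.1 q.2},
    isBiNonCrossing_sInf fun σ hσ => hσ.1⟩
  have hc : ∀ σ : BNC χ, (∀ q ∈ P, σ.1 q.1 q.2) ↔ c ≤ σ := by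
    intro σ
    refine ⟨fun h => sInf_le (a := σ.1) ⟨σ.2, h⟩, fun h q hq => ?_⟩
    exact h fun s hs => hs.2 q hq
  have hc1 : c ≠ BNC.one χ := by
    intro h
    refine h0 (le_antisymm (fun _ _ _ => trivial) ?_)
    rw [← h]
    exact (hc π₀).1 hP
  rw [← Finset.sum_filter, Finset.filter_filter]
  have h := IncidenceAlgebra.sum_Icc_mu_left (𝕜 := ℤ) c (BNC.one χ)
  rw [if_neg hc1] at h
  rw [← h]
  refine Finset.sum_congr ?_ fun σ _ => rfl
  ext σ
  rw [Finset.mem_filter, Finset.mem_Icc, hc σ, and_comm (a := σ ≤ _)]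
  simp

/-- The partition into two neighbours in the `χ`-order and the rest. -/
theorem isBiNonCrossing_pair {x y : Fin n} {l₁ l₂ : List (Fin n)}
    (h : chiList χ = l₁ ++ x :: y :: l₂) :
    IsBiNonCrossing χ (Setoid.ker fun a => a = x ∨ a = y) := by
  have hpw := pairwise_chiList (χ := χ)
  rw [h, List.pairwise_append, List.pairwise_cons, List.pairwise_cons] at hpw
  obtain ⟨-, ⟨h1, h2, -⟩, h3⟩ := hpw
  have key : ∀ a b c, chiLT χ a b → chiLT χ b c → (a = x ∨ a = y) → (c = x ∨ c = y) →
      (b = x ∨ b = y) := by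
    intro a b c hab hbc ha hc
    have hb := mem_chiList (χ := χ) b
    rw [h, List.mem_append, List.mem_cons, List.mem_cons] at hb
    rcases hb with hb | hb | hb | hb
    · exfalso
      rcases ha with rfl | rfl
      · exact chiLT_asymm hab (h3 b hb _ (by simp))
      · exact chiLT_asymm hab (h3 b hb _ (by simp))
    · exact Or.inl hb
    · exact Or.inr hb
    · exfalso
      rcases hc with rfl | rfl
      · exact chiLT_asymm hbc (h1 b (List.mem_cons_of_mem _ hb))
      · exact chiLT_asymm hbc (h2 b hb)
  intro v₁ w₁ v₂ w₂ hvw hwv hvw' hv hw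
  rw [Setoid.ker_def] at *
  refine propext ⟨fun h => key v₁ w₁ v₂ hvw hwv h (hv ▸ h), fun h => ?_⟩
  rw [hv]
  exact key w₁ v₂ w₂ hwv hvw' h (hw ▸ h)

/-- A pairing of `n ≠ 2` indices contains a pair of neighbours, and is therefore below the partition
into this pair and the rest, which is not `1_χ`. -/
theorem exists_ne_one_of_isPairing (hn : n ≠ 0) (hn2 : n ≠ 2) {P : List (Fin n × Fin n)}
    (hP : IsPairing (chiList χ) P []) :
    ∃ π₀ : BNC χ, π₀ ≠ BNC.one χ ∧ ∀ q ∈ P, π₀.1 q.1 q.2 := by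
  rcases hP.adjacent with ⟨-, h⟩ | ⟨x, y, l₁, l₂, hxy, h⟩
  · have h1 := mem_chiList (χ := χ) ⟨0, Nat.pos_of_ne_zero hn⟩
    rw [← h] at h1
    exact absurd h1 List.not_mem_nil
  · have hnd := nodup_chiList (χ := χ)
    have hne : x ≠ y := by
      rw [h] at hnd
      have h1 := (List.nodup_append.1 hnd).2.1
      rw [List.nodup_cons] at h1
      intro hxy
      exact h1.1 (hxy ▸ List.mem_cons_self)
    refine ⟨⟨_, isBiNonCrossing_pair h⟩, fun h0 => ?_, fun q hq => ?_⟩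
    · have hall : ∀ z : Fin n, z = x ∨ z = y := fun z => by
        have h1 : (BNC.one χ).1 x z := trivial
        rw [← h0] at h1
        exact (Eq.mp h1 (Or.inl rfl) : z = x ∨ z = y)
      have hcard : (Finset.univ : Finset (Fin n)) = {x, y} := by
        ext z
        simpa using hall z
      have h2 := congrArg Finset.card hcard
      rw [Finset.card_univ, Fintype.card_fin, Finset.card_pair hne] at h2
      exact hn2 h2
    · have hnd' := (hP.perm.nodup_iff).2 hnd
      rw [List.append_nil, List.nodup_flatMap] at hnd'
      rcases eq_or_ne q (x, y) with rfl | hq'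
      · exact propext ⟨fun _ => Or.inr rfl, fun _ => Or.inl rfl⟩
      · have hsymm : Std.Symm (Function.onFun List.Disjoint
            fun q : Fin n × Fin n => [q.1, q.2]) := ⟨fun _ _ h => List.Disjoint.symm h⟩
        have hdis := hnd'.2.forall hq hxy hq'
        have h3 : ∀ a ∈ [q.1, q.2], ¬ (a = x ∨ a = y) := fun a ha h =>
          hdis ha (by simpa using h)
        exact propext ⟨fun h => absurd h (h3 _ (by simp)), fun h => absurd h (h3 _ (by simp))⟩

open scoped Classical in
/-- The Möbius sum of a combination of functions `[P ≤ π] w` vanishes in the vacuum component: there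
`w` has no letters, so that `P` pairs all indices. -/
theorem sum_moebiusBNC_smul_eq_zero (hn : n ≠ 0) (hn2 : n ≠ 2)
    {f : Setoid (Fin n) → Fock B (K × Fin n)} (hf : f ∈ pairingCone B K (chiList χ)) :
    ∑ σ : BNC χ with σ ≤ BNC.one χ, moebiusBNC χ σ (BNC.one χ) • vacProj B _ (f σ.1) = 0 := by
  induction hf using AddSubmonoid.closure_induction with
  | zero => simp
  | add f g _ _ hf hg =>
    simp only [Pi.add_apply, map_add, smul_add, Finset.sum_add_distrib]
    rw [hf, hg, add_zero]
  | mem f hf =>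
    obtain ⟨P, t, w, hP, hw, rfl⟩ := hf
    cases hw with
    | cons b k x t w hw => simp [apply_ite]
    | vac b =>
      obtain ⟨π₀, h1, h2⟩ := exists_ne_one_of_isPairing hn hn2 hP
      have h := congrArg (fun m : ℤ => m • b) (sum_moebiusBNC_eq_zero h1 h2)
      simp only [Finset.sum_smul, zero_smul] at h
      rw [← h]
      refine Finset.sum_congr rfl fun σ _ => ?_
      by_cases hσ : ∀ q ∈ P, σ.1 q.1 q.2
      · simp only [if_pos hσ, vacProj_vac]
      · simp only [if_neg hσ, map_zero, smul_zero, zero_smul]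

variable {A : Type*} [Ring A] [Algebra ℂ A] {ε : B ⊗[ℂ] Bᵐᵒᵖ →ₐ[ℂ] A} {E : A →ₗ[ℂ] B}
  {f : A →ₐ[ℂ] Module.End ℂ (Fock B K)} {d : Fin n → B × K × B}

theorem bifreeCumulant_eq_zero (hE : ∀ x, E x = vacProj B K (f x (vac B K 1)))
    (hL : ∀ b, f (leftB ε b) = fockLeft B K b) (hR : ∀ b, f (rightB ε b) = rmul B K b)
    (hn : n ≠ 0) (hn2 : n ≠ 2) {Z : Fin n → A} (hZ : ∀ k, f (Z k) = sideOp η (χ k) (d k)) :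
    bifreeCumulant ε E χ (BNC.one χ) Z = 0 := by
  rw [bifreeCumulant, ← sum_moebiusBNC_smul_eq_zero hn hn2
    (semiApply_mem_pairingCone (η := η) d (chiList χ))]
  refine Finset.sum_congr rfl fun σ _ => ?_
  rw [bifreeMoment_eq hE hL hR hn σ hZ]
  rfl

theorem semiMoment_pair (η : K → K → B →ₗ[ℂ] B) (z z' : B × K × B) :
    semiMoment η [z, z'] = z.1 * η z.2.1 z'.2.1 (z.2.2 * z'.1) * z'.2.2 := by
  rw [semiMoment, semiApply_cons, semiApply_cons, semiOp_apply, semiOp_apply]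
  change vacProj B K (fockLeft B K _ (lsemi η _ (fockLeft B K _ (fockLeft B K _
    (lsemi η _ (fockLeft B K _ (vac B K 1))))))) = _
  rw [fockLeft_vac, lsemi_vac, fockLeft_mul_apply, lsemi_apply, leftAnnih_cons, fockLeft_vac,
    map_add, map_add, vacProj_left, vacProj_create, fockLeft_vac, vacProj_vac]
  simp [mul_assoc]

/-- The cumulants of order two. -/
theorem bifreeCumulant_two {χ : Fin 2 → Side} {d : Fin 2 → B × K × B}
    (hE : ∀ x, E x = vacProj B K (f x (vac B K 1)))
    (hL : ∀ b, f (leftB ε b) = fockLeft B K b) (hR : ∀ b, f (rightB ε b) = rmul B K b)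
    {Z : Fin 2 → A} (hZ : ∀ k, f (Z k) = sideOp η (χ k) (d k)) {x y : Fin 2}
    (hxy : chiList χ = [x, y]) :
    bifreeCumulant ε E χ (BNC.one χ) Z =
      (d x).1 * η (d x).2.1 (d y).2.1 ((d x).2.2 * (d y).1) * (d y).2.2 := by
  classical
  have h1 : ∀ σ : BNC χ, bifreeMoment ε E χ σ Z = if σ = BNC.one χ then
      (d x).1 * η (d x).2.1 (d y).2.1 ((d x).2.2 * (d y).1) * (d y).2.2 else 0 := by
    intro σ
    have hσ : σ = BNC.one χ ↔ σ.1 x y := by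
      refine ⟨fun h => h ▸ trivial, fun h => ?_⟩
      refine le_antisymm (fun _ _ _ => trivial) fun a b _ => ?_
      have ha := mem_chiList (χ := χ) a
      have hb := mem_chiList (χ := χ) b
      rw [hxy, List.mem_pair] at ha hb
      rcases ha with rfl | rfl <;> rcases hb with rfl | rfl
      · exact σ.1.refl _
      · exact h
      · exact σ.1.symm h
      · exact σ.1.refl _
    rw [bifreeMoment_eq hE hL hR two_ne_zero σ hZ, hxy, List.map_cons, List.map_cons,
      List.map_nil, semiMoment_pair, labelled, labelled, blockCovariance]
    simp only [hσ]
    split_ifs <;> simp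
  rw [bifreeCumulant]
  simp only [h1, smul_ite, smul_zero]
  rw [Finset.sum_ite_eq' _ _, if_pos (by simp), moebiusBNC, IncidenceAlgebra.mu_self, one_smul]

end Cumulants

/-! ### The cumulants of the generators -/

section Generators

variable {B : Type u} [Ring B] [Algebra ℂ B] {I J : Type} {η : I ⊕ J → I ⊕ J → B →ₗ[ℂ] B}

theorem val_leftB (b : B) : (biSemiAlgebra η).val (leftB (biSemiEps η) b) =
    fockLeft B (I ⊕ J) b :=
  congrArg Subtype.val (leftB_biSemiEps b)

theorem val_rightB (b : B) : (biSemiAlgebra η).val (rightB (biSemiEps η) b) =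
    rmul B (I ⊕ J) b :=
  congrArg Subtype.val (rightB_biSemiEps b)

theorem val_semiS (i : I) : (biSemiAlgebra η).val (semiS η i) =
    sideOp η .left (1, Sum.inl i, 1) := by
  rw [sideOp, semiOp, map_one, one_mul, mul_one]
  rfl

theorem val_semiD (j : J) : (biSemiAlgebra η).val (semiD η j) =
    sideOp η .right (1, Sum.inr j, 1) := by
  rw [sideOp, show rmul B (I ⊕ J) 1 = 1 from map_one (fockRight B (I ⊕ J)), one_mul, mul_one]
  rfl

theorem val_semiS_mul (i : I) (b : B) :
    (biSemiAlgebra η).val (semiS η i * leftB (biSemiEps η) b) =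
      sideOp η .left (1, Sum.inl i, b) := by
  rw [map_mul, val_leftB, sideOp, semiOp, map_one, one_mul]
  rfl

theorem val_semiD_mul (j : J) (b : B) :
    (biSemiAlgebra η).val (semiD η j * rightB (biSemiEps η) b) =
      sideOp η .right (b, Sum.inr j, 1) := by
  rw [map_mul, val_rightB, sideOp, show rmul B (I ⊕ J) 1 = 1 from map_one (fockRight B (I ⊕ J)),
    one_mul]
  rfl

theorem biSemiCumulant_eq_zero {n : ℕ} {χ : Fin n → Side} {d : Fin n → B × (I ⊕ J) × B}
    {Z : Fin n → biSemiAlgebra η} (hn : n ≠ 0) (hn2 : n ≠ 2)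
    (hZ : ∀ k, (biSemiAlgebra η).val (Z k) = sideOp η (χ k) (d k)) :
    bifreeCumulant (A := biSemiAlgebra η) (biSemiEps η) (biSemiExpectation η) χ (BNC.one χ) Z =
      0 :=
  bifreeCumulant_eq_zero (A := biSemiAlgebra η) (f := (biSemiAlgebra η).val)
    biSemiExpectation_apply (val_leftB (η := η)) (val_rightB (η := η)) hn hn2 hZ

theorem biSemiCumulant_two {χ : Fin 2 → Side} {d : Fin 2 → B × (I ⊕ J) × B}
    {Z : Fin 2 → biSemiAlgebra η}
    (hZ : ∀ k, (biSemiAlgebra η).val (Z k) = sideOp η (χ k) (d k)) {x y : Fin 2}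
    (hxy : chiList χ = [x, y]) :
    bifreeCumulant (A := biSemiAlgebra η) (biSemiEps η) (biSemiExpectation η) χ (BNC.one χ) Z =
      (d x).1 * η (d x).2.1 (d y).2.1 ((d x).2.2 * (d y).1) * (d y).2.2 :=
  bifreeCumulant_two (A := biSemiAlgebra η) (f := (biSemiAlgebra η).val)
    biSemiExpectation_apply (val_leftB (η := η)) (val_rightB (η := η)) hZ hxy

end Generators

end BiFree

end

open BiFree TensorProduct in
theorem mainTheorem8 {B : Type*} [Ring B] [StarRing B] [Algebra ℂ B] [StarModule ℂ B]
    (hB : IsBoundedStarAlgebra B)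
    (τB : B →ₗ[ℂ] ℂ) (hτB : IsState τB) (hτB' : IsTracial τB)
    {I J : Type} [Finite I] [Finite J] [DecidableEq I] [DecidableEq J] [Nonempty (I ⊕ J)]
    (ηl : I → B →ₗ[ℂ] B) (hηl : ∀ i, IsCompletelyPositive (ηl i))
    (ηr : J → B →ₗ[ℂ] B) (hηr : ∀ j, IsCompletelyPositive (ηr j))
    (η : I ⊕ J → I ⊕ J → B →ₗ[ℂ] B) (hη : η = diagCovariance (Sum.elim ηl ηr)) :
    -- the involution of `A`
    (∃ (_ : StarRing (biSemiAlgebra η)) (_ : StarModule ℂ (biSemiAlgebra η)),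
      (∀ i, star (semiS η i) = semiS η i) ∧ (∀ j, star (semiD η j) = semiD η j) ∧
      (∀ i, semiS η i ∈ leftAlgebra (biSemiEps η)) ∧
      (∀ j, semiD η j ∈ rightAlgebra (biSemiEps η)) ∧
      IsAnalyticBBProbabilitySpace (A := biSemiAlgebra η) (biSemiEps η) (biSemiExpectation η)
        (τB ∘ₗ biSemiExpectation η)) ∧
    -- cumulants of order different from two
    (∀ (n : ℕ) (χ : Fin n → Side) (Z : Fin n → biSemiAlgebra η), n ≠ 0 → n ≠ 2 →
      (∀ k, (χ k = Side.left ∧ ∃ (i : I) (b b' : B),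
            Z k = leftB (biSemiEps η) b * semiS η i * leftB (biSemiEps η) b') ∨
          (χ k = Side.right ∧ ∃ (j : J) (b b' : B),
            Z k = rightB (biSemiEps η) b * semiD η j * rightB (biSemiEps η) b')) →
      bifreeCumulant (biSemiEps η) (biSemiExpectation η) χ (BNC.one χ) Z = 0) ∧
    -- cumulants of order two
    (∀ (i₁ i₂ : I) (b : B),
      bifreeCumulant (biSemiEps η) (biSemiExpectation η) ![Side.left, Side.left] (BNC.one _)
        ![semiS η i₁ * leftB (biSemiEps η) b, semiS η i₂] = if i₁ = i₂ then ηl i₁ b else 0) ∧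
    (∀ (j₁ j₂ : J) (b : B),
      bifreeCumulant (biSemiEps η) (biSemiExpectation η) ![Side.right, Side.right] (BNC.one _)
        ![semiD η j₁ * rightB (biSemiEps η) b, semiD η j₂] = if j₁ = j₂ then ηr j₁ b else 0) ∧
    (∀ (i : I) (j : J) (b : B),
      bifreeCumulant (biSemiEps η) (biSemiExpectation η) ![Side.left, Side.right] (BNC.one _)
        ![semiS η i * leftB (biSemiEps η) b, semiD η j] = 0) ∧
    (∀ (i : I) (j : J) (b : B),
      bifreeCumulant (biSemiEps η) (biSemiExpectation η) ![Side.right, Side.left] (BNC.one _)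
        ![semiD η j * rightB (biSemiEps η) b, semiS η i] = 0) := by
  have hηK : ∀ k, IsCompletelyPositive (Sum.elim ηl ηr k) := fun k => by
    rcases k with i | j
    · exact hηl i
    · exact hηr j
  have hη1 : IsHermitianCovariance η := hη ▸ isHermitianCovariance_diagCovariance hB hηK
  have hη2 : IsPositiveCovariance η := hη ▸ isPositiveCovariance_diagCovariance hB hηK
  have hη0 : ∀ i j, η (Sum.inl i) (Sum.inr j) = 0 := fun i j => by
    rw [hη, diagCovariance, if_neg Sum.inl_ne_inr]
  refine ⟨?_, ?_, ?_, ?_, ?_, ?_⟩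
  · obtain ⟨i1, i2, hL, hR, hS, hD⟩ := exists_starRing_biSemiAlgebra hη1
    have hst : IsSemicircularStar η := ⟨hL, hR, hS, hD⟩
    exact ⟨i1, i2, hS, hD, semiS_mem_leftAlgebra hst, semiD_mem_rightAlgebra hst,
      isAnalyticBBProbabilitySpace_biSemi hB hst hη1 hη2 hη0 hτB hτB'⟩
  · intro n χ Z hn hn2 hZ
    have hd : ∀ k, ∃ d : B × (I ⊕ J) × B, (biSemiAlgebra η).val (Z k) = sideOp η (χ k) d := by
      intro k
      rcases hZ k with ⟨hk, i, b, b', h⟩ | ⟨hk, j, b, b', h⟩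
      · refine ⟨(b, Sum.inl i, b'), ?_⟩
        rw [hk, h, map_mul, map_mul, val_leftB, val_leftB]
        rfl
      · -- a right operator multiplies words from the right, so its coefficients change places
        refine ⟨(b', Sum.inr j, b), ?_⟩
        rw [hk, h, map_mul, map_mul, val_rightB, val_rightB]
        rfl
    choose d hd using hd
    exact biSemiCumulant_eq_zero hn hn2 hd
  · intro i₁ i₂ b
    rw [biSemiCumulant_two (x := 0) (y := 1)
      (d := ![(1, Sum.inl i₁, b), (1, Sum.inl i₂, 1)])
      (fun k => ?_) (by simp [chiList, List.finRange_succ])]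
    · by_cases h : i₁ = i₂ <;> simp [hη, diagCovariance, h]
    · fin_cases k
      · exact val_semiS_mul i₁ b
      · exact val_semiS i₂
  · intro j₁ j₂ b
    -- right indices are in decreasing order in the `χ`-order
    rw [biSemiCumulant_two (x := 1) (y := 0)
      (d := ![(b, Sum.inr j₁, 1), (1, Sum.inr j₂, 1)])
      (fun k => ?_) (by simp [chiList, List.finRange_succ])]
    · by_cases h : j₁ = j₂
      · simp [hη, diagCovariance, h]
      · simp [hη, diagCovariance, h, Ne.symm h]
    · fin_cases k
      · exact val_semiD_mul j₁ b
      · exact val_semiD j₂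
  · intro i j b
    rw [biSemiCumulant_two (x := 0) (y := 1)
      (d := ![(1, Sum.inl i, b), (1, Sum.inr j, 1)])
      (fun k => ?_) (by simp [chiList, List.finRange_succ])]
    · simp [hη0]
    · fin_cases k
      · exact val_semiS_mul i b
      · exact val_semiD j
  · intro i j b
    -- the `χ`-order lists the left index `1` before the right index `0`
    rw [biSemiCumulant_two (x := 1) (y := 0)
      (d := ![(b, Sum.inr j, 1), (1, Sum.inl i, 1)])
      (fun k => ?_) (by simp [chiList, List.finRange_succ])]
    · simp [hη0]
    · fin_cases k
      · exact val_semiD_mul j b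
      · exact val_semiS i
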